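/- **Setting.** Let $\mathsf Z$ be a Polish space, $d\ge 1$, $\mathrm Q$ a Markov kernel on $\mathsf Z$ with invariant distribution $\pi$, and $\mathbf A:\mathsf Z\to\mathbb R^{d\times d}$, $\mathbf b:\mathsf Z\to\mathbb R^d$ measurable. Let $\bar{\mathbf A}=\int \mathbf A\,d\pi$, $\bar{\mathbf b}=\int \mathbf b\,d\pi$, and assume that: * $-\bar{\mathbf A}$ is Hurwitz; $\theta^\star$ denotes the solution of $\bar{\mathbf A}\theta^\star=\bar{\mathbf b}$; * $C_A=\sup_z\|\mathbf A(z)\|\vee\sup_z\|\mathbf A(z)-\bar{\mathbf A}\|<\infty$, and $\|\varepsilon\|_\infty=\sup_z\|\varepsilon(z)\|<\infty$, where $\varepsilon(z)=(\mathbf A(z)-\bar{\mathbf A})\theta^\star-(\mathbf b(z)-\bar{\mathbf b})$; * for some integer $t_{\rm mix}\ge1$ and all $k\ge1$, $\sup_{z,z'}\tfrac12\|\mathrm Q^k(z,\cdot)-\mathrm Q^k(z',\cdot)\|_{\rm TV}\le(1/4)^{\lfloor k/t_{\rm mix}\rfloor}$. Let $\Sigma_\varepsilon^{(M)}=\mathbb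 E_\pi[\varepsilon(Z_0)\varepsilon(Z_0)^\top]+2\sum_{\ell\ge1}\mathbb E_\pi[\varepsilon(Z_0)\varepsilon(Z_\ell)^\top]$. **Step size.** Let $Q$ be the symmetric positive definite solution of $\bar{\mathbf A}^\top Q+Q\bar{\mathbf A}=\mathrm I$, $\kappa_Q=\lambda_{\max}(Q)/\lambda_{\min}(Q)$, $a=\|Q\|^{-1}/2$, $\alpha_\infty=\tfrac12\|\bar{\mathbf A}\|_Q^{-2}\|Q\|^{-1}\wedge\|Q\|$ (here $\|\cdot\|_Q$ is the operator norm induced by $x\mapsto(x^\top Qx)^{1/2}$), $h=\lceil 8\kappa_Q^{1/2}C_A/a\rceil$, $C_\Gamma=4(\kappa_Q^{1/2}C_A+a/6)^2h$, and $$\alpha^{(M)}_{q,\infty}=\Big(\big[\alpha_\infty\wedge\kappa_Q^{-1/2}C_A^{-1}\wedge\tfrac{a}{6e\kappa_QC_A}\big]h^{-1}\Big)\wedge\frac{a}{12\,C_\Gamma\,q},$$ $$\alpha^{(b)}_{p,\infty}=\Big(\alpha^{(M)}_{p(1+\log d),\infty}\wedge\frac1{1+C_A}\wedge\frac1{ap}\Big)t_{\rm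 mix}^{-1}.$$ **Algorithm.** For $\alpha>0$ and $\theta_0\in\mathbb R^d$ let $\theta_0^{(\alpha)}=\theta_0$, $\theta_k^{(\alpha)}=\theta_{k-1}^{(\alpha)}-\alpha\{\mathbf A(Z_k)\theta_{k-1}^{(\alpha)}-\mathbf b(Z_k)\}$ for $k\ge1$, and, with burn-in $n_0=\lfloor n/2\rfloor$, $\bar\theta_n^{(\alpha)}=(n-n_0)^{-1}\sum_{k=n_0}^{n-1}\theta_k^{(\alpha)}$ and $\bar\theta_n^{(\alpha,\mathsf{RR})}=2\bar\theta_n^{(\alpha)}-\bar\theta_n^{(2\alpha)}$ (same noise sequence in both averages). **Claim.** For every $\delta_0\in(0,1)$ there are a constant $K$ depending only on $\delta_0$ and a constant $C$ depending only on $\delta_0,d,t_{\rm mix},a,\kappa_Q,C_A,\|\varepsilon\|_\infty$ such that for every such problem, every initial distribution $\xi$ of $Z_0$, every $\theta_0\in\mathbb R^d$, every $n\ge t_{\rm mix}$ and every $\delta\in(0,\delta_0]$, with $p=\ln(3e/\delta)$ and $\alpha=\alpha^{(b)}_{p,\infty}n^{-1/2}$, it holds with $\mathbb P_\xi$-probability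 at least $1-\delta$ that $$\|\bar{\mathbf A}(\bar\theta_n^{(\alpha,\mathsf{RR})}-\theta^\star)\|\le K\sqrt{\operatorname{Tr}\Sigma_\varepsilon^{(M)}\log(1/\delta)}\;n^{-1/2}+C\big(1+\log^{3/2}(n)\log^{5/2}(1/\delta)\big)\log(1/\delta)\,n^{-3/4}$$ $$\qquad+\,C\,n^{-1/2}\log(1/\delta)\,\|\theta_0-\theta^\star\|\exp\{-a\,\alpha^{(b)}_{p,\infty}\,n^{1/2}/24\}.$$ -/

import Mathlib

open MeasureTheory ProbabilityTheory
open scoped ENNReal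

noncomputable section

namespace MarkovLSA

/-- The space `ℝ^d` with its Euclidean norm. -/
abbrev Vec (d : ℕ) : Type := EuclideanSpace ℝ (Fin d)

/-! ### Matrices -/

section Matrices

variable {d : ℕ}

/-- The spectral norm of a real square matrix. -/
def opNorm (M : Matrix (Fin d) (Fin d) ℝ) : ℝ :=
  ‖Matrix.toEuclideanCLM (n := Fin d) (𝕜 := ℝ) M‖

/-- The matrix-vector product `M x` in `ℝ^d`. -/
def act (M : Matrix (Fin d) (Fin d) ℝ) (x : Vec d) : Vec d :=
  Matrix.toEuclideanCLM (n := Fin d) (𝕜 := ℝ) M x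

/-- `M` is Hurwitz: all its complex eigenvalues have negative real part. -/
def IsHurwitz (M : Matrix (Fin d) (Fin d) ℝ) : Prop :=
  ∀ μ ∈ spectrum ℂ (M.map (fun x : ℝ => (x : ℂ))), μ.re < 0

/-- `P` is a symmetric positive definite solution of the Lyapunov equation `Mᵀ P + P M = I`. -/
def IsLyapunovSolution (M P : Matrix (Fin d) (Fin d) ℝ) : Prop :=
  P.PosDef ∧ M.transpose * P + P * M = 1

open Classical in
/-- The symmetric positive definite solution of the Lyapunov equation `Mᵀ P + P M = I`
(it exists and is unique when `-M` is Hurwitz). -/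
def lyapunov (M : Matrix (Fin d) (Fin d) ℝ) : Matrix (Fin d) (Fin d) ℝ :=
  if h : ∃ P, IsLyapunovSolution M P then h.choose else 0

/-- The weighted norm `‖x‖_P = (xᵀ P x)^{1/2}`. -/
def wNorm (P : Matrix (Fin d) (Fin d) ℝ) (x : Vec d) : ℝ :=
  Real.sqrt (inner ℝ x (act P x))

/-- The operator norm of `M` induced by `‖·‖_P`. -/
def wOpNorm (P M : Matrix (Fin d) (Fin d) ℝ) : ℝ :=
  sSup {r | ∃ x : Vec d, wNorm P x = 1 ∧ r = wNorm P (act M x)}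

/-- The condition number `λ_max(P) / λ_min(P)` of a symmetric positive definite matrix. -/
def condNumber (P : Matrix (Fin d) (Fin d) ℝ) : ℝ :=
  sSup (spectrum ℝ P) / sInf (spectrum ℝ P)

end Matrices

/-! ### Markov chains -/

section Chains

variable {Z : Type*} [MeasurableSpace Z]

/-- The law on `Z^ℕ` of the Markov chain with kernel `Q` and initial distribution `ξ`. -/
def chainLaw (Q : Kernel Z Z) [IsMarkovKernel Q] (ξ : Measure Z) : Measure (ℕ → Z) :=
  Kernel.trajMeasure (X := fun _ => Z) ξ
    (fun n => Q.comap (fun x : (Π _ : Finset.Iic n, Z) => x ⟨n, Finset.mem_Iic.2 le_rfl⟩)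
      (measurable_pi_apply _))

instance (Q : Kernel Z Z) [IsMarkovKernel Q] (ξ : Measure Z) [IsProbabilityMeasure ξ] :
    IsProbabilityMeasure (chainLaw Q ξ) := by
  unfold chainLaw
  infer_instance

/-- The total variation norm `|μ - ν|(Z)`. -/
def tvNorm (μ ν : Measure Z) [IsFiniteMeasure μ] [IsFiniteMeasure ν] : ℝ≥0∞ :=
  (μ.toSignedMeasure - ν.toSignedMeasure).totalVariation Set.univ

/-- The Dobrushin coefficient of a Markov kernel. -/
def dobrushin (K : Kernel Z Z) [IsMarkovKernel K] : ℝ≥0∞ :=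
  ⨆ (z : Z) (z' : Z), tvNorm (K z) (K z') / 2

instance isMarkovKernel_pow (Q : Kernel Z Z) [IsMarkovKernel Q] (k : ℕ) :
    IsMarkovKernel (Q ^ k) := by
  induction k with
  | zero => rw [pow_zero]; exact inferInstanceAs (IsMarkovKernel Kernel.id)
  | succ k ih => rw [pow_succ]; exact inferInstanceAs (IsMarkovKernel ((Q ^ k) ∘ₖ Q))

end Chains

/-! ### The linear stochastic approximation problem -/

/-- The data of a linear stochastic approximation problem `Ā θ = b̄` driven by a Markov
chain on `Z`: the Markov kernel, a probability measure, and the (measurable) estimates `A(z)` and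
`b(z)` of `Ā` and `b̄`. The assumptions relating them are in `LSA.Assumptions`. -/
structure LSA (Z : Type*) [MeasurableSpace Z] (d : ℕ) where
  Q : Kernel Z Z
  statLaw : Measure Z
  A : Z → Matrix (Fin d) (Fin d) ℝ
  b : Z → Vec d
  Abar : Matrix (Fin d) (Fin d) ℝ
  bbar : Vec d
  markov : IsMarkovKernel Q
  prob : IsProbabilityMeasure statLaw
  measurable_A : ∀ i j, Measurable fun z => A z i j
  measurable_b : Measurable b

attribute [instance] LSA.markov LSA.prob

namespace LSA

variable {Z : Type*} [MeasurableSpace Z] {d : ℕ} (S : LSA Z d)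

/-- The solution `θ⋆` of `Ā θ = b̄`. -/
def thetaStar : Vec d := act S.Abar⁻¹ S.bbar

/-- The centered matrix `A(z) - Ā`. -/
def Atilde (z : Z) : Matrix (Fin d) (Fin d) ℝ := S.A z - S.Abar

/-- The noise `ε(z) = (A(z) - Ā) θ⋆ - (b(z) - b̄)`. -/
def noise (z : Z) : Vec d := act (S.Atilde z) S.thetaStar - (S.b z - S.bbar)

/-- `C_A = sup_z ‖A(z)‖ ∨ sup_z ‖A(z) - Ā‖`. -/
def CA : ℝ := max (⨆ z, opNorm (S.A z)) (⨆ z, opNorm (S.Atilde z))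

/-- `‖ε‖_∞ = sup_z ‖ε(z)‖`. -/
def noiseSup : ℝ := ⨆ z, ‖S.noise z‖

/-- The standing assumptions, with `tmix` a mixing time of the chain. -/
structure Assumptions (tmix : ℕ) : Prop where
  bdd_A : BddAbove (Set.range fun z => opNorm (S.A z))
  bdd_Atilde : BddAbove (Set.range fun z => opNorm (S.Atilde z))
  hurwitz : IsHurwitz (-S.Abar)
  mean_A : ∀ i j, ∫ z, S.A z i j ∂S.statLaw = S.Abar i j
  mean_b : ∫ z, S.b z ∂S.statLaw = S.bbar
  bdd_noise : BddAbove (Set.range fun z => ‖S.noise z‖)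
  invariant : Kernel.Invariant S.Q S.statLaw
  tmix_pos : 1 ≤ tmix
  mixing : ∀ k : ℕ, 1 ≤ k → dobrushin (S.Q ^ k) ≤ (1 / 4 : ℝ≥0∞) ^ (k / tmix)

/-- The covariance
`Σ = E_π[ε(Z_0) ε(Z_0)ᵀ] + 2 ∑_{ℓ ≥ 1} E_π[ε(Z_0) ε(Z_ℓ)ᵀ]`. -/
def noiseCov : Matrix (Fin d) (Fin d) ℝ := Matrix.of fun i j =>
  (∫ ω, S.noise (ω 0) i * S.noise (ω 0) j ∂(chainLaw S.Q S.statLaw)) +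
    2 * ∑' l : ℕ, ∫ ω, S.noise (ω 0) i * S.noise (ω (l + 1)) j ∂(chainLaw S.Q S.statLaw)

/-! #### Step sizes -/

/-- The matrix `Q` solving `Āᵀ Q + Q Ā = I`. -/
def lyap : Matrix (Fin d) (Fin d) ℝ := lyapunov S.Abar

/-- `κ_Q = λ_max(Q) / λ_min(Q)`. -/
def kappa : ℝ := condNumber S.lyap

/-- `a = ‖Q‖⁻¹ / 2`. -/
def a : ℝ := (opNorm S.lyap)⁻¹ / 2

/-- `α_∞ = (1/2) ‖Ā‖_Q⁻² ‖Q‖⁻¹ ∧ ‖Q‖`. -/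
def alphaInf : ℝ :=
  min (1 / 2 * ((wOpNorm S.lyap S.Abar) ^ 2)⁻¹ * (opNorm S.lyap)⁻¹) (opNorm S.lyap)

/-- `⌈8 κ_Q^{1/2} C_A / a⌉`. -/
def blockLen : ℝ := (⌈8 * Real.sqrt S.kappa * S.CA / S.a⌉ : ℤ)

/-- `α_∞^{(M)}`. -/
def alphaInfM : ℝ :=
  min (min S.alphaInf ((Real.sqrt S.kappa)⁻¹ * S.CA⁻¹))
    (S.a / (6 * Real.exp 1 * S.kappa * S.CA)) * S.blockLen⁻¹

/-- `C_Γ = 4 (κ_Q^{1/2} C_A + a/6)² ⌈8 κ_Q^{1/2} C_A / a⌉`. -/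
def CGamma : ℝ := 4 * (Real.sqrt S.kappa * S.CA + S.a / 6) ^ 2 * S.blockLen

/-- `α_{q,∞}^{(M)} = α_∞^{(M)} ∧ (a / (12 C_Γ)) / q`. -/
def alphaM (q : ℝ) : ℝ := min S.alphaInfM (S.a / (12 * S.CGamma) / q)

/-- `α_{p,∞}^{(b)} = (α_{p(1 + log d),∞}^{(M)} ∧ 1/(1 + C_A) ∧ 1/(a p)) / t_mix`. -/
def alphaB (tmix : ℕ) (p : ℝ) : ℝ :=
  min (min (S.alphaM (p * (1 + Real.log d))) (1 / (1 + S.CA))) (1 / (S.a * p)) * (tmix : ℝ)⁻¹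

/-! #### The algorithm -/

/-- `θ_k = θ_{k-1} - α (A(Z_k) θ_{k-1} - b(Z_k))`, along a trajectory `z` of the chain. -/
def iter (α : ℝ) (θ₀ : Vec d) (z : ℕ → Z) : ℕ → Vec d
  | 0 => θ₀
  | k + 1 => iter α θ₀ z k - α • (act (S.A (z (k + 1))) (iter α θ₀ z k) - S.b (z (k + 1)))

/-- The Polyak-Ruppert average `(n - n₀)⁻¹ ∑_{k = n₀}^{n - 1} θ_k`. -/
def prAverage (α : ℝ) (θ₀ : Vec d) (n₀ n : ℕ) (z : ℕ → Z) : Vec d :=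
  ((n : ℝ) - (n₀ : ℝ))⁻¹ • ∑ k ∈ Finset.Ico n₀ n, S.iter α θ₀ z k

/-- The Richardson-Romberg iterate: twice the average for `α` minus the average for `2 α`,
with the same noise sequence. -/
def rrAverage (α : ℝ) (θ₀ : Vec d) (n₀ n : ℕ) (z : ℕ → Z) : Vec d :=
  (2 : ℝ) • S.prAverage α θ₀ n₀ n z - S.prAverage (2 * α) θ₀ n₀ n z

end LSA

end MarkovLSA

end

/-! Write e_k = θ_k − θ⋆. Since Āθ⋆ = b̄, the error obeys e_{k+1} = e_k − β(A(Z_{k+1}) e_k +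
ε(Z_{k+1})) with β = α or β = 2α. Under the mixing condition the series h = ∑ Qˡ f converges for
every bounded centred f, and f(Z_{k+1}) becomes a martingale increment h(Z_{k+1}) − Qh(Z_k) plus a
telescoping term. Applied to A − Ā and ε, and summed over the averaging window (`sum_errIter_eq`),
this writes Ā ∑ e_k as a boundary term of order β⁻¹ sup‖e_k‖, the noise sum −∑ ε(Z_{k+1}), a
martingale transform of e_k, bounded boundary operators applied to e_k, and β times a sum of
operators applied to A e_k + ε. The ε part of the last sum is a bias of order β after averaging. In
twice the α-process minus the (2α)-process it carries the coefficient 2α both times and cancels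
(`sum_rrErr_eq`). What remains, apart from ∑ ε, is controlled by a bound R on the errors over the
window.

The step size satisfies c₀ ≤ αn^{1/2}p ≤ 1/a with c₀ depending only on the allowed constants, and R
is of order exp(−aαn/24)‖e_0‖ + (α(p + log n))^{1/2}. After division by the window length the terms
containing R are at most of order pRn^{-1/2}, which gives the n^{-3/4} remainder and the
exponentially small contribution of the initial condition.

Three probabilistic estimates are needed. The sum of ε obeys a Bernstein inequality
(`measure_sum_mgInc_le`): a second Poisson equation replaces the conditional variances by asymptotic
variances, and convexity of cosh√ (`measure_lt_norm_le`) combines the coordinates with an absolute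
constant in front of the trace, the dimension entering only at lower order. The martingale transform
obeys an Azuma inequality (`measure_sum_mgInc_apply_le`). The bound R comes from moments of order q
≈ p + log n of a quadratic Lyapunov function (`measure_norm_errIter_le`), evaluated at an iterate
corrected by Poisson solutions so that its one-step drift is a contraction plus a martingale
increment plus O(β²). The log n in q pays for a union bound over the window.

These estimates require α(p + log n) to be small. This holds once n^{3/4} exceeds a constant
multiple of p (`step_small`). Otherwise nα is bounded, the errors grow by at most a constant factor,
and the remainder on the right is already of constant order (`crude_bound_le`). Existence of the
Lyapunov matrix is proved by passing to discrete time with the Cayley transform. -/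

set_option linter.unusedSectionVars false

namespace MarkovLSA

/-! ### The trajectory law and its Markov property. -/

section Chain

variable {Z : Type*} [MeasurableSpace Z] {S T : Type*} [MeasurableSpace S] [MeasurableSpace T]

/-- `f` is a measurable function of the first `k + 1` coordinates of the trajectory. -/
def MeasurableUpTo (k : ℕ) (f : (ℕ → Z) → S) : Prop :=
  ∃ g : (Π _ : Finset.Iic k, Z) → S, Measurable g ∧ ∀ ω, f ω = g (Preorder.frestrictLe k ω)

namespace MeasurableUpTo

theorem measurable {k : ℕ} {f : (ℕ → Z) → S} (hf : MeasurableUpTo k f) : Measurable f := by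
  obtain ⟨g, hg, h⟩ := hf
  rw [funext h]
  exact hg.comp (Preorder.measurable_frestrictLe k)

theorem const (k : ℕ) (c : S) : MeasurableUpTo k (fun _ : ℕ → Z => c) :=
  ⟨fun _ => c, measurable_const, fun _ => rfl⟩

theorem eval {j k : ℕ} (h : j ≤ k) : MeasurableUpTo k (fun ω : ℕ → Z => ω j) :=
  ⟨fun x => x ⟨j, Finset.mem_Iic.2 h⟩, measurable_pi_apply _, fun _ => rfl⟩

theorem comp {k : ℕ} {f : (ℕ → Z) → S} (hf : MeasurableUpTo k f) {g : S → T}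
    (hg : Measurable g) : MeasurableUpTo k (fun ω => g (f ω)) := by
  obtain ⟨f', hf', h⟩ := hf
  exact ⟨g ∘ f', hg.comp hf', fun ω => by simp [h]⟩

theorem prodMk {k : ℕ} {f : (ℕ → Z) → S} {g : (ℕ → Z) → T} (hf : MeasurableUpTo k f)
    (hg : MeasurableUpTo k g) : MeasurableUpTo k (fun ω => (f ω, g ω)) := by
  obtain ⟨f', hf', h⟩ := hf
  obtain ⟨g', hg', h'⟩ := hg
  exact ⟨fun x => (f' x, g' x), hf'.prodMk hg', fun ω => by simp [h, h']⟩

theorem mono {j k : ℕ} (hjk : j ≤ k) {f : (ℕ → Z) → S} (hf : MeasurableUpTo j f) :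
    MeasurableUpTo k f := by
  obtain ⟨f', hf', h⟩ := hf
  exact ⟨fun x => f' (Preorder.frestrictLe₂ (π := fun _ => Z) hjk x),
    hf'.comp (Preorder.measurable_frestrictLe₂ (X := fun _ => Z) hjk), fun ω => by rw [h]; rfl⟩

end MeasurableUpTo

variable (Q : Kernel Z Z) [IsMarkovKernel Q] (ξ : Measure Z) [IsProbabilityMeasure ξ]

theorem map_chainLaw_zero : (chainLaw Q ξ).map (fun ω => ω 0) = ξ := by
  have hm : Measurable (fun x : (Π _ : Finset.Iic 0, Z) => x ⟨0, Finset.mem_Iic.2 le_rfl⟩) :=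
    measurable_pi_apply _
  have h : (chainLaw Q ξ).map (fun ω => ω 0) = ((chainLaw Q ξ).map
      (Preorder.frestrictLe (π := fun _ => Z) 0)).map
        (fun x : (Π _ : Finset.Iic 0, Z) => x ⟨0, Finset.mem_Iic.2 le_rfl⟩) := by
    rw [Measure.map_map hm (by fun_prop)]
    rfl
  rw [h, chainLaw, Kernel.trajMeasure, Measure.map_comp _ _ (Preorder.measurable_frestrictLe 0),
    Kernel.traj_map_frestrictLe, Kernel.partialTraj_self, Measure.id_comp,
    Measure.map_map hm (by fun_prop)]
  exact Measure.map_id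

theorem map_chainLaw_succ (k : ℕ) :
    (chainLaw Q ξ).map (fun ω => (Preorder.frestrictLe (π := fun _ => Z) k ω, ω (k + 1))) =
      ((chainLaw Q ξ).map (Preorder.frestrictLe (π := fun _ => Z) k)) ⊗ₘ
        (Q.comap (fun x : (Π _ : Finset.Iic k, Z) => x ⟨k, Finset.mem_Iic.2 le_rfl⟩)
          (measurable_pi_apply _)) :=
  (Kernel.map_frestrictLe_trajMeasure_compProd_eq_map_trajMeasure (X := fun _ => Z)
    (κ := fun n => Q.comap (fun x : (Π _ : Finset.Iic n, Z) => x ⟨n, Finset.mem_Iic.2 le_rfl⟩)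
      (measurable_pi_apply _))).symm

/-- The Markov property, for nonnegative functions. -/
theorem lintegral_chainLaw_succ {k : ℕ} {f : (ℕ → Z) → S} (hf : MeasurableUpTo k f)
    {φ : S → Z → ℝ≥0∞} (hφ : Measurable (Function.uncurry φ)) :
    ∫⁻ ω, φ (f ω) (ω (k + 1)) ∂(chainLaw Q ξ) =
      ∫⁻ ω, ∫⁻ y, φ (f ω) y ∂(Q (ω k)) ∂(chainLaw Q ξ) := by
  obtain ⟨g, hg, h⟩ := hf
  have hφg : Measurable (fun x : (Π _ : Finset.Iic k, Z) × Z => φ (g x.1) x.2) :=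
    hφ.comp ((hg.comp measurable_fst).prodMk measurable_snd)
  have h1 : ∫⁻ ω, φ (f ω) (ω (k + 1)) ∂(chainLaw Q ξ) =
      ∫⁻ x, φ (g x.1) x.2 ∂((chainLaw Q ξ).map
        (fun ω => (Preorder.frestrictLe (π := fun _ => Z) k ω, ω (k + 1)))) := by
    rw [lintegral_map hφg (by fun_prop)]
    simp [h]
  rw [h1, map_chainLaw_succ, Measure.lintegral_compProd hφg, lintegral_map _ (by fun_prop)]
  · simp [h, Kernel.comap_apply]
  · exact hφg.lintegral_kernel_prod_right'

/-- The Markov property, for bounded functions. -/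
theorem integral_chainLaw_succ {k : ℕ} {f : (ℕ → Z) → S} (hf : MeasurableUpTo k f)
    {φ : S → Z → ℝ} (hφ : Measurable (Function.uncurry φ)) {c : ℝ} (hc : ∀ s z, |φ s z| ≤ c) :
    ∫ ω, φ (f ω) (ω (k + 1)) ∂(chainLaw Q ξ) =
      ∫ ω, ∫ y, φ (f ω) y ∂(Q (ω k)) ∂(chainLaw Q ξ) := by
  obtain ⟨g, hg, h⟩ := hf
  have hφg : Measurable (fun x : (Π _ : Finset.Iic k, Z) × Z => φ (g x.1) x.2) :=
    hφ.comp ((hg.comp measurable_fst).prodMk measurable_snd)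
  have h1 : ∫ ω, φ (f ω) (ω (k + 1)) ∂(chainLaw Q ξ) =
      ∫ x, φ (g x.1) x.2 ∂((chainLaw Q ξ).map
        (fun ω => (Preorder.frestrictLe (π := fun _ => Z) k ω, ω (k + 1)))) := by
    rw [integral_map (by fun_prop) hφg.aestronglyMeasurable]
    simp [h]
  have : IsProbabilityMeasure ((chainLaw Q ξ).map (Preorder.frestrictLe (π := fun _ => Z) k)) :=
    Measure.isProbabilityMeasure_map (by fun_prop)
  rw [h1, map_chainLaw_succ, Measure.integral_compProd, integral_map (by fun_prop)]
  · simp [h, Kernel.comap_apply]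
  · exact (StronglyMeasurable.integral_kernel_prod_right'
      hφg.stronglyMeasurable).aestronglyMeasurable
  · exact Integrable.of_bound hφg.aestronglyMeasurable c (.of_forall fun x => hc _ _)

end Chain

/-! ### Mixing and the Poisson equation. -/

section Poisson

variable {Z : Type*} [MeasurableSpace Z] {E : Type*} [NormedAddCommGroup E] [NormedSpace ℝ E]

/-- The Jordan decomposition as an identity between positive measures, so that vector-valued
integrals can be compared without integrating against a signed measure. -/
theorem add_negPart_eq_add_posPart (μ ν : Measure Z) [IsFiniteMeasure μ] [IsFiniteMeasure ν] :
    μ + (μ.toSignedMeasure - ν.toSignedMeasure).toJordanDecomposition.negPart =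
      ν + (μ.toSignedMeasure - ν.toSignedMeasure).toJordanDecomposition.posPart := by
  set s := μ.toSignedMeasure - ν.toSignedMeasure with hs
  have h := s.toSignedMeasure_toJordanDecomposition
  rw [JordanDecomposition.toSignedMeasure, hs, sub_eq_sub_iff_add_eq_add, ← hs] at h
  rw [← Measure.toSignedMeasure_add, ← Measure.toSignedMeasure_add] at h
  have h2 := Measure.toSignedMeasure_eq_toSignedMeasure_iff.1 h
  rw [← h2, add_comm]

theorem norm_integral_sub_integral_le_tvNorm (μ ν : Measure Z) [IsFiniteMeasure μ]
    [IsFiniteMeasure ν] {f : Z → E} (hf : StronglyMeasurable f) {c : ℝ} (hc : ∀ z, ‖f z‖ ≤ c) :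
    ‖(∫ z, f z ∂μ) - ∫ z, f z ∂ν‖ ≤ c * (tvNorm μ ν).toReal := by
  set s := μ.toSignedMeasure - ν.toSignedMeasure with hs
  have hint : ∀ (ρ : Measure Z) [IsFiniteMeasure ρ], Integrable f ρ := fun ρ _ =>
    Integrable.of_bound hf.aestronglyMeasurable c (.of_forall hc)
  have h := congrArg (fun ρ => ∫ z, f z ∂ρ) (add_negPart_eq_add_posPart μ ν)
  simp only [← hs] at h
  rw [integral_add_measure (hint _) (hint _), integral_add_measure (hint _) (hint _)] at h
  have h1 : (∫ z, f z ∂μ) - ∫ z, f z ∂ν = (∫ z, f z ∂s.toJordanDecomposition.posPart) -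
      ∫ z, f z ∂s.toJordanDecomposition.negPart := by
    rw [sub_eq_sub_iff_add_eq_add, h, add_comm]
  have h2 : ∀ (ρ : Measure Z) [IsFiniteMeasure ρ], ‖∫ z, f z ∂ρ‖ ≤ c * (ρ Set.univ).toReal :=
    fun ρ _ => norm_integral_le_of_norm_le_const (.of_forall hc)
  rw [h1, tvNorm, ← hs, SignedMeasure.totalVariation, Measure.add_apply,
    ENNReal.toReal_add (measure_ne_top _ _) (measure_ne_top _ _), mul_add]
  exact (norm_sub_le _ _).trans (add_le_add (h2 _) (h2 _))

/-- The mixing condition with parameter `tmix`. -/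
def IsMixing (Q : Kernel Z Z) [IsMarkovKernel Q] (tmix : ℕ) : Prop :=
  ∀ k : ℕ, 1 ≤ k → dobrushin (Q ^ k) ≤ (1 / 4 : ℝ≥0∞) ^ (k / tmix)

/-- The constant relating the size of a function to that of its Poisson solution. -/
noncomputable def mixConst (tmix : ℕ) : ℝ := ∑' l : ℕ, 2 * (1 / 4 : ℝ) ^ (l / tmix)

/-- With r = (1/4)^{1/tmix}, the floor in the exponent costs at most a factor r^{-tmix} = 4 relative
to the geometric series of r. -/
theorem summable_mix {tmix : ℕ} (ht : 1 ≤ tmix) :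
    Summable fun l : ℕ => 2 * (1 / 4 : ℝ) ^ (l / tmix) := by
  set r : ℝ := (1 / 4 : ℝ) ^ (1 / (tmix : ℝ)) with hr
  have ht' : (0 : ℝ) < tmix := by exact_mod_cast ht
  have hr0 : 0 < r := by positivity
  have hr1 : r < 1 := Real.rpow_lt_one (by norm_num) (by norm_num) (by positivity)
  have hrt : r ^ tmix = 1 / 4 := by
    rw [hr, ← Real.rpow_natCast, ← Real.rpow_mul (by norm_num)]
    field_simp
    norm_num
  refine Summable.mul_left _ (Summable.of_nonneg_of_le (fun _ => by positivity) (fun l => ?_)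
    ((summable_geometric_of_lt_one hr0.le hr1).mul_left 4))
  have h1 : r ^ l = (1 / 4 : ℝ) ^ (l / tmix) * r ^ (l % tmix) := by
    conv_lhs => rw [← Nat.div_add_mod l tmix, pow_add, pow_mul, hrt]
  have h2 : (1 / 4 : ℝ) ≤ r ^ (l % tmix) := by
    rw [← hrt]
    exact pow_le_pow_of_le_one hr0.le hr1.le (Nat.mod_lt _ ht).le
  rw [h1]
  nlinarith [pow_pos (show (0 : ℝ) < 1 / 4 by norm_num) (l / tmix)]

theorem mixConst_nonneg (tmix : ℕ) : 0 ≤ mixConst tmix := tsum_nonneg fun _ => by positivity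

variable {Q : Kernel Z Z} [IsMarkovKernel Q] {π : Measure Z} [IsProbabilityMeasure π]

theorem invariant_pow (hπ : Kernel.Invariant Q π) (k : ℕ) : Kernel.Invariant (Q ^ k) π := by
  induction k with
  | zero => rw [pow_zero]; exact Measure.id_comp
  | succ k ih => rw [pow_succ]; exact ih.comp hπ

theorem integral_integral_of_invariant {K : Kernel Z Z} [IsMarkovKernel K]
    (hπ : Kernel.Invariant K π) {f : Z → E} (hf : StronglyMeasurable f) {c : ℝ}
    (hc : ∀ z, ‖f z‖ ≤ c) : ∫ z, ∫ y, f y ∂(K z) ∂π = ∫ z, f z ∂π := by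
  have h : (K ∘ₖ Kernel.const Unit π) () = π := by
    rw [Kernel.comp_apply, Kernel.const_apply]
    exact hπ.def
  have h2 := Kernel.integral_comp (η := K) (κ := Kernel.const Unit π) (a := ()) (f := f)
    (by rw [h]; exact Integrable.of_bound hf.aestronglyMeasurable c (.of_forall hc))
  rw [h, Kernel.const_apply] at h2
  exact h2.symm

theorem norm_integral_kernel_le {K : Kernel Z Z} [IsMarkovKernel K] {f : Z → E} {c : ℝ}
    (hc : ∀ z, ‖f z‖ ≤ c) (z : Z) : ‖∫ y, f y ∂(K z)‖ ≤ c := by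
  simpa using norm_integral_le_of_norm_le_const (μ := K z) (.of_forall hc)

/-- A centred function has zero mean under π = πQˡ, so its expectation from z is an average over z'
∼ π of differences between two starting points, each controlled by the Dobrushin coefficient. The
factor 2 undoes the half in that coefficient and also covers l = 0, where no mixing is assumed. -/
theorem norm_integral_pow_le {tmix : ℕ} (hmix : IsMixing Q tmix) (hπ : Kernel.Invariant Q π)
    {f : Z → E} (hf : StronglyMeasurable f) {c : ℝ} (hc : ∀ z, ‖f z‖ ≤ c)
    (hf0 : ∫ z, f z ∂π = 0) (l : ℕ) (z : Z) :
    ‖∫ y, f y ∂((Q ^ l) z)‖ ≤ c * (2 * (1 / 4 : ℝ) ^ (l / tmix)) := by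
  have hc0 : 0 ≤ c := (norm_nonneg _).trans (hc z)
  rcases Nat.eq_zero_or_pos l with rfl | hl
  · refine (norm_integral_kernel_le hc z).trans ?_
    simp
    linarith
  have h1 : ∀ z', ‖(∫ y, f y ∂((Q ^ l) z)) - ∫ y, f y ∂((Q ^ l) z')‖ ≤
      c * (2 * (1 / 4 : ℝ) ^ (l / tmix)) := fun z' => by
    refine (norm_integral_sub_integral_le_tvNorm _ _ hf hc).trans ?_
    gcongr
    have h2 : tvNorm ((Q ^ l) z) ((Q ^ l) z') / 2 ≤ (1 / 4 : ℝ≥0∞) ^ (l / tmix) :=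
      (le_iSup₂ (f := fun z z' => tvNorm ((Q ^ l) z) ((Q ^ l) z') / 2) z z').trans (hmix l hl)
    have h3 : tvNorm ((Q ^ l) z) ((Q ^ l) z') ≤ 2 * (1 / 4 : ℝ≥0∞) ^ (l / tmix) := by
      rw [mul_comm]
      exact (ENNReal.div_le_iff (by norm_num) (by norm_num)).1 h2
    refine (ENNReal.toReal_mono (by finiteness) h3).trans_eq ?_
    simp
  have h4 : ∫ z', ∫ y, f y ∂((Q ^ l) z') ∂π = 0 := by
    rw [integral_integral_of_invariant (invariant_pow hπ l) hf hc, hf0]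
  have hm : StronglyMeasurable fun z' => ∫ y, f y ∂((Q ^ l) z') :=
    StronglyMeasurable.integral_kernel (κ := Q ^ l) hf
  have h5 : ∫ y, f y ∂((Q ^ l) z) =
      ∫ z', ((∫ y, f y ∂((Q ^ l) z)) - ∫ y, f y ∂((Q ^ l) z')) ∂π := by
    rw [integral_sub (integrable_const _) (Integrable.of_bound hm.aestronglyMeasurable c
      (.of_forall fun z' => norm_integral_kernel_le hc z')), h4]
    -- Without completeness the Bochner integral is zero by convention, and both sides vanish.
    by_cases hE : CompleteSpace E
    · simp
    · simp [integral, hE]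
  rw [h5]
  simpa using norm_integral_le_of_norm_le_const (μ := π) (.of_forall h1)

/-- The solution `∑ₗ Qˡ f` of the Poisson equation for the centered function `f`. -/
noncomputable def poisson (Q : Kernel Z Z) (f : Z → E) (z : Z) : E :=
  ∑' l : ℕ, ∫ y, f y ∂((Q ^ l) z)

/-- The image `Q h` of the Poisson solution `h` under the kernel. -/
noncomputable def poissonNext (Q : Kernel Z Z) (f : Z → E) (z : Z) : E := poisson Q f z - f z

variable [CompleteSpace E] {tmix : ℕ} {f : Z → E} {c : ℝ}

theorem summable_poisson (ht : 1 ≤ tmix) (hmix : IsMixing Q tmix) (hπ : Kernel.Invariant Q π)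
    (hf : StronglyMeasurable f) (hc : ∀ z, ‖f z‖ ≤ c) (hf0 : ∫ z, f z ∂π = 0) (z : Z) :
    Summable fun l : ℕ => ∫ y, f y ∂((Q ^ l) z) :=
  Summable.of_norm_bounded ((summable_mix ht).mul_left c)
    fun l => norm_integral_pow_le hmix hπ hf hc hf0 l z

theorem norm_poisson_le (ht : 1 ≤ tmix) (hmix : IsMixing Q tmix) (hπ : Kernel.Invariant Q π)
    (hf : StronglyMeasurable f) (hc : ∀ z, ‖f z‖ ≤ c) (hf0 : ∫ z, f z ∂π = 0) (z : Z) :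
    ‖poisson Q f z‖ ≤ c * mixConst tmix :=
  tsum_of_norm_bounded ((summable_mix ht).hasSum.mul_left c)
    fun l => norm_integral_pow_le hmix hπ hf hc hf0 l z

theorem stronglyMeasurable_poisson (ht : 1 ≤ tmix) (hmix : IsMixing Q tmix)
    (hπ : Kernel.Invariant Q π) (hf : StronglyMeasurable f) (hc : ∀ z, ‖f z‖ ≤ c)
    (hf0 : ∫ z, f z ∂π = 0) : StronglyMeasurable (poisson Q f) := by
  refine stronglyMeasurable_of_tendsto Filter.atTop (f := fun (s : Finset ℕ) z =>
    ∑ l ∈ s, ∫ y, f y ∂((Q ^ l) z)) (fun s => ?_) ?_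
  · exact Finset.stronglyMeasurable_fun_sum s fun l _ =>
      StronglyMeasurable.integral_kernel (κ := Q ^ l) hf
  · rw [tendsto_pi_nhds]
    exact fun z => (summable_poisson ht hmix hπ hf hc hf0 z).hasSum

theorem integral_pow_succ (hf : StronglyMeasurable f) (hc : ∀ z, ‖f z‖ ≤ c) (l : ℕ) (z : Z) :
    ∫ y, f y ∂((Q ^ (l + 1)) z) = ∫ y, ∫ x, f x ∂((Q ^ l) y) ∂(Q z) := by
  rw [pow_succ]
  exact Kernel.integral_comp (η := Q ^ l) (κ := Q) (Integrable.of_bound hf.aestronglyMeasurable c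
    (.of_forall hc))

theorem integral_pow_succ' (hf : StronglyMeasurable f) (hc : ∀ z, ‖f z‖ ≤ c) (l : ℕ) (z : Z) :
    ∫ y, f y ∂((Q ^ (l + 1)) z) = ∫ y, ∫ x, f x ∂(Q y) ∂((Q ^ l) z) := by
  rw [pow_succ']
  exact Kernel.integral_comp (η := Q) (κ := Q ^ l) (Integrable.of_bound hf.aestronglyMeasurable c
    (.of_forall hc))

/-- The Poisson equation. -/
theorem integral_poisson (ht : 1 ≤ tmix) (hmix : IsMixing Q tmix) (hπ : Kernel.Invariant Q π)
    (hf : StronglyMeasurable f) (hc : ∀ z, ‖f z‖ ≤ c) (hf0 : ∫ z, f z ∂π = 0) (z : Z) :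
    ∫ y, poisson Q f y ∂(Q z) = poissonNext Q f z := by
  have h1 : ∫ y, poisson Q f y ∂(Q z) = ∑' l : ℕ, ∫ y, ∫ x, f x ∂((Q ^ l) y) ∂(Q z) := by
    refine (integral_tsum_of_summable_integral_norm (fun l => ?_) ?_).symm
    · exact Integrable.of_bound (StronglyMeasurable.integral_kernel (κ := Q ^ l)
        hf).aestronglyMeasurable c (.of_forall fun y => norm_integral_kernel_le hc y)
    · refine Summable.of_nonneg_of_le (fun l => integral_nonneg fun _ => norm_nonneg _)
        (fun l => ?_) ((summable_mix ht).mul_left c)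
      refine (Real.le_norm_self _).trans ?_
      have h := norm_integral_le_of_norm_le_const (μ := Q z)
        (f := fun y => ‖∫ x, f x ∂((Q ^ l) y)‖) (.of_forall fun y => by
        rw [norm_norm]; exact norm_integral_pow_le hmix hπ hf hc hf0 l y)
      simpa using h
  rw [h1, poissonNext, poisson, (summable_poisson ht hmix hπ hf hc hf0 z).tsum_eq_zero_add]
  simp_rw [← integral_pow_succ hf hc]
  have h2 : ∫ y, f y ∂((1 : Kernel Z Z) z) = f z := by
    change ∫ y, f y ∂(Kernel.id z) = f z
    rw [Kernel.id_apply, integral_dirac' _ _ hf]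
  rw [pow_zero, h2, add_sub_cancel_left]

end Poisson

/-! ### Exponential moments and dimension-free tails. -/

section Concentration

/-- Convexity of `x ↦ cosh √x`. -/
theorem cosh_sqrt_sum_le {ι : Type*} (s : Finset ι) (w x : ι → ℝ) (hw : ∀ i ∈ s, 0 ≤ w i)
    (hw1 : ∑ i ∈ s, w i = 1) :
    Real.cosh (Real.sqrt (∑ i ∈ s, w i * x i ^ 2)) ≤ ∑ i ∈ s, w i * Real.cosh (x i) := by
  have h1 := Real.hasSum_cosh (Real.sqrt (∑ i ∈ s, w i * x i ^ 2))
  have h2 : HasSum (fun n : ℕ => ∑ i ∈ s, w i * (x i ^ (2 * n) / (Nat.factorial (2 * n) : ℝ)))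
      (∑ i ∈ s, w i * Real.cosh (x i)) :=
    hasSum_sum fun i _ => (Real.hasSum_cosh (x i)).mul_left (w i)
  refine hasSum_le (fun n => ?_) h1 h2
  rw [pow_mul, Real.sq_sqrt (Finset.sum_nonneg fun i hi => mul_nonneg (hw i hi) (sq_nonneg _))]
  simp_rw [← mul_div_assoc]
  rw [← Finset.sum_div]
  gcongr
  simpa only [pow_mul] using Real.pow_arith_mean_le_arith_mean_pow s w (fun i => x i ^ 2) hw hw1
    (fun i _ => sq_nonneg _) n

/-- A dimension-free tail bound from exponential moments of the coordinates. -/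
theorem measure_lt_norm_le {Ω : Type*} [MeasurableSpace Ω] (μ : Measure Ω)
    {d : ℕ} [NeZero d] {X : Ω → Vec d} (hX : Measurable X) {p : ℝ} (hp : 1 ≤ p) {v : Fin d → ℝ}
    (hv : ∀ i, 0 < v i)
    (h : ∀ i, ∀ s : ℝ, s = 1 ∨ s = -1 →
      ∫⁻ ω, ENNReal.ofReal (Real.exp (s * Real.sqrt (p / v i) * X ω i)) ∂μ ≤
        ENNReal.ofReal (Real.exp (4 * p))) :
    μ {ω | 6 * Real.sqrt (p * ∑ i, v i) < ‖X ω‖} ≤ ENNReal.ofReal (Real.exp (-p)) := by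
  set V := ∑ i, v i with hV
  have hV0 : 0 < V := Finset.sum_pos (fun i _ => hv i) Finset.univ_nonempty
  have hXi : ∀ i, Measurable fun ω => X ω i := fun i =>
    (EuclideanSpace.proj (𝕜 := ℝ) i).continuous.measurable.comp hX
  have hcosh : ∀ ω, Real.cosh (Real.sqrt (p / V) * ‖X ω‖) ≤
      ∑ i, v i / V * Real.cosh (Real.sqrt (p / v i) * X ω i) := fun ω => by
    -- The weights v_i/V and the scales (p/v_i)^{1/2} are matched: v_i cancels and the weighted sum
    -- of squares is (p/V)‖X‖².
    have h1 := cosh_sqrt_sum_le Finset.univ (fun i => v i / V)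
      (fun i => Real.sqrt (p / v i) * X ω i) (fun i _ => (div_pos (hv i) hV0).le)
      (by rw [← Finset.sum_div, ← hV, div_self hV0.ne'])
    refine le_trans (le_of_eq ?_) h1
    congr 1
    rw [EuclideanSpace.norm_eq, ← Real.sqrt_mul (by positivity), Finset.mul_sum]
    congr 1
    refine Finset.sum_congr rfl fun i _ => ?_
    have := hv i
    rw [mul_pow, Real.sq_sqrt (by positivity), Real.norm_eq_abs, sq_abs]
    field_simp
  have hint : ∫⁻ ω, ENNReal.ofReal (Real.cosh (Real.sqrt (p / V) * ‖X ω‖)) ∂μ ≤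
      ENNReal.ofReal (Real.exp (4 * p)) := by
    have hc : ∀ i, ∫⁻ ω, ENNReal.ofReal (Real.cosh (Real.sqrt (p / v i) * X ω i)) ∂μ ≤
        ENNReal.ofReal (Real.exp (4 * p)) := fun i => by
      have e : ∀ ω, ENNReal.ofReal (Real.cosh (Real.sqrt (p / v i) * X ω i)) =
          ENNReal.ofReal (1 / 2) *
          (ENNReal.ofReal (Real.exp (1 * Real.sqrt (p / v i) * X ω i)) +
          ENNReal.ofReal (Real.exp (-1 * Real.sqrt (p / v i) * X ω i))) := fun ω => by
        rw [← ENNReal.ofReal_add (by positivity) (by positivity),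
          ← ENNReal.ofReal_mul (by positivity), Real.cosh_eq]
        congr 1
        ring_nf
      have hm := hXi i
      simp_rw [e]
      rw [lintegral_const_mul _ (by fun_prop), lintegral_add_left (by fun_prop)]
      refine (mul_le_mul_right (add_le_add (h i 1 (Or.inl rfl)) (h i (-1) (Or.inr rfl))) _).trans ?_
      rw [← ENNReal.ofReal_add (by positivity) (by positivity),
          ← ENNReal.ofReal_mul (by positivity)]
      exact ENNReal.ofReal_le_ofReal (by linarith)
    calc ∫⁻ ω, ENNReal.ofReal (Real.cosh (Real.sqrt (p / V) * ‖X ω‖)) ∂μ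
        ≤ ∫⁻ ω, ∑ i, ENNReal.ofReal (v i / V) *
            ENNReal.ofReal (Real.cosh (Real.sqrt (p / v i) * X ω i)) ∂μ := by
          refine lintegral_mono fun ω => ?_
          refine (ENNReal.ofReal_le_ofReal (hcosh ω)).trans_eq ?_
          rw [ENNReal.ofReal_sum_of_nonneg fun i _ => mul_nonneg (div_pos (hv i) hV0).le
            (Real.cosh_pos _).le]
          exact Finset.sum_congr rfl fun i _ => ENNReal.ofReal_mul (div_pos (hv i) hV0).le
      _ = ∑ i, ENNReal.ofReal (v i / V) *
            ∫⁻ ω, ENNReal.ofReal (Real.cosh (Real.sqrt (p / v i) * X ω i)) ∂μ := by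
          have hm : ∀ i, Measurable fun ω =>
              ENNReal.ofReal (Real.cosh (Real.sqrt (p / v i) * X ω i)) := fun i =>
            (Real.continuous_cosh.measurable.comp ((hXi i).const_mul _)).ennreal_ofReal
          rw [lintegral_finsetSum _ fun i _ => (hm i).const_mul _]
          exact Finset.sum_congr rfl fun i _ => lintegral_const_mul _ (hm i)
      _ ≤ ∑ i, ENNReal.ofReal (v i / V) * ENNReal.ofReal (Real.exp (4 * p)) :=
          Finset.sum_le_sum fun i _ => mul_le_mul_right (hc i) _
      _ = ENNReal.ofReal (Real.exp (4 * p)) := by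
          rw [← Finset.sum_mul, ← ENNReal.ofReal_sum_of_nonneg fun i _ => (div_pos (hv i) hV0).le,
            ← Finset.sum_div, ← hV, div_self hV0.ne', ENNReal.ofReal_one, one_mul]
  have hm : Measurable fun ω => ENNReal.ofReal (Real.cosh (Real.sqrt (p / V) * ‖X ω‖)) :=
    (Real.continuous_cosh.measurable.comp (hX.norm.const_mul _)).ennreal_ofReal
  have hsub : {ω | 6 * Real.sqrt (p * V) < ‖X ω‖} ⊆
      {ω | ENNReal.ofReal (Real.exp (6 * p) / 2) ≤
        ENNReal.ofReal (Real.cosh (Real.sqrt (p / V) * ‖X ω‖))} := fun ω hω => by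
    refine ENNReal.ofReal_le_ofReal ?_
    have h1 : 6 * p ≤ Real.sqrt (p / V) * ‖X ω‖ := by
      have h2 : Real.sqrt (p / V) * Real.sqrt (p * V) = p := by
        rw [← Real.sqrt_mul (by positivity)]
        have : p / V * (p * V) = p ^ 2 := by field_simp
        rw [this, Real.sqrt_sq (by linarith)]
      have h3 := mul_le_mul_of_nonneg_left (le_of_lt (Set.mem_ofPred.1 hω))
        (Real.sqrt_nonneg (p / V))
      nlinarith
    rw [Real.cosh_eq]
    have := Real.exp_le_exp.2 h1
    have := Real.exp_pos (-(Real.sqrt (p / V) * ‖X ω‖))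
    linarith
  calc μ {ω | 6 * Real.sqrt (p * V) < ‖X ω‖}
      ≤ (∫⁻ ω, ENNReal.ofReal (Real.cosh (Real.sqrt (p / V) * ‖X ω‖)) ∂μ) /
          ENNReal.ofReal (Real.exp (6 * p) / 2) :=
        (measure_mono hsub).trans (meas_ge_le_lintegral_div hm.aemeasurable
          (by simp [Real.exp_pos]) ENNReal.ofReal_ne_top)
    _ ≤ ENNReal.ofReal (Real.exp (4 * p)) / ENNReal.ofReal (Real.exp (6 * p) / 2) := by gcongr
    _ = ENNReal.ofReal (Real.exp (4 * p) / (Real.exp (6 * p) / 2)) :=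
        (ENNReal.ofReal_div_of_pos (by positivity)).symm
    _ ≤ ENNReal.ofReal (Real.exp (-p)) := by
        -- The quotient is 2e^{-2p}, and 2 ≤ e^p because p ≥ 1.
        refine ENNReal.ofReal_le_ofReal ?_
        rw [div_le_iff₀ (by positivity), ← mul_div_assoc, ← Real.exp_add, le_div_iff₀ (by norm_num),
          show -p + 6 * p = 4 * p + p by ring, Real.exp_add]
        have := Real.add_one_le_exp p
        gcongr
        linarith

/-- For |x| ≤ 1 one has e^x ≤ 1 + x + x². The linear term integrates to zero, and 1 + b ≤ e^b. -/
theorem integral_exp_le {Ω : Type*} [MeasurableSpace Ω] (ν : Measure Ω) [IsProbabilityMeasure ν]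
    {X : Ω → ℝ} (hX : Measurable X) (hX1 : ∀ ω, |X ω| ≤ 1) (hX0 : ∫ ω, X ω ∂ν = 0) {b : ℝ}
    (hb : ∫ ω, X ω ^ 2 ∂ν ≤ b) : ∫ ω, Real.exp (X ω) ∂ν ≤ Real.exp b := by
  have hi1 : Integrable X ν := Integrable.of_bound hX.aestronglyMeasurable 1 (.of_forall hX1)
  have hi2 : Integrable (fun ω => X ω ^ 2) ν :=
    Integrable.of_bound (hX.pow_const 2).aestronglyMeasurable 1 (.of_forall fun ω => by
      simpa using hX1 ω)
  have hi3 : Integrable (fun ω => Real.exp (X ω)) ν :=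
    Integrable.of_bound hX.exp.aestronglyMeasurable (Real.exp 1) (.of_forall fun ω => by
      rw [Real.norm_eq_abs, Real.abs_exp]
      exact Real.exp_le_exp.2 (le_of_abs_le (hX1 ω)))
  calc ∫ ω, Real.exp (X ω) ∂ν ≤ ∫ ω, (1 + X ω + X ω ^ 2) ∂ν := by
        refine integral_mono hi3 (((integrable_const 1).add hi1).add hi2) fun ω => ?_
        have := le_of_abs_le (Real.abs_exp_sub_one_sub_id_le (hX1 ω))
        dsimp only
        linarith
    _ = 1 + ∫ ω, X ω ^ 2 ∂ν := by
        rw [integral_add (f := fun ω => 1 + X ω) ((integrable_const 1).add hi1) hi2,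
          integral_add (integrable_const 1) hi1, hX0]
        simp
    _ ≤ Real.exp b := by
        have := Real.add_one_le_exp b
        linarith

/-- The form used for one step of an exponential supermartingale: the constant `a` stands for what
is already known from the past. -/
theorem lintegral_exp_add_le {Ω : Type*} [MeasurableSpace Ω] (ν : Measure Ω)
    [IsProbabilityMeasure ν] {X : Ω → ℝ} (hX : Measurable X) (hX1 : ∀ ω, |X ω| ≤ 1)
    (hX0 : ∫ ω, X ω ∂ν = 0) {b : ℝ} (hb : ∫ ω, X ω ^ 2 ∂ν ≤ b) (a : ℝ) :
    ∫⁻ ω, ENNReal.ofReal (Real.exp (a + X ω)) ∂ν ≤ ENNReal.ofReal (Real.exp (a + b)) := by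
  rw [← ofReal_integral_eq_lintegral_ofReal]
  · refine ENNReal.ofReal_le_ofReal ?_
    simp_rw [Real.exp_add a]
    rw [integral_const_mul]
    exact mul_le_mul_of_nonneg_left (integral_exp_le ν hX hX1 hX0 hb) (Real.exp_pos _).le
  · refine Integrable.of_bound (hX.const_add a).exp.aestronglyMeasurable (Real.exp (a + 1))
      (.of_forall fun ω => ?_)
    rw [Real.norm_eq_abs, Real.abs_exp]
    exact Real.exp_le_exp.2 (by linarith [le_of_abs_le (hX1 ω)])
  · exact .of_forall fun ω => (Real.exp_pos _).le

end Concentration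

/-! ### The asymptotic variance as a mean conditional variance. -/

section AsymptoticVariance

variable {Z : Type*} [MeasurableSpace Z] {Q : Kernel Z Z} [IsMarkovKernel Q] {π : Measure Z}
  [IsProbabilityMeasure π] {tmix : ℕ} {f : Z → ℝ} {c : ℝ}

theorem integrable_of_bdd {Ω : Type*} [MeasurableSpace Ω] {ν : Measure Ω} [IsFiniteMeasure ν]
    {f : Ω → ℝ} (hf : Measurable f) {c : ℝ} (hc : ∀ z, |f z| ≤ c) : Integrable f ν :=
  Integrable.of_bound hf.aestronglyMeasurable c (.of_forall hc)

/-- Induction on the lag: the last transition is absorbed by replacing k with its image under the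
kernel, hence the generalization over k. -/
theorem integral_chainLaw_mul {ξ : Measure Z} [IsProbabilityMeasure ξ] (hf : Measurable f)
    (hc : ∀ z, |f z| ≤ c) {k : Z → ℝ} (hk : Measurable k) {c' : ℝ} (hc' : ∀ z, |k z| ≤ c')
    (l : ℕ) : ∫ ω, f (ω 0) * k (ω l) ∂(chainLaw Q ξ) = ∫ z, f z * ∫ y, k y ∂((Q ^ l) z) ∂ξ := by
  induction l generalizing k with
  | zero =>
    have h : ∀ z, ∫ y, k y ∂((Q ^ 0) z) = k z := fun z => by
      rw [pow_zero]
      change ∫ y, k y ∂(Kernel.id z) = k z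
      rw [Kernel.id_apply, integral_dirac' _ _ hk.stronglyMeasurable]
    simp_rw [h]
    conv_rhs => rw [← map_chainLaw_zero Q ξ]
    rw [integral_map (measurable_pi_apply 0).aemeasurable (by fun_prop)]
  | succ l ih =>
    have h1 := integral_chainLaw_succ Q ξ (MeasurableUpTo.eval (Nat.zero_le l))
      (φ := fun s y => f s * k y) (by unfold Function.uncurry; fun_prop) (c := c * c')
      (fun s z => by
        rw [abs_mul]
        exact mul_le_mul (hc s) (hc' z) (abs_nonneg _) ((abs_nonneg _).trans (hc s)))
    have hk' : Measurable fun z => ∫ y, k y ∂(Q z) :=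
      (StronglyMeasurable.integral_kernel (κ := Q) hk.stronglyMeasurable).measurable
    rw [h1]
    simp_rw [integral_const_mul]
    rw [ih (k := fun z => ∫ y, k y ∂(Q z)) hk' (fun z => norm_integral_kernel_le (E := ℝ) hc' z)]
    simp_rw [integral_pow_succ' hk.stronglyMeasurable hc']

/-- The asymptotic variance of `f` along the stationary chain. -/
noncomputable def asympVar (Q : Kernel Z Z) [IsMarkovKernel Q] (π : Measure Z) (f : Z → ℝ) : ℝ :=
  (∫ ω, f (ω 0) * f (ω 0) ∂(chainLaw Q π)) +
    2 * ∑' l : ℕ, ∫ ω, f (ω 0) * f (ω (l + 1)) ∂(chainLaw Q π)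

/-- The martingale increment attached to the solution of the Poisson equation. -/
noncomputable def mgInc {E : Type*} [NormedAddCommGroup E] [NormedSpace ℝ E]
    (Q : Kernel Z Z) (f : Z → E) (z y : Z) : E := poisson Q f y - poissonNext Q f z

/-- The conditional variance of the martingale increment. -/
noncomputable def condVar (Q : Kernel Z Z) (f : Z → ℝ) (z : Z) : ℝ :=
  ∫ y, mgInc Q f z y ^ 2 ∂(Q z)

variable (ht : 1 ≤ tmix) (hmix : IsMixing Q tmix) (hπ : Kernel.Invariant Q π)

include ht hmix hπ

section Banach

variable {E : Type*} [NormedAddCommGroup E] [NormedSpace ℝ E] [CompleteSpace E] {f : Z → E}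
  (hf : StronglyMeasurable f) (hc : ∀ z, ‖f z‖ ≤ c) (hf0 : ∫ z, f z ∂π = 0)

include hf hc hf0

theorem norm_poissonNext_le (z : Z) : ‖poissonNext Q f z‖ ≤ c * mixConst tmix := by
  rw [← integral_poisson ht hmix hπ hf hc hf0 z]
  exact norm_integral_kernel_le (norm_poisson_le ht hmix hπ hf hc hf0) z

theorem norm_mgInc_le (z y : Z) : ‖mgInc Q f z y‖ ≤ 2 * (c * mixConst tmix) := by
  have h1 := norm_poissonNext_le ht hmix hπ hf hc hf0 z
  have h2 := norm_poisson_le ht hmix hπ hf hc hf0 y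
  exact (norm_sub_le _ _).trans (by linarith)

theorem integral_mgInc (z : Z) : ∫ y, mgInc Q f z y ∂(Q z) = 0 := by
  unfold mgInc
  rw [integral_sub (Integrable.of_bound (stronglyMeasurable_poisson ht hmix hπ hf hc
    hf0).aestronglyMeasurable _ (.of_forall (norm_poisson_le ht hmix hπ hf hc hf0)))
    (integrable_const _), integral_poisson ht hmix hπ hf hc hf0]
  simp

end Banach

variable (hf : Measurable f) (hc : ∀ z, |f z| ≤ c) (hf0 : ∫ z, f z ∂π = 0)

include hf hc hf0

theorem measurable_poisson : Measurable (poisson Q f) :=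
  (stronglyMeasurable_poisson ht hmix hπ hf.stronglyMeasurable hc hf0).measurable

theorem measurable_poissonNext : Measurable (poissonNext Q f) :=
  (measurable_poisson ht hmix hπ hf hc hf0).sub hf

theorem condVar_eq (z : Z) :
    condVar Q f z = (∫ y, poisson Q f y ^ 2 ∂(Q z)) - poissonNext Q f z ^ 2 := by
  have hm := measurable_poisson ht hmix hπ hf hc hf0
  have hb : ∀ z, |poisson Q f z| ≤ c * mixConst tmix :=
    norm_poisson_le ht hmix hπ hf.stronglyMeasurable hc hf0
  have hb2 : ∀ z, |poisson Q f z ^ 2| ≤ (c * mixConst tmix) ^ 2 := fun z => by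
    rw [abs_pow]
    exact pow_le_pow_left₀ (abs_nonneg _) (hb z) 2
  have e : ∀ y, mgInc Q f z y ^ 2 = poisson Q f y ^ 2 - (2 * poissonNext Q f z) * poisson Q f y +
      poissonNext Q f z ^ 2 := fun y => by
    unfold mgInc
    ring
  unfold condVar
  simp_rw [e]
  have i1 : Integrable (fun y => poisson Q f y ^ 2) (Q z) :=
    integrable_of_bdd (hm.pow_const 2) hb2
  have i2 : Integrable (fun y => 2 * poissonNext Q f z * poisson Q f y) (Q z) :=
    (integrable_of_bdd hm hb).const_mul _
  rw [integral_add (f := fun y => poisson Q f y ^ 2 - 2 * poissonNext Q f z * poisson Q f y)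
    (i1.sub i2) (integrable_const _), integral_sub i1 i2, integral_const_mul,
    integral_poisson ht hmix hπ hf.stronglyMeasurable hc hf0]
  simp
  ring

theorem measurable_condVar : Measurable (condVar Q f) := by
  have hm := measurable_poisson ht hmix hπ hf hc hf0
  rw [funext (condVar_eq ht hmix hπ hf hc hf0)]
  exact ((hm.pow_const 2).stronglyMeasurable.integral_kernel (κ := Q)).measurable.sub
    ((measurable_poissonNext ht hmix hπ hf hc hf0).pow_const 2)

theorem condVar_mem (z : Z) : 0 ≤ condVar Q f z ∧ condVar Q f z ≤ 4 * (c * mixConst tmix) ^ 2 := by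
  refine ⟨integral_nonneg fun y => sq_nonneg _, ?_⟩
  have hb : ∀ y, ‖mgInc Q f z y ^ 2‖ ≤ 4 * (c * mixConst tmix) ^ 2 := fun y => by
    have h := pow_le_pow_left₀ (norm_nonneg _)
      (norm_mgInc_le ht hmix hπ hf.stronglyMeasurable hc hf0 z y) 2
    rw [norm_pow]
    linarith
  refine (Real.le_norm_self _).trans ?_
  simpa [condVar] using norm_integral_le_of_norm_le_const (μ := Q z) (.of_forall hb)

/-- With h the Poisson solution and Qh = h − f, invariance gives ∫ (Q(h²) − (Qh)²) dπ = ∫ (h² − (h −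
f)²) dπ = 2∫ fh dπ − ∫ f² dπ. Expanding h as ∑ Qˡ f turns ∫ fh dπ into the series of autocovariances
from lag 0 on. -/
theorem integral_condVar : ∫ z, condVar Q f z ∂π = asympVar Q π f := by
  have hm := measurable_poisson ht hmix hπ hf hc hf0
  have hmn := measurable_poissonNext ht hmix hπ hf hc hf0
  have hb : ∀ z, |poisson Q f z| ≤ c * mixConst tmix :=
    norm_poisson_le ht hmix hπ hf.stronglyMeasurable hc hf0
  have hbn : ∀ z, |poissonNext Q f z| ≤ c * mixConst tmix :=
    norm_poissonNext_le ht hmix hπ hf.stronglyMeasurable hc hf0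
  have hb2 : ∀ z, |poisson Q f z ^ 2| ≤ (c * mixConst tmix) ^ 2 := fun z => by
    rw [abs_pow]
    exact pow_le_pow_left₀ (abs_nonneg _) (hb z) 2
  have hbn2 : ∀ z, |poissonNext Q f z ^ 2| ≤ (c * mixConst tmix) ^ 2 := fun z => by
    rw [abs_pow]
    exact pow_le_pow_left₀ (abs_nonneg _) (hbn z) 2
  have hfm : ∀ z l, |∫ y, f y ∂((Q ^ l) z)| ≤ c * (2 * (1 / 4 : ℝ) ^ (l / tmix)) := fun z l =>
    norm_integral_pow_le hmix hπ hf.stronglyMeasurable hc hf0 l z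
  have hfl : ∀ l : ℕ, Measurable fun z => ∫ y, f y ∂((Q ^ l) z) := fun l =>
    (hf.stronglyMeasurable.integral_kernel (κ := Q ^ l)).measurable
  have hbd : ∀ z l, |f z * ∫ y, f y ∂((Q ^ l) z)| ≤
      c * (c * (2 * (1 / 4 : ℝ) ^ (l / tmix))) := fun z l => by
    rw [abs_mul]
    exact mul_le_mul (hc z) (hfm z l) (abs_nonneg _) ((abs_nonneg _).trans (hc z))
  have hsum : Summable fun l : ℕ => ∫ z, f z * ∫ y, f y ∂((Q ^ l) z) ∂π := by
    refine Summable.of_norm_bounded (((summable_mix ht).mul_left c).mul_left c) fun l => ?_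
    have h := norm_integral_le_of_norm_le_const (μ := π)
      (f := fun z => f z * ∫ y, f y ∂((Q ^ l) z)) (.of_forall fun z => hbd z l)
    simpa using h
  have h1 : ∫ z, f z * poisson Q f z ∂π = ∑' l : ℕ, ∫ z, f z * ∫ y, f y ∂((Q ^ l) z) ∂π := by
    unfold poisson
    simp_rw [← tsum_mul_left]
    refine (integral_tsum_of_summable_integral_norm (fun l => ?_) ?_).symm
    · exact integrable_of_bdd (hf.mul (hfl l)) (fun z => hbd z l)
    · refine Summable.of_nonneg_of_le (fun l => integral_nonneg fun _ => norm_nonneg _)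
        (fun l => ?_) (((summable_mix ht).mul_left c).mul_left c)
      refine (Real.le_norm_self _).trans ?_
      have h := norm_integral_le_of_norm_le_const (μ := π)
        (f := fun z => ‖f z * ∫ y, f y ∂((Q ^ l) z)‖) (.of_forall fun z => by
          rw [norm_norm]; exact hbd z l)
      simpa using h
  have h0 : ∀ z, ∫ y, f y ∂((Q ^ 0) z) = f z := fun z => by
    rw [pow_zero]
    change ∫ y, f y ∂(Kernel.id z) = f z
    rw [Kernel.id_apply, integral_dirac' _ _ hf.stronglyMeasurable]
  have h2 : asympVar Q π f = 2 * (∫ z, f z * poisson Q f z ∂π) - ∫ z, f z * f z ∂π := by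
    unfold asympVar
    simp_rw [integral_chainLaw_mul (Q := Q) (ξ := π) hf hc hf hc]
    rw [h1, hsum.tsum_eq_zero_add]
    simp_rw [h0]
    ring
  simp_rw [condVar_eq ht hmix hπ hf hc hf0]
  have i1 : Integrable (fun z => ∫ y, poisson Q f y ^ 2 ∂(Q z)) π :=
    integrable_of_bdd ((hm.pow_const 2).stronglyMeasurable.integral_kernel (κ := Q)).measurable
      (fun z => norm_integral_kernel_le (E := ℝ) hb2 z)
  have i2 : Integrable (fun z => poissonNext Q f z ^ 2) π :=
    integrable_of_bdd (hmn.pow_const 2) hbn2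
  have i3 : Integrable (fun z => poisson Q f z ^ 2) π := integrable_of_bdd (hm.pow_const 2) hb2
  have hc0 : 0 ≤ c := by
    obtain ⟨z⟩ : Nonempty Z := π.nonempty_of_neZero
    exact (abs_nonneg _).trans (hc z)
  have i4 : Integrable (fun z => f z * poisson Q f z) π :=
    integrable_of_bdd (hf.mul hm) (c := c * (c * mixConst tmix)) fun z => by
      rw [abs_mul]
      exact mul_le_mul (hc z) (hb z) (abs_nonneg _) hc0
  have i5 : Integrable (fun z => f z * f z) π :=
    integrable_of_bdd (hf.mul hf) (c := c * c) fun z => by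
      rw [abs_mul]
      exact mul_le_mul (hc z) (hc z) (abs_nonneg _) hc0
  rw [integral_sub i1 i2,
    integral_integral_of_invariant hπ (hm.pow_const 2).stronglyMeasurable hb2, h2,
    ← integral_sub i3 i2, ← integral_const_mul, ← integral_sub (i4.const_mul 2) i5]
  refine integral_congr_ae (.of_forall fun z => ?_)
  simp only [poissonNext]
  ring

/-- Both bounds are inherited from the conditional variance; nonnegativity is not visible from the
autocovariance series itself. -/
theorem asympVar_mem :
    0 ≤ asympVar Q π f ∧ asympVar Q π f ≤ 4 * (c * mixConst tmix) ^ 2 := by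
  rw [← integral_condVar ht hmix hπ hf hc hf0]
  refine ⟨integral_nonneg fun z => (condVar_mem ht hmix hπ hf hc hf0 z).1, ?_⟩
  refine (Real.le_norm_self _).trans ?_
  have h := norm_integral_le_of_norm_le_const (μ := π) (f := condVar Q f)
    (C := 4 * (c * mixConst tmix) ^ 2) (.of_forall fun z => by
      have := condVar_mem ht hmix hπ hf hc hf0 z
      rw [Real.norm_eq_abs, abs_of_nonneg this.1]
      exact this.2)
  simpa using h

end AsymptoticVariance

/-! ### Exponential supermartingales and the Bernstein inequality. -/

section Martingales

variable {Z : Type*} [MeasurableSpace Z] {Q : Kernel Z Z} [IsMarkovKernel Q] {ξ : Measure Z}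
  [IsProbabilityMeasure ξ]

/-- Iterating the Markov property: V is increased by at most b in exponential mean at each step. The
statistic `s` carries the part of the past that the next increment depends on, so no filtration is
needed. -/
theorem lintegral_exp_le_of_step {T : Type*} [MeasurableSpace T] {s : ℕ → (ℕ → Z) → T}
    (hs : ∀ k, MeasurableUpTo k (s k)) {ψ : T → Z → ℝ} (hψ : Measurable (Function.uncurry ψ))
    {V : ℕ → (ℕ → Z) → ℝ} {n₀ : ℕ} (hV : ∀ k, n₀ ≤ k → ∀ ω, V (k + 1) ω = ψ (s k ω) (ω (k + 1)))
    {b b₀ : ℝ} (h : ∀ k, n₀ ≤ k → ∀ ω, ∫⁻ y, ENNReal.ofReal (Real.exp (ψ (s k ω) y)) ∂(Q (ω k)) ≤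
      ENNReal.ofReal (Real.exp (V k ω + b)))
    (h0 : ∀ ω, V n₀ ω ≤ b₀) {n : ℕ} (hn : n₀ ≤ n) :
    ∫⁻ ω, ENNReal.ofReal (Real.exp (V n ω)) ∂(chainLaw Q ξ) ≤
      ENNReal.ofReal (Real.exp (b₀ + ((n : ℝ) - n₀) * b)) := by
  induction n, hn using Nat.le_induction with
  | base =>
    refine (lintegral_mono fun ω => ENNReal.ofReal_le_ofReal (Real.exp_le_exp.2 (h0 ω))).trans ?_
    simp
  | succ k hk ih =>
    simp_rw [hV k hk]
    rw [lintegral_chainLaw_succ Q ξ (hs k)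
      (φ := fun t y => ENNReal.ofReal (Real.exp (ψ t y))) (hψ.exp.ennreal_ofReal)]
    refine (lintegral_mono (h k hk)).trans ?_
    simp_rw [Real.exp_add, ENNReal.ofReal_mul (Real.exp_pos _).le]
    rw [lintegral_mul_const' _ _ ENNReal.ofReal_ne_top]
    refine (mul_le_mul_left ih _).trans_eq ?_
    rw [← ENNReal.ofReal_mul (Real.exp_pos _).le, ← ENNReal.ofReal_mul (Real.exp_pos _).le,
      ← Real.exp_add, ← Real.exp_add]
    congr 2
    push_cast
    ring

theorem MeasurableUpTo.sum_Ico {E : Type*} [MeasurableSpace E] [AddCommMonoid E]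
    [MeasurableAdd₂ E] {g : ℕ → (ℕ → Z) → E} (hg : ∀ k, MeasurableUpTo (k + 1) (g k)) (n₀ k : ℕ) :
    MeasurableUpTo k (fun ω => ∑ j ∈ Finset.Ico n₀ k, g j ω) := by
  induction k with
  | zero => simpa using MeasurableUpTo.const 0 (0 : E)
  | succ k ih =>
    rcases le_or_gt n₀ k with h | h
    · simp_rw [Finset.sum_Ico_succ_top h]
      exact ((ih.mono (Nat.le_succ k)).prodMk (hg k)).comp measurable_add
    · simp_rw [Finset.Ico_eq_empty_of_le (show k + 1 ≤ n₀ from h), Finset.sum_empty]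
      exact MeasurableUpTo.const _ _

variable {π : Measure Z} [IsProbabilityMeasure π] {tmix : ℕ} {c : ℝ}
  (ht : 1 ≤ tmix) (hmix : IsMixing Q tmix) (hπ : Kernel.Invariant Q π)

include ht hmix hπ

theorem stronglyMeasurable_mgInc {E : Type*} [NormedAddCommGroup E] [NormedSpace ℝ E]
    [CompleteSpace E] {f : Z → E} (hf : StronglyMeasurable f) (hc : ∀ z, ‖f z‖ ≤ c)
    (hf0 : ∫ z, f z ∂π = 0) : StronglyMeasurable (Function.uncurry (mgInc Q f)) := by
  have h := stronglyMeasurable_poisson ht hmix hπ hf hc hf0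
  exact (h.comp_measurable measurable_snd).sub ((h.sub hf).comp_measurable measurable_fst)

section Scalar

variable {f : Z → ℝ} (hf : Measurable f) (hc : ∀ z, |f z| ≤ c) (hf0 : ∫ z, f z ∂π = 0)

include hf hc hf0

theorem measurable_mgInc : Measurable (Function.uncurry (mgInc Q f)) :=
  (stronglyMeasurable_mgInc ht hmix hπ hf.stronglyMeasurable hc hf0).measurable

/-- The usual argument would leave the random sum of conditional variances in the exponent. Adding
2l²H(Z_k), where H solves the Poisson equation for the centred conditional variance, replaces that
sum by its stationary mean. The price is the bounded boundary term 4l²G and a fourth-order term in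
l. -/
theorem lintegral_exp_sum_mgInc_le {F G : ℝ} (hF : F = c * mixConst tmix)
    (hG : G = 4 * F ^ 2 * mixConst tmix) {l : ℝ} (hl : |l| * (2 * F) + 4 * l ^ 2 * G ≤ 1)
    {n₀ n : ℕ} (hn : n₀ ≤ n) :
    ∫⁻ ω, ENNReal.ofReal (Real.exp (l * ∑ k ∈ Finset.Ico n₀ n, mgInc Q f (ω k) (ω (k + 1))))
        ∂(chainLaw Q ξ) ≤
      ENNReal.ofReal (Real.exp (4 * l ^ 2 * G +
        ((n : ℝ) - n₀) * (2 * l ^ 2 * asympVar Q π f + 32 * l ^ 4 * G ^ 2))) := by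
  have hv := condVar_mem ht hmix hπ hf hc hf0
  have ha := asympVar_mem ht hmix hπ hf hc hf0
  rw [← hF] at hv ha
  set v := asympVar Q π f with hvdef
  set g : Z → ℝ := fun z => condVar Q f z - v with hg
  have hgm : Measurable g := (measurable_condVar ht hmix hπ hf hc hf0).sub_const _
  have hgb : ∀ z, |g z| ≤ 4 * F ^ 2 := fun z => by
    rw [abs_le]
    constructor <;> simp only [hg] <;> linarith [(hv z).1, (hv z).2]
  have hg0 : ∫ z, g z ∂π = 0 := by
    simp only [hg]
    rw [integral_sub (integrable_of_bdd (measurable_condVar ht hmix hπ hf hc hf0)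
      (c := 4 * F ^ 2) fun z => by rw [abs_of_nonneg (hv z).1]; exact (hv z).2)
      (integrable_const _), integral_condVar ht hmix hπ hf hc hf0]
    simp [hvdef]
  set H := poisson Q g with hH
  have hHm : Measurable H := measurable_poisson ht hmix hπ hgm hgb hg0
  have hHb : ∀ z, |H z| ≤ G := fun z => by
    rw [hG]
    exact norm_poisson_le ht hmix hπ hgm.stronglyMeasurable hgb hg0 z
  have hmm := measurable_mgInc ht hmix hπ hf hc hf0
  set S : ℕ → (ℕ → Z) → ℝ := fun n ω => ∑ k ∈ Finset.Ico n₀ n, mgInc Q f (ω k) (ω (k + 1))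
    with hS
  have hSm : ∀ k, MeasurableUpTo k (S k) := fun k =>
    MeasurableUpTo.sum_Ico (fun j => ((MeasurableUpTo.eval (Nat.le_succ j)).prodMk
      (MeasurableUpTo.eval le_rfl)).comp hmm) n₀ k
  have key := lintegral_exp_le_of_step (Q := Q) (ξ := ξ)
    (s := fun k ω => (S k ω, ω k)) (fun k => (hSm k).prodMk (MeasurableUpTo.eval le_rfl))
    (ψ := fun t y => l * (t.1 + mgInc Q f t.2 y) + 2 * l ^ 2 * H y)
    (V := fun k ω => l * S k ω + 2 * l ^ 2 * H (ω k)) (n₀ := n₀)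
    (b := 2 * l ^ 2 * v + 32 * l ^ 4 * G ^ 2) (b₀ := 2 * l ^ 2 * G) ?_ ?_ ?_ ?_ hn
  · refine le_trans ?_ (((mul_le_mul_right key (ENNReal.ofReal (Real.exp (2 * l ^ 2 * G))))).trans_eq
      ?_)
    · rw [← lintegral_const_mul' _ _ ENNReal.ofReal_ne_top]
      refine lintegral_mono fun ω => ?_
      rw [← ENNReal.ofReal_mul (Real.exp_pos _).le, ← Real.exp_add]
      refine ENNReal.ofReal_le_ofReal (Real.exp_le_exp.2 ?_)
      have := mul_le_mul_of_nonneg_left (abs_le.1 (hHb (ω n))).1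
        (show 0 ≤ 2 * l ^ 2 by positivity)
      simp only [hS]
      linarith
    · rw [← ENNReal.ofReal_mul (Real.exp_pos _).le, ← Real.exp_add]
      congr 2
      ring
  · unfold Function.uncurry
    have h1 : Measurable fun p : (ℝ × Z) × Z => mgInc Q f p.1.2 p.2 :=
      hmm.comp ((measurable_snd.comp measurable_fst).prodMk measurable_snd)
    have h2 : Measurable fun p : (ℝ × Z) × Z => H p.2 := hHm.comp measurable_snd
    fun_prop
  · intro k hk ω
    simp only [hS, Finset.sum_Ico_succ_top hk]
  · intro k hk ω
    have hm1 : Measurable fun y => mgInc Q f (ω k) y := hmm.comp measurable_prodMk_left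
    have hm2 : Measurable fun y => mgInc Q g (ω k) y :=
      (measurable_mgInc ht hmix hπ hgm hgb hg0).comp measurable_prodMk_left
    have hb1 : ∀ y, |mgInc Q f (ω k) y| ≤ 2 * F := fun y => by
      rw [hF]
      exact norm_mgInc_le ht hmix hπ hf.stronglyMeasurable hc hf0 _ y
    have hb2 : ∀ y, |mgInc Q g (ω k) y| ≤ 2 * G := fun y => by
      rw [hG]
      exact norm_mgInc_le ht hmix hπ hgm.stronglyMeasurable hgb hg0 _ y
    have i1 : Integrable (fun y => mgInc Q f (ω k) y) (Q (ω k)) := integrable_of_bdd hm1 hb1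
    have i2 : Integrable (fun y => mgInc Q g (ω k) y) (Q (ω k)) := integrable_of_bdd hm2 hb2
    have hb3 : ∀ y, |mgInc Q f (ω k) y ^ 2| ≤ (2 * F) ^ 2 := fun y => by
      rw [abs_pow]
      exact pow_le_pow_left₀ (abs_nonneg _) (hb1 y) 2
    have i3 : Integrable (fun y => mgInc Q f (ω k) y ^ 2) (Q (ω k)) :=
      integrable_of_bdd (hm1.pow_const 2) hb3
    -- The second moment of l·m + 2l²·m', with |m'| ≤ 2G, is at most 2l² times the conditional
    -- variance plus 2·(2l²)²·(2G)² = 32l⁴G². The conditional variance then cancels against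
    -- `poissonNext Q g`, leaving v.
    have step := lintegral_exp_add_le (Q (ω k))
      (X := fun y => l * mgInc Q f (ω k) y + 2 * l ^ 2 * mgInc Q g (ω k) y)
      (b := 2 * l ^ 2 * condVar Q f (ω k) + 32 * l ^ 4 * G ^ 2)
      (by fun_prop) (fun y => ?_) ?_ ?_ (l * S k ω + 2 * l ^ 2 * poissonNext Q g (ω k))
    · refine le_of_eq_of_le (lintegral_congr fun y => ?_) (step.trans_eq ?_)
      · congr 2
        simp only [mgInc, hH]
        ring
      · congr 2
        have e : poissonNext Q g (ω k) = H (ω k) - (condVar Q f (ω k) - v) := rfl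
        rw [e]
        ring
    · refine (abs_add_le _ _).trans (le_trans ?_ hl)
      rw [abs_mul, abs_mul, abs_of_nonneg (show 0 ≤ 2 * l ^ 2 by positivity)]
      have := mul_le_mul_of_nonneg_left (hb1 y) (abs_nonneg l)
      have := mul_le_mul_of_nonneg_left (hb2 y) (show 0 ≤ 2 * l ^ 2 by positivity)
      linarith
    · rw [integral_add (i1.const_mul _) (i2.const_mul _), integral_const_mul, integral_const_mul,
        integral_mgInc ht hmix hπ hf.stronglyMeasurable hc hf0,
        integral_mgInc ht hmix hπ hgm.stronglyMeasurable hgb hg0]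
      simp
    · have e : 2 * l ^ 2 * condVar Q f (ω k) + 32 * l ^ 4 * G ^ 2 =
          ∫ y, (2 * l ^ 2 * mgInc Q f (ω k) y ^ 2 + 32 * l ^ 4 * G ^ 2) ∂(Q (ω k)) := by
        rw [integral_add (i3.const_mul _) (integrable_const _), integral_const_mul]
        simp [condVar]
      rw [e]
      refine integral_mono_of_nonneg (.of_forall fun y => sq_nonneg _)
        ((i3.const_mul _).add (integrable_const _)) (.of_forall fun y => ?_)
      have h1 : mgInc Q g (ω k) y ^ 2 ≤ (2 * G) ^ 2 := sq_le_sq' (abs_le.1 (hb2 y)).1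
        (abs_le.1 (hb2 y)).2
      have h2 := mul_le_mul_of_nonneg_left h1 (show 0 ≤ 8 * l ^ 4 by positivity)
      dsimp only
      nlinarith [sq_nonneg (l * mgInc Q f (ω k) y - 2 * l ^ 2 * mgInc Q g (ω k) y)]
  · intro ω
    have := mul_le_mul_of_nonneg_left (abs_le.1 (hHb (ω n₀))).2
      (show 0 ≤ 2 * l ^ 2 by positivity)
    simp only [hS, Finset.Ico_self, Finset.sum_empty]
    linarith

end Scalar

section Vector

variable {d : ℕ} [NeZero d]

/-- Coordinate projections are continuous and linear, so they commute with the Poisson series; the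
vector case reduces to the scalar one. -/
theorem mgInc_apply {f : Z → Vec d} (hf : StronglyMeasurable f) (hc : ∀ z, ‖f z‖ ≤ c)
    (hf0 : ∫ z, f z ∂π = 0) (i : Fin d) (z y : Z) :
    (mgInc Q f z y) i = mgInc Q (fun z => f z i) z y := by
  have h : ∀ z, (poisson Q f z) i = poisson Q (fun z => f z i) z := fun z => by
    have h1 := (EuclideanSpace.proj (𝕜 := ℝ) i).map_tsum
      (summable_poisson ht hmix hπ hf hc hf0 z)
    refine h1.trans (tsum_congr fun l => ?_)
    exact ((EuclideanSpace.proj (𝕜 := ℝ) i).integral_comp_comm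
      (Integrable.of_bound hf.aestronglyMeasurable c (.of_forall hc))).symm
  simp [mgInc, poissonNext, h]

/-- A Bernstein inequality for the martingale part of an additive functional. -/
theorem measure_sum_mgInc_le {f : Z → Vec d} (hf : StronglyMeasurable f) (hc : ∀ z, ‖f z‖ ≤ c)
    (hf0 : ∫ z, f z ∂π = 0) {F G : ℝ} (hF : F = c * mixConst tmix)
    (hG : G = 4 * F ^ 2 * mixConst tmix) {n₀ n : ℕ} (hn : n₀ ≤ n) {p : ℝ} (hp : 1 ≤ p)
    (hpn : p ≤ (n : ℝ) - n₀) :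
    chainLaw Q ξ {ω | 6 * Real.sqrt (p * (((n : ℝ) - n₀) * ∑ i, asympVar Q π (fun z => f z i) +
        d * ((16 * F ^ 2 + 8 * G + 1) * Real.sqrt (p * ((n : ℝ) - n₀))))) <
          ‖∑ k ∈ Finset.Ico n₀ n, mgInc Q f (ω k) (ω (k + 1))‖} ≤
      ENNReal.ofReal (Real.exp (-p)) := by
  have hfi : ∀ i, Measurable fun z => f z i := fun i =>
    (EuclideanSpace.proj (𝕜 := ℝ) i).continuous.measurable.comp hf.measurable
  have hci : ∀ i z, |f z i| ≤ c := fun i z => (PiLp.norm_apply_le (f z) i).trans (hc z)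
  have hfi0 : ∀ i, ∫ z, f z i ∂π = 0 := fun i => by
    have := (EuclideanSpace.proj (𝕜 := ℝ) i).integral_comp_comm
      (Integrable.of_bound (μ := π) hf.aestronglyMeasurable c (.of_forall hc))
    rw [hf0, map_zero] at this
    exact this
  have hmi : ∀ i, Measurable (Function.uncurry (mgInc Q (fun z => f z i))) := fun i =>
    measurable_mgInc ht hmix hπ (hfi i) (hci i) (hfi0 i)
  have hm0 := mixConst_nonneg tmix
  have hG0 : 0 ≤ G := by rw [hG]; positivity
  have hF0 : 0 ≤ F := by
    obtain ⟨z⟩ : Nonempty Z := π.nonempty_of_neZero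
    rw [hF]
    exact mul_nonneg ((norm_nonneg _).trans (hc z)) hm0
  set N : ℝ := (n : ℝ) - n₀ with hN
  set r := Real.sqrt (p * N) with hr
  have hrp : p ≤ r := by
    rw [hr]
    refine Real.le_sqrt_of_sq_le ?_
    nlinarith
  have hr0 : 0 < r := by linarith
  have hr2 : r ^ 2 = p * N := Real.sq_sqrt (by nlinarith)
  -- The second summand forces l² = p/v_i to be small enough for the increments in the exponent to
  -- be at most 1, and absorbs the terms in G. Being of order N^{1/2}, it does not affect the
  -- leading term, and it keeps v_i positive when the asymptotic variance vanishes.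
  set v : Fin d → ℝ := fun i => N * asympVar Q π (fun z => f z i) + (16 * F ^ 2 + 8 * G + 1) * r
    with hv
  have hva : ∀ i, 0 ≤ N * asympVar Q π (fun z => f z i) := fun i =>
    mul_nonneg (by linarith) (asympVar_mem ht hmix hπ (hfi i) (hci i) (hfi0 i)).1
  have hvr : ∀ i, (16 * F ^ 2 + 8 * G + 1) * r ≤ v i := fun i => by
    simp only [hv]
    linarith [hva i]
  have hv0 : ∀ i, 0 < v i := fun i => lt_of_lt_of_le (by positivity) (hvr i)
  have hsum : ∑ i, v i = N * ∑ i, asympVar Q π (fun z => f z i) +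
      d * ((16 * F ^ 2 + 8 * G + 1) * r) := by
    simp [hv, Finset.sum_add_distrib, Finset.mul_sum]
  rw [← hsum]
  refine measure_lt_norm_le (chainLaw Q ξ) ?_ hp hv0 fun i s hs => ?_
  · have hmm := (stronglyMeasurable_mgInc ht hmix hπ hf hc hf0).measurable
    refine Finset.measurable_fun_sum _ fun k _ => ?_
    change Measurable (Function.uncurry (mgInc Q f) ∘ fun ω : ℕ → Z => (ω k, ω (k + 1)))
    exact hmm.comp (by fun_prop)
  · set l := s * Real.sqrt (p / v i) with hl
    have hs2 : s ^ 2 = 1 := by rcases hs with rfl | rfl <;> norm_num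
    have hl2 : l ^ 2 = p / v i := by
      rw [hl, mul_pow, hs2, one_mul, Real.sq_sqrt (by have := hv0 i; positivity)]
    have hlv : l ^ 2 * v i = p := by rw [hl2]; exact div_mul_cancel₀ _ (hv0 i).ne'
    have hlr : l ^ 2 * ((16 * F ^ 2 + 8 * G + 1) * r) ≤ p := by
      rw [← hlv]
      exact mul_le_mul_of_nonneg_left (hvr i) (sq_nonneg _)
    have hl1 : l ^ 2 * (16 * F ^ 2 + 8 * G + 1) ≤ 1 := by
      by_contra! hcon
      have : p < l ^ 2 * (16 * F ^ 2 + 8 * G + 1) * r := by nlinarith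
      linarith
    have hqF : 0 ≤ l ^ 2 * F ^ 2 := by positivity
    have hqG : 0 ≤ l ^ 2 * G := by positivity
    have hl1' : 16 * (l ^ 2 * F ^ 2) + 8 * (l ^ 2 * G) ≤ 1 := by
      linarith [sq_nonneg l]
    have hcond : |l| * (2 * F) + 4 * l ^ 2 * G ≤ 1 := by
      have h2 : |l| * (4 * F) ≤ 1 := by
        refine le_of_abs_le (abs_le_of_sq_le_sq ?_ zero_le_one)
        rw [mul_pow, sq_abs]
        linarith
      linarith
    have key := lintegral_exp_sum_mgInc_le (ξ := ξ) ht hmix hπ (hfi i) (hci i) (hfi0 i) hF hG hcond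
      hn
    have e : ∀ ω : ℕ → Z, (∑ k ∈ Finset.Ico n₀ n, mgInc Q f (ω k) (ω (k + 1))) i =
        ∑ k ∈ Finset.Ico n₀ n, mgInc Q (fun z => f z i) (ω k) (ω (k + 1)) := fun ω => by
      simp [mgInc_apply ht hmix hπ hf hc hf0]
    simp_rw [e]
    refine key.trans (ENNReal.ofReal_le_ofReal (Real.exp_le_exp.2 ?_))
    have t1 : 4 * l ^ 2 * G ≤ p := by linarith
    have t2 : l ^ 2 * (N * asympVar Q π (fun z => f z i)) ≤ p := by
      rw [← hlv]
      refine mul_le_mul_of_nonneg_left ?_ (sq_nonneg _)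
      simp only [hv]
      have : 0 ≤ (16 * F ^ 2 + 8 * G + 1) * r := by positivity
      linarith
    have t3 : l ^ 2 * (8 * G * r) ≤ p := by
      refine le_trans (mul_le_mul_of_nonneg_left ?_ (sq_nonneg _)) hlr
      have : 0 ≤ (16 * F ^ 2 + 1) * r := by positivity
      linarith
    have t4 : (l ^ 2 * (8 * G * r)) ^ 2 ≤ p ^ 2 := pow_le_pow_left₀ (by positivity) t3 2
    have t5 : p * (64 * l ^ 4 * G ^ 2 * N) ≤ p * p := by
      have : (l ^ 2 * (8 * G * r)) ^ 2 = 64 * l ^ 4 * G ^ 2 * r ^ 2 := by ring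
      rw [this, hr2] at t4
      linarith
    have t6 : 64 * l ^ 4 * G ^ 2 * N ≤ p := le_of_mul_le_mul_left t5 (by linarith)
    have e2 : 4 * l ^ 2 * G + N * (2 * l ^ 2 * asympVar Q π (fun z => f z i) +
        32 * l ^ 4 * G ^ 2) = 4 * l ^ 2 * G + 2 * (l ^ 2 * (N * asympVar Q π (fun z => f z i))) +
        1 / 2 * (64 * l ^ 4 * G ^ 2 * N) := by ring
    rw [e2]
    linarith

end Vector

end Martingales

/-! ### The Azuma inequality for martingale transforms. -/

section Transform

variable {Z : Type*} [MeasurableSpace Z] {Q : Kernel Z Z} [IsMarkovKernel Q] {ξ : Measure Z}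
  [IsProbabilityMeasure ξ] {π : Measure Z} [IsProbabilityMeasure π] {tmix : ℕ} {c : ℝ}
  (ht : 1 ≤ tmix) (hmix : IsMixing Q tmix) (hπ : Kernel.Invariant Q π)
  {d : ℕ} [NeZero d] {f : Z → Vec d →L[ℝ] Vec d} (hf : StronglyMeasurable f)
  (hc : ∀ z, ‖f z‖ ≤ c) (hf0 : ∫ z, f z ∂π = 0)

include ht hmix hπ hf hc hf0

theorem measurable_mgInc_apply {T : Type*} [MeasurableSpace T] {a b : T → Z} {w : T → Vec d}
    (ha : Measurable a) (hb : Measurable b) (hw : Measurable w) :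
    Measurable fun t => mgInc Q f (a t) (b t) (w t) := by
  have h1 : StronglyMeasurable (fun t => mgInc Q f (a t) (b t)) :=
    (stronglyMeasurable_mgInc ht hmix hπ hf hc hf0).comp_measurable (ha.prodMk hb)
  exact (isBoundedBilinearMap_apply.continuous.comp_stronglyMeasurable
    (h1.prodMk hw.stronglyMeasurable)).measurable

theorem measurable_mgInc_apply_apply {T : Type*} [MeasurableSpace T] {a b : T → Z} {w : T → Vec d}
    (ha : Measurable a) (hb : Measurable b) (hw : Measurable w) (i : Fin d) :
    Measurable fun t => (mgInc Q f (a t) (b t) (w t)) i :=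
  (EuclideanSpace.proj (𝕜 := ℝ) i).continuous.measurable.comp
    (measurable_mgInc_apply ht hmix hπ hf hc hf0 ha hb hw)

/-- An Azuma inequality for the transform of a matrix martingale by a bounded predictable
process. -/
theorem measure_sum_mgInc_apply_le {w : ℕ → (ℕ → Z) → Vec d} (hw : ∀ k, MeasurableUpTo k (w k))
    {R : ℝ} (hR : 0 < R) (hwR : ∀ k ω, ‖w k ω‖ ≤ R) {F : ℝ} (hF0 : 0 < F)
    (hF : 2 * (c * mixConst tmix) ≤ F) {n₀ n : ℕ} (hn : n₀ ≤ n) {p : ℝ} (hp : 1 ≤ p)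
    (hpn : p ≤ (n : ℝ) - n₀) :
    chainLaw Q ξ {ω | 6 * Real.sqrt (p * (d * (((n : ℝ) - n₀) * (F * R) ^ 2))) <
          ‖∑ k ∈ Finset.Ico n₀ n, mgInc Q f (ω k) (ω (k + 1)) (w k ω)‖} ≤
      ENNReal.ofReal (Real.exp (-p)) := by
  set N : ℝ := (n : ℝ) - n₀ with hN
  have hN0 : 0 < N := by linarith
  have hsum : (d : ℝ) * (N * (F * R) ^ 2) = ∑ _i : Fin d, N * (F * R) ^ 2 := by simp
  have hinc : ∀ k, MeasurableUpTo (k + 1) fun ω : ℕ → Z =>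
      mgInc Q f (ω k) (ω (k + 1)) (w k ω) := fun k =>
    (((MeasurableUpTo.eval (Nat.le_succ k)).prodMk ((hw k).mono (Nat.le_succ k))).prodMk
      (MeasurableUpTo.eval le_rfl)).comp (measurable_mgInc_apply ht hmix hπ hf hc hf0
        (a := fun t : (Z × Vec d) × Z => t.1.1) (b := fun t => t.2) (w := fun t => t.1.2)
        (by fun_prop) (by fun_prop) (by fun_prop))
  rw [hsum]
  refine measure_lt_norm_le (chainLaw Q ξ)
    (MeasurableUpTo.sum_Ico hinc n₀ n).measurable hp (fun i => by positivity) fun i s hs => ?_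
  set l := s * Real.sqrt (p / (N * (F * R) ^ 2)) with hl
  have hs2 : s ^ 2 = 1 := by rcases hs with rfl | rfl <;> norm_num
  -- Each of the N steps contributes p/N to the exponent, p in total; p ≤ N keeps a single increment
  -- below 1.
  have hl2 : l ^ 2 * (F * R) ^ 2 = p / N := by
    rw [hl, mul_pow, hs2, one_mul, Real.sq_sqrt (by positivity)]
    field_simp
  have hl1 : |l| * (F * R) ≤ 1 := by
    refine le_of_abs_le (abs_le_of_sq_le_sq ?_ zero_le_one)
    rw [mul_pow, sq_abs, hl2, one_pow]
    exact (div_le_one hN0).2 hpn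
  set S : ℕ → (ℕ → Z) → ℝ := fun n ω =>
    ∑ k ∈ Finset.Ico n₀ n, (mgInc Q f (ω k) (ω (k + 1)) (w k ω)) i with hS
  have hi : Measurable fun x : Vec d => x i :=
    (EuclideanSpace.proj (𝕜 := ℝ) i).continuous.measurable
  have key := lintegral_exp_le_of_step (Q := Q) (ξ := ξ)
    (s := fun k ω => (S k ω, (ω k, w k ω)))
    (fun k => (MeasurableUpTo.sum_Ico (fun k => (hinc k).comp hi) n₀ k).prodMk
      ((MeasurableUpTo.eval le_rfl).prodMk (hw k)))
    (ψ := fun t y => l * (t.1 + (mgInc Q f t.2.1 y t.2.2) i))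
    (V := fun k ω => l * S k ω) (n₀ := n₀)
    (b := l ^ 2 * (F * R) ^ 2) (b₀ := 0) ?_ ?_ ?_ ?_ hn
  · have e : ∀ ω : ℕ → Z, (∑ k ∈ Finset.Ico n₀ n, mgInc Q f (ω k) (ω (k + 1)) (w k ω)) i =
        S n ω := fun ω => by simp [hS]
    simp_rw [e]
    refine key.trans (ENNReal.ofReal_le_ofReal (Real.exp_le_exp.2 ?_))
    rw [hl2, ← hN, zero_add, mul_div_cancel₀ _ hN0.ne']
    linarith
  · have h1 : Measurable fun t : (ℝ × Z × Vec d) × Z => (mgInc Q f t.1.2.1 t.2 t.1.2.2) i :=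
      measurable_mgInc_apply_apply ht hmix hπ hf hc hf0 (by fun_prop) (by fun_prop)
        (by fun_prop) i
    exact ((measurable_fst.comp measurable_fst).add h1).const_mul l
  · intro k hk ω
    simp only [hS, Finset.sum_Ico_succ_top hk]
  · intro k hk ω
    have hb : ∀ y, |(mgInc Q f (ω k) y (w k ω)) i| ≤ F * R := fun y => by
      refine (PiLp.norm_apply_le (mgInc Q f (ω k) y (w k ω)) i).trans
        ((ContinuousLinearMap.le_opNorm (mgInc Q f (ω k) y) (w k ω)).trans ?_)
      exact mul_le_mul ((norm_mgInc_le ht hmix hπ hf hc hf0 _ y).trans hF) (hwR k ω)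
        (norm_nonneg _) hF0.le
    have hm1 : Measurable fun y => (mgInc Q f (ω k) y (w k ω)) i :=
      measurable_mgInc_apply_apply ht hmix hπ hf hc hf0 measurable_const measurable_id
        measurable_const i
    have hzero : ∫ y, (mgInc Q f (ω k) y (w k ω)) i ∂(Q (ω k)) = 0 := by
      have h0 := integral_mgInc ht hmix hπ hf hc hf0 (ω k)
      have hint : Integrable (fun y => mgInc Q f (ω k) y) (Q (ω k)) :=
        Integrable.of_bound ((stronglyMeasurable_mgInc ht hmix hπ hf hc hf0).comp_measurable
          (g := fun y => (ω k, y)) (by fun_prop)).aestronglyMeasurable _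
          (.of_forall fun y => norm_mgInc_le ht hmix hπ hf hc hf0 (ω k) y)
      have h1 := ((EuclideanSpace.proj (𝕜 := ℝ) i).comp
        (ContinuousLinearMap.apply ℝ (Vec d) (w k ω))).integral_comp_comm hint
      rw [h0, map_zero] at h1
      exact h1
    have step := lintegral_exp_add_le (Q (ω k))
      (X := fun y => l * (mgInc Q f (ω k) y (w k ω)) i) (b := l ^ 2 * (F * R) ^ 2)
      (hm1.const_mul l) (fun y => ?_) ?_ ?_ (l * S k ω)
    · simpa only [mul_add] using step
    · rw [abs_mul]
      exact (mul_le_mul_of_nonneg_left (hb y) (abs_nonneg l)).trans hl1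
    · rw [integral_const_mul, hzero, mul_zero]
    · have hsq : ∀ y, ‖(l * (mgInc Q f (ω k) y (w k ω)) i) ^ 2‖ ≤ l ^ 2 * (F * R) ^ 2 :=
        fun y => by
        rw [Real.norm_eq_abs, abs_pow, sq_abs, mul_pow]
        exact mul_le_mul_of_nonneg_left (sq_le_sq' (abs_le.1 (hb y)).1 (abs_le.1 (hb y)).2)
          (sq_nonneg l)
      refine (Real.le_norm_self _).trans ?_
      simpa using norm_integral_le_of_norm_le_const (μ := Q (ω k)) (.of_forall hsq)
  · intro ω
    simp [hS]

end Transform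

/-! ### One-step drift of the Lyapunov function. -/

section OneStep

/-- `P` is a symmetric operator with spectrum in `[D⁻¹, D]`, solving the Lyapunov equation for `A`,
and `a` is at most half the inverse of its norm. -/
structure IsLyapunovOperator {E : Type*} [NormedAddCommGroup E] [InnerProductSpace ℝ E]
    (A P : E →L[ℝ] E) (D a : ℝ) : Prop where
  symm : ∀ x y, inner ℝ x (P y) = inner ℝ y (P x)
  lower : ∀ x, ‖x‖ ^ 2 ≤ D * inner ℝ x (P x)
  upper : ∀ x, 2 * a * inner ℝ x (P x) ≤ ‖x‖ ^ 2
  norm_le : ‖P‖ ≤ D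
  eq : ∀ x, 2 * inner ℝ (A x) (P x) = ‖x‖ ^ 2

variable {E : Type*} [NormedAddCommGroup E] [InnerProductSpace ℝ E]

/-- The correction β(Be + g) moves e by at most ‖e‖/4 + βD, so bounds on the corrected iterate
transfer back to e. -/
theorem norm_le_of_corrected {B : E →L[ℝ] E} {e g : E} {β D : ℝ} (hβ : 0 ≤ β)
    (hβD : β * D ≤ 1 / 4) (hB : ‖B‖ ≤ D) (hg : ‖g‖ ≤ D) :
    3 / 4 * ‖e‖ ≤ ‖e - β • (B e + g)‖ + β * D := by
  have h1 : ‖B e + g‖ ≤ D * ‖e‖ + D :=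
    (norm_add_le _ _).trans (add_le_add (B.le_of_opNorm_le hB e) hg)
  have h2 : ‖e‖ ≤ ‖e - β • (B e + g)‖ + ‖β • (B e + g)‖ := by
    simpa using norm_add_le (e - β • (B e + g)) (β • (B e + g))
  rw [norm_smul, Real.norm_of_nonneg hβ] at h2
  have h3 := mul_le_mul_of_nonneg_left h1 hβ
  have h4 := mul_le_mul_of_nonneg_right hβD (norm_nonneg e)
  linarith

theorem norm_corrected_le {B : E →L[ℝ] E} {e g : E} {β D : ℝ} (hβ : 0 ≤ β)
    (hβD : β * D ≤ 1 / 4) (hB : ‖B‖ ≤ D) (hg : ‖g‖ ≤ D) :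
    ‖e - β • (B e + g)‖ ≤ 2 * ‖e‖ + β * D := by
  have h1 : ‖B e + g‖ ≤ D * ‖e‖ + D :=
    (norm_add_le _ _).trans (add_le_add (B.le_of_opNorm_le hB e) hg)
  have h2 := norm_sub_le e (β • (B e + g))
  rw [norm_smul, Real.norm_of_nonneg hβ] at h2
  have h3 := mul_le_mul_of_nonneg_left h1 hβ
  have h4 := mul_le_mul_of_nonneg_right hβD (norm_nonneg e)
  linarith [norm_nonneg e]

theorem abs_inner_le_of_lyapunov {A P : E →L[ℝ] E} {D a : ℝ} (hP : IsLyapunovOperator A P D a)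
    (x y : E) : |inner ℝ x (P y)| ≤ ‖x‖ * (D * ‖y‖) :=
  (abs_real_inner_le_norm _ _).trans
    (mul_le_mul_of_nonneg_left (P.le_of_opNorm_le hP.norm_le y) (norm_nonneg _))

/-- The one-step drift of the Lyapunov function at the corrected iterate. -/
theorem lyapunov_drift {A P : E →L[ℝ] E} {D a : ℝ} (hD : 1 ≤ D)
    (hP : IsLyapunovOperator A P D a) (hA : ‖A‖ ≤ D) {A' B B' M : E →L[ℝ] E} {g g' m ε' e : E}
    (hA' : ‖A'‖ ≤ D) (hB : ‖B‖ ≤ D) (hB' : ‖B'‖ ≤ D) (hM : ‖M‖ ≤ D) (hg : ‖g‖ ≤ D)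
    (hm : ‖m‖ ≤ D) (hε' : ‖ε'‖ ≤ D) (eA : A' = A + M + B - B') (eε : ε' = m + g - g')
    {β : ℝ} (hβ : 0 ≤ β) (hβD : 124 * (β * D ^ 3) ≤ 1) {u e' u' : E}
    (hu : u = e - β • (B e + g)) (he' : e' = e - β • (A' e + ε'))
    (hu' : u' = e' - β • (B' e' + g')) :
    inner ℝ u' (P u') ≤ (1 - a * β) * inner ℝ u (P u) +
      β * (-2 * inner ℝ (M e + m) (P u)) + β ^ 2 * (62 * D ^ 3) ∧
    |(-2 * inner ℝ (M e + m) (P u) : ℝ)| ≤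
      4 * D ^ 3 * (inner ℝ u (P u) + Real.sqrt (inner ℝ u (P u))) := by
  have hD0 : 0 < D := by linarith
  have hD3 : D ≤ D ^ 3 := by nlinarith [mul_nonneg hD0.le (sub_nonneg.2 hD), sq_nonneg D]
  have hD13 : D ^ 2 ≤ D ^ 3 := by nlinarith [sq_nonneg D]
  have hβ1 : β * D ≤ 1 / 4 := by
    have := mul_le_mul_of_nonneg_left hD3 hβ
    linarith
  have he1 := norm_le_of_corrected (e := e) hβ hβ1 hB hg
  rw [← hu] at he1
  set U := ‖u‖ with hU
  have hU0 : 0 ≤ U := norm_nonneg u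
  have he2 : ‖e‖ ≤ 2 * U + 1 := by linarith [norm_nonneg e]
  have hMe : ‖M e + m‖ ≤ D * (2 * U + 2) := by
    refine (norm_add_le _ _).trans ((add_le_add (M.le_of_opNorm_le hM e) hm).trans ?_)
    have := mul_le_mul_of_nonneg_left he2 hD0.le
    linarith
  have hBe : ‖B e + g‖ ≤ D * (2 * U + 2) := by
    refine (norm_add_le _ _).trans ((add_le_add (B.le_of_opNorm_le hB e) hg).trans ?_)
    have := mul_le_mul_of_nonneg_left he2 hD0.le
    linarith
  have hAe : ‖A' e + ε'‖ ≤ D * (2 * U + 2) := by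
    refine (norm_add_le _ _).trans ((add_le_add (A'.le_of_opNorm_le hA' e) hε').trans ?_)
    have := mul_le_mul_of_nonneg_left he2 hD0.le
    linarith
  have hABe : ‖A (B e + g)‖ ≤ D * (D * (2 * U + 2)) :=
    (A.le_of_opNorm_le hA _).trans (mul_le_mul_of_nonneg_left hBe hD0.le)
  have hBAe : ‖B' (A' e + ε')‖ ≤ D * (D * (2 * U + 2)) :=
    (B'.le_of_opNorm_le hB' _).trans (mul_le_mul_of_nonneg_left hAe hD0.le)
  set r := B' (A' e + ε') - A (B e + g) with hr
  have hrn : ‖r‖ ≤ 2 * (D * (D * (2 * U + 2))) := (norm_sub_le _ _).trans (by linarith)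
  -- The increment of the corrected iterate divided by β. The correction cancels the differences B −
  -- B' and g − g', leaving the mean drift −Au, a martingale increment, and a remainder with an
  -- additional factor β.
  set v := β • r - A u - (M e + m) with hv
  have huv : u' = u + β • v := by
    rw [hu', he', hv, hr, eA, eε, hu]
    simp only [map_sub, map_add, map_smul, smul_sub, smul_add, add_apply, sub_apply]
    module
  have hvn : ‖v‖ ≤ 5 * D * (U + 1) := by
    have h1 : ‖v‖ ≤ β * ‖r‖ + D * U + ‖M e + m‖ := by
      rw [hv]
      refine (norm_sub_le _ _).trans (add_le_add ((norm_sub_le _ _).trans (add_le_add ?_ ?_)) le_rfl)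
      · rw [norm_smul, Real.norm_of_nonneg hβ]
      · exact A.le_of_opNorm_le hA u
    have h2 : β * ‖r‖ ≤ D * (U + 1) := by
      have h3 := mul_le_mul_of_nonneg_left hrn hβ
      have h4 := mul_le_mul_of_nonneg_right hβ1 (show 0 ≤ 4 * D * (U + 1) by positivity)
      linarith
    have h5 : 0 ≤ D * U := by positivity
    linarith
  have hPv := abs_inner_le_of_lyapunov hP
  have hW : inner ℝ u' (P u') = inner ℝ u (P u) + 2 * β * inner ℝ v (P u) +
      β ^ 2 * inner ℝ v (P v) := by
    rw [huv]
    simp only [map_add, map_smul, inner_add_left, inner_add_right, inner_smul_left,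
      inner_smul_right, hP.symm u v]
    simp
    ring
  have hvu : inner ℝ v (P u) = β * inner ℝ r (P u) - inner ℝ (A u) (P u) -
      inner ℝ (M e + m) (P u) := by
    rw [hv, inner_sub_left, inner_sub_left, inner_smul_left]
    simp
  have h1 : inner ℝ r (P u) ≤ 4 * D ^ 3 * (U ^ 2 + U) := by
    refine (le_of_abs_le (hPv r u)).trans ?_
    have := mul_le_mul_of_nonneg_right hrn (show 0 ≤ D * U by positivity)
    linarith
  have h2 : inner ℝ v (P v) ≤ 50 * D ^ 3 * (U ^ 2 + 1) := by
    refine (le_of_abs_le (hPv v v)).trans ?_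
    have h3 := mul_le_mul hvn hvn (norm_nonneg _) (by positivity)
    have h4 := mul_le_mul_of_nonneg_left h3 hD0.le
    have h5 : 0 ≤ D ^ 3 * (U - 1) ^ 2 := by positivity
    linarith
  have h3 := hP.eq u
  rw [← hU] at h3
  have hlow := hP.lower u
  rw [← hU] at hlow
  set W := (inner ℝ u (P u) : ℝ) with hWdef
  have hup := hP.upper u
  rw [← hWdef, ← hU] at hup
  constructor
  · rw [hW, hvu]
    -- The second-order terms add up to at most 62β²D³(U² + 1). Because 124 = 2·62, their U² part
    -- uses half of the drift −βU², and the other half dominates aβW.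
    have h5 := mul_le_mul_of_nonneg_left h1 (show 0 ≤ 2 * β ^ 2 by positivity)
    have h6 := mul_le_mul_of_nonneg_left h2 (sq_nonneg β)
    have h7 : 0 ≤ β ^ 2 * D ^ 3 * (U - 1) ^ 2 := by positivity
    have h8 := mul_le_mul_of_nonneg_left hβD (show 0 ≤ β * U ^ 2 by positivity)
    have h9 := mul_le_mul_of_nonneg_left hup hβ
    have h10 : β * (2 * inner ℝ (A u) (P u)) = β * U ^ 2 := by rw [h3]
    have h11 : 0 ≤ β ^ 2 * D ^ 3 := by positivity
    linarith
  · rw [abs_mul]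
    have h5 := hPv (M e + m) u
    have h6 := mul_le_mul_of_nonneg_right hMe (show 0 ≤ D * U by positivity)
    have h7 : U ≤ D * Real.sqrt W := by
      refine le_of_abs_le (abs_le_of_sq_le_sq ?_ (by positivity))
      have hW0 : 0 ≤ W := nonneg_of_mul_nonneg_right ((sq_nonneg U).trans hlow) hD0
      rw [mul_pow, Real.sq_sqrt hW0]
      nlinarith
    have h8 : U ^ 2 ≤ D * W := hlow
    have h9 : |(-2 : ℝ)| = 2 := by norm_num
    rw [h9]
    have h10 := mul_le_mul_of_nonneg_left h7 (show 0 ≤ 4 * D ^ 2 by positivity)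
    have h11 := mul_le_mul_of_nonneg_left h8 (show 0 ≤ 4 * D ^ 2 by positivity)
    linarith

end OneStep

/-! ### Moment recursion under multiplicative and additive noise. -/

section PowerStep

theorem exp_half_sub_exp_neg_le {s : ℝ} (hs : 0 ≤ s) (hs1 : s ≤ 1) :
    Real.exp (s / 2) - Real.exp (-s) ≤ 3 * (1 - Real.exp (-s)) := by
  set x := Real.exp (-(s / 2)) with hx
  have hx0 : 0 < x := Real.exp_pos _
  have h1 : Real.exp (-s) = x ^ 2 := by
    rw [hx, ← Real.exp_nat_mul]
    congr 1
    push_cast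
    ring
  have h2 : Real.exp (s / 2) = x⁻¹ := by rw [hx, Real.exp_neg, inv_inv]
  have hx1 : x ≤ 1 := Real.exp_le_one_iff.2 (by linarith)
  have hx2 : 1 / 2 ≤ x := by linarith [Real.add_one_le_exp (-(s / 2))]
  rw [h1, h2]
  have h3 : x⁻¹ ≤ 3 - 2 * x ^ 2 := by
    rw [inv_le_iff_one_le_mul₀ hx0]
    nlinarith [mul_nonneg (sub_nonneg.2 hx1) (sub_nonneg.2 hx2),
      mul_nonneg (sub_nonneg.2 hx1) hx0.le]
  linarith

/-- One step of the moment recursion of a nonnegative process with multiplicative and additive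
noise and negative drift. -/
theorem lintegral_pow_step {Ω : Type*} [MeasurableSpace Ω] (ν : Measure Ω) [IsProbabilityMeasure ν]
    {W' ξ : Ω → ℝ} (hξ : Measurable ξ) (hW' : ∀ y, 0 ≤ W' y) {a β w C₁ C₂ C₃ l : ℝ} {q : ℕ}
    (ha : 0 < a) (hβ : 0 < β) (hq : 1 ≤ q) (hw : 0 ≤ w)
    (hC₃ : 0 < C₃) (h31 : 8 * C₁ ≤ C₃ * a) (h32 : 8 * C₂ ^ 2 ≤ C₃ * a) (hl : l = C₃ * (q * β))
    (hl1 : l ≤ 1) (hqa : q * a * β ≤ 1)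
    (hstep : ∀ y, W' y ≤ (1 - a * β) * w + β * ξ y + β ^ 2 * C₁)
    (hξ0 : ∫ y, ξ y ∂ν = 0) (hξb : ∀ y, |ξ y| ≤ C₂ * (w + Real.sqrt w)) :
    ∫⁻ y, ENNReal.ofReal ((W' y + l) ^ q) ∂ν ≤
      ENNReal.ofReal (Real.exp (-(q * a * β / 4)) * (w + l) ^ q +
        3 * (1 - Real.exp (-(q * a * β / 4))) * (4 * l) ^ q) := by
  have hq0 : (1 : ℝ) ≤ q := by exact_mod_cast hq
  have hl0 : 0 < l := by rw [hl]; positivity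
  set Y := w + l with hY
  have hY0 : 0 < Y := by linarith
  set t := w / Y with ht
  have ht0 : 0 ≤ t := by positivity
  have ht1 : t ≤ 1 := (div_le_one hY0).2 (by linarith)
  -- The offset l tames √w: since l ≤ 1, l(w + √w)² ≤ 4wY. With C₃a ≥ 8C₂² the squared relative
  -- noise is then at most half of the drift q·a·β·t.
  have hsq : (q * β * (C₂ * (w + Real.sqrt w)) / Y) ^ 2 ≤ 1 / 2 * (q * a * β) * t := by
    have h1 : (w + Real.sqrt w) ^ 2 ≤ 2 * w ^ 2 + 2 * w := by
      have := Real.sq_sqrt hw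
      nlinarith [sq_nonneg (w - Real.sqrt w)]
    have h2 : l * (2 * w ^ 2 + 2 * w) ≤ 4 * w * Y := by
      have h3 := mul_le_mul_of_nonneg_left hl1 (sq_nonneg w)
      have h4 : 0 ≤ w * l := by positivity
      nlinarith [sq_nonneg w]
    have h3 : l * (w + Real.sqrt w) ^ 2 ≤ 4 * t * Y ^ 2 := by
      have e : 4 * t * Y ^ 2 = 4 * w * Y := by rw [ht]; field_simp
      rw [e]
      exact (mul_le_mul_of_nonneg_left h1 hl0.le).trans h2
    have h4 : C₂ ^ 2 * (q * β) * (w + Real.sqrt w) ^ 2 * (8 * C₃) ≤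
        (C₃ * a) * (4 * t * Y ^ 2) := by
      have h5 : C₂ ^ 2 * (q * β) * (w + Real.sqrt w) ^ 2 * (8 * C₃) =
          (8 * C₂ ^ 2) * (l * (w + Real.sqrt w) ^ 2) := by rw [hl]; ring
      rw [h5]
      exact mul_le_mul h32 h3 (by positivity) (by positivity)
    rw [div_pow, div_le_iff₀ (by positivity)]
    have h6 : C₂ ^ 2 * (q * β) * (w + Real.sqrt w) ^ 2 ≤ a * t * Y ^ 2 / 2 := by
      refine le_of_mul_le_mul_right (h4.trans_eq ?_) (show 0 < 8 * C₃ by positivity)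
      ring
    have h7 := mul_le_mul_of_nonneg_left h6 (show 0 ≤ q * β by positivity)
    linarith
  have hη : ∀ y, |q * β * ξ y / Y| ≤ q * β * (C₂ * (w + Real.sqrt w)) / Y := fun y => by
    rw [abs_div, abs_mul, abs_of_pos hY0, abs_of_nonneg (show 0 ≤ q * β by positivity)]
    gcongr
    exact hξb y
  have hη1 : ∀ y, |q * β * ξ y / Y| ≤ 1 := fun y => by
    refine (hη y).trans (le_of_abs_le (abs_le_of_sq_le_sq ?_ zero_le_one))
    refine hsq.trans ?_
    have := mul_le_mul hqa ht1 ht0 zero_le_one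
    linarith
  -- The bound 1 + x ≤ e^x is applied to the change relative to Y, which makes the q-th power an
  -- exponential with noise bounded by 1.
  have hpow : ∀ y, (W' y + l) ^ q ≤ Y ^ q *
      Real.exp (-(q * a * β) * t + q * a * β / 8 + q * β * ξ y / Y) := fun y => by
    have h1 : W' y + l ≤ Y * Real.exp ((-(a * β * w) + β * ξ y + β ^ 2 * C₁) / Y) := by
      have h2 := Real.add_one_le_exp ((-(a * β * w) + β * ξ y + β ^ 2 * C₁) / Y)
      have h3 := mul_le_mul_of_nonneg_left h2 hY0.le
      have e : Y * ((-(a * β * w) + β * ξ y + β ^ 2 * C₁) / Y + 1) =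
          -(a * β * w) + β * ξ y + β ^ 2 * C₁ + Y := by field_simp
      rw [e] at h3
      linarith [hstep y]
    refine (pow_le_pow_left₀ (by linarith [hW' y]) h1 q).trans ?_
    rw [mul_pow, ← Real.exp_nat_mul]
    refine mul_le_mul_of_nonneg_left (Real.exp_le_exp.2 ?_) (by positivity)
    have e : (q : ℝ) * ((-(a * β * w) + β * ξ y + β ^ 2 * C₁) / Y) =
        -(q * a * β) * t + q * β ^ 2 * C₁ / Y + q * β * ξ y / Y := by
      rw [ht]
      field_simp
      ring
    rw [e]
    have h4 : q * β ^ 2 * C₁ / Y ≤ q * a * β / 8 := by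
      rw [div_le_iff₀ hY0]
      have h5 : 8 * C₁ * β ≤ a * l := by
        rw [hl]
        have h6 := mul_le_mul_of_nonneg_right h31 hβ.le
        have h7 := mul_le_mul_of_nonneg_left hq0 (show 0 ≤ C₃ * a * β by positivity)
        linarith
      have h8 := mul_le_mul_of_nonneg_left h5 (show 0 ≤ q * β by positivity)
      have h9 : 0 ≤ q * β * a * w := by positivity
      rw [hY]
      linarith
    linarith
  have hsq' : ∀ y, ‖(q * β * ξ y / Y) ^ 2‖ ≤ 1 / 2 * (q * a * β) * t := fun y => by
    rw [Real.norm_eq_abs, abs_pow]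
    exact (pow_le_pow_left₀ (abs_nonneg _) (hη y) 2).trans hsq
  have hexp := lintegral_exp_add_le ν (X := fun y => q * β * ξ y / Y)
    (b := 1 / 2 * (q * a * β) * t) (by fun_prop) hη1
    (by simp_rw [mul_div_assoc]
        rw [integral_const_mul, integral_div, hξ0]
        simp)
    (by refine (Real.le_norm_self _).trans ?_
        simpa using norm_integral_le_of_norm_le_const (μ := ν) (.of_forall hsq'))
    (-(q * a * β) * t + q * a * β / 8)
  calc ∫⁻ y, ENNReal.ofReal ((W' y + l) ^ q) ∂ν
      ≤ ∫⁻ y, ENNReal.ofReal (Y ^ q) * ENNReal.ofReal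
          (Real.exp (-(q * a * β) * t + q * a * β / 8 + q * β * ξ y / Y)) ∂ν := by
        refine lintegral_mono fun y => ?_
        rw [← ENNReal.ofReal_mul (by positivity)]
        exact ENNReal.ofReal_le_ofReal (hpow y)
    _ ≤ ENNReal.ofReal (Y ^ q) * ENNReal.ofReal
          (Real.exp (-(q * a * β) * t + q * a * β / 8 + 1 / 2 * (q * a * β) * t)) := by
        rw [lintegral_const_mul' _ _ ENNReal.ofReal_ne_top]
        exact mul_le_mul_right hexp _
    _ ≤ _ := by
        rw [← ENNReal.ofReal_mul (by positivity)]
        refine ENNReal.ofReal_le_ofReal ?_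
        set s := (q * a * β / 4 : ℝ) with hs
        have hs0 : 0 ≤ s := by positivity
        have he : (-(q * a * β) * t + q * a * β / 8 + 1 / 2 * (q * a * β) * t : ℝ) =
            s / 2 - 2 * s * t := by rw [hs]; ring
        have hE1 : Real.exp (-s) ≤ 1 := Real.exp_le_one_iff.2 (by linarith)
        rw [he]
        -- Above 4l the drift fraction t is at least 3/4 and the power contracts by e^{-s}. Below 4l
        -- the power itself is at most (4l)^q, and the possible growth e^{s/2} is charged to the
        -- additive term.
        rcases le_or_gt (4 * l) Y with h | h
        · have h1 : 3 / 4 ≤ t := by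
            rw [ht, le_div_iff₀ hY0]
            linarith
          have h2 : Real.exp (s / 2 - 2 * s * t) ≤ Real.exp (-s) :=
            Real.exp_le_exp.2 (by nlinarith)
          have h3 : 0 ≤ 3 * (1 - Real.exp (-s)) * (4 * l) ^ q := by
            have : 0 ≤ 1 - Real.exp (-s) := by linarith
            positivity
          have h4 := mul_le_mul_of_nonneg_left h2 (show 0 ≤ Y ^ q by positivity)
          linarith
        · have h2 : Real.exp (s / 2 - 2 * s * t) ≤ Real.exp (s / 2) :=
            Real.exp_le_exp.2 (by nlinarith [mul_nonneg hs0 ht0])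
          have h3 := exp_half_sub_exp_neg_le hs0 (by rw [hs]; linarith)
          have h4 : Y ^ q ≤ (4 * l) ^ q := pow_le_pow_left₀ hY0.le h.le q
          have h5 := mul_le_mul_of_nonneg_left h2 (show 0 ≤ Y ^ q by positivity)
          have h6 : Y ^ q * (Real.exp (s / 2) - Real.exp (-s)) ≤
              (4 * l) ^ q * (3 * (1 - Real.exp (-s))) :=
            mul_le_mul h4 h3 (sub_nonneg.2 (Real.exp_le_exp.2 (by linarith))) (by positivity)
          linarith

end PowerStep

/-! ### The error recursion and moments of its Lyapunov function. -/

section ErrorProcess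

variable {Z : Type*} [MeasurableSpace Z] {d : ℕ}

/-- The error recursion `e_k = e_{k-1} - β (A(Z_k) e_{k-1} + ε(Z_k))`. -/
noncomputable def errIter (A : Z → Vec d →L[ℝ] Vec d) (ε : Z → Vec d) (β : ℝ) (e₀ : Vec d)
    (ω : ℕ → Z) : ℕ → Vec d
  | 0 => e₀
  | k + 1 => errIter A ε β e₀ ω k - β • (A (ω (k + 1)) (errIter A ε β e₀ ω k) + ε (ω (k + 1)))

theorem measurable_apply_of_stronglyMeasurable {A : Z → Vec d →L[ℝ] Vec d}
    (hA : StronglyMeasurable A) {T : Type*} [MeasurableSpace T] {a : T → Z} {w : T → Vec d}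
    (ha : Measurable a) (hw : Measurable w) : Measurable fun t => A (a t) (w t) :=
  (isBoundedBilinearMap_apply.continuous.comp_stronglyMeasurable
    ((hA.comp_measurable ha).prodMk hw.stronglyMeasurable)).measurable

theorem measurableUpTo_errIter {A : Z → Vec d →L[ℝ] Vec d} (hA : StronglyMeasurable A)
    {ε : Z → Vec d} (hε : Measurable ε) (β : ℝ) (e₀ : Vec d) (k : ℕ) :
    MeasurableUpTo k (fun ω => errIter A ε β e₀ ω k) := by
  induction k with
  | zero => exact MeasurableUpTo.const 0 e₀
  | succ k ih =>
    have hm : Measurable fun t : Vec d × Z => t.1 - β • (A t.2 t.1 + ε t.2) := by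
      have h1 := measurable_apply_of_stronglyMeasurable hA
        (T := Vec d × Z) measurable_snd measurable_fst
      exact measurable_fst.sub ((h1.add (hε.comp measurable_snd)).const_smul β)
    exact ((ih.mono (Nat.le_succ k)).prodMk (MeasurableUpTo.eval le_rfl)).comp hm

/-- A discrete Grönwall argument: ‖e_k‖ + 1 grows by at most the factor 1 + βD. It serves the
short-horizon regime, where kβ stays bounded. -/
theorem norm_errIter_le {A : Z → Vec d →L[ℝ] Vec d} {ε : Z → Vec d} {β D : ℝ} (hβ : 0 ≤ β)
    (hD : 1 ≤ D) (hA : ∀ z, ‖A z‖ ≤ D) (hε : ∀ z, ‖ε z‖ ≤ D) (e₀ : Vec d) (ω : ℕ → Z) (k : ℕ) :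
    ‖errIter A ε β e₀ ω k‖ ≤ Real.exp (k * (β * D)) * (‖e₀‖ + 1) := by
  have hD0 : 0 ≤ D := by linarith
  have key : ‖errIter A ε β e₀ ω k‖ + 1 ≤ Real.exp (k * (β * D)) * (‖e₀‖ + 1) := by
    induction k with
    | zero => simp [errIter]
    | succ k ih =>
      set e := errIter A ε β e₀ ω k with he
      have h1 : ‖errIter A ε β e₀ ω (k + 1)‖ ≤ ‖e‖ + β * (D * ‖e‖ + D) := by
        refine (norm_sub_le _ _).trans (add_le_add le_rfl ?_)
        rw [norm_smul, Real.norm_of_nonneg hβ]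
        exact mul_le_mul_of_nonneg_left ((norm_add_le _ _).trans
          (add_le_add ((A _).le_of_opNorm_le (hA _) e) (hε _))) hβ
      have h2 : ‖errIter A ε β e₀ ω (k + 1)‖ + 1 ≤ (β * D + 1) * (‖e‖ + 1) := by linarith
      have h3 : Real.exp (((k + 1 : ℕ) : ℝ) * (β * D)) =
          Real.exp (β * D) * Real.exp (k * (β * D)) := by
        rw [← Real.exp_add]
        congr 1
        push_cast
        ring
      rw [h3, mul_assoc]
      exact h2.trans (mul_le_mul (Real.add_one_le_exp _) ih (by positivity) (Real.exp_pos _).le)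
  linarith

/-- The standing assumptions on the error recursion, with the solution of the Lyapunov equation and
common bounds. -/
structure ErrorSystem (Q : Kernel Z Z) [IsMarkovKernel Q] (π : Measure Z) (tmix : ℕ)
    (A : Z → Vec d →L[ℝ] Vec d) (Abar : Vec d →L[ℝ] Vec d) (ε : Z → Vec d)
    (P : Vec d →L[ℝ] Vec d) (c D a : ℝ) : Prop where
  tmix_pos : 1 ≤ tmix
  mixing : IsMixing Q tmix
  invariant : Kernel.Invariant Q π
  stronglyMeasurable_A : StronglyMeasurable A
  stronglyMeasurable_ε : StronglyMeasurable ε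
  centered_le : ∀ z, ‖A z - Abar‖ ≤ c
  noise_le : ∀ z, ‖ε z‖ ≤ c
  integral_A : ∫ z, (A z - Abar) ∂π = 0
  integral_ε : ∫ z, ε z ∂π = 0
  le_D : c ≤ D
  mix_le : 2 * (c * mixConst tmix) ≤ D
  one_le : 1 ≤ D
  A_le : ∀ z, ‖A z‖ ≤ D
  Abar_le : ‖Abar‖ ≤ D
  a_pos : 0 < a
  lyapunov : IsLyapunovOperator Abar P D a

variable {Q : Kernel Z Z} [IsMarkovKernel Q] {π : Measure Z} [IsProbabilityMeasure π] {tmix : ℕ}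
  {A : Z → Vec d →L[ℝ] Vec d} {Abar : Vec d →L[ℝ] Vec d} {ε : Z → Vec d} {P : Vec d →L[ℝ] Vec d}
  {c D a : ℝ}

/-- The iterate corrected by the solutions of the Poisson equations. -/
noncomputable def corrected (Q : Kernel Z Z) (A : Z → Vec d →L[ℝ] Vec d)
    (Abar : Vec d →L[ℝ] Vec d) (ε : Z → Vec d) (β : ℝ) (z : Z) (e : Vec d) : Vec d :=
  e - β • (poissonNext Q (fun z => A z - Abar) z e + poissonNext Q ε z)

/-- The Lyapunov function of the corrected iterate. -/
noncomputable def lyapFun (Q : Kernel Z Z) (A : Z → Vec d →L[ℝ] Vec d)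
    (Abar : Vec d →L[ℝ] Vec d) (ε : Z → Vec d) (P : Vec d →L[ℝ] Vec d) (β : ℝ) (z : Z)
    (e : Vec d) : ℝ :=
  inner ℝ (corrected Q A Abar ε β z e) (P (corrected Q A Abar ε β z e))

namespace ErrorSystem

variable (H : ErrorSystem Q π tmix A Abar ε P c D a)

include H

theorem stronglyMeasurable_centered : StronglyMeasurable fun z => A z - Abar :=
  H.stronglyMeasurable_A.sub stronglyMeasurable_const

theorem D_pos : 0 < D := zero_lt_one.trans_le H.one_le

theorem le_mix : c * mixConst tmix ≤ D := by
  linarith [H.mix_le, H.D_pos]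

theorem poissonNext_A_le (z : Z) : ‖poissonNext Q (fun z => A z - Abar) z‖ ≤ D :=
  (norm_poissonNext_le H.tmix_pos H.mixing H.invariant H.stronglyMeasurable_centered H.centered_le
    H.integral_A z).trans H.le_mix

theorem poissonNext_ε_le (z : Z) : ‖poissonNext Q ε z‖ ≤ D :=
  (norm_poissonNext_le H.tmix_pos H.mixing H.invariant H.stronglyMeasurable_ε H.noise_le
    H.integral_ε z).trans H.le_mix

theorem mgInc_A_le (z y : Z) : ‖mgInc Q (fun z => A z - Abar) z y‖ ≤ D :=
  (norm_mgInc_le H.tmix_pos H.mixing H.invariant H.stronglyMeasurable_centered H.centered_le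
    H.integral_A z y).trans H.mix_le

theorem mgInc_ε_le (z y : Z) : ‖mgInc Q ε z y‖ ≤ D :=
  (norm_mgInc_le H.tmix_pos H.mixing H.invariant H.stronglyMeasurable_ε H.noise_le
    H.integral_ε z y).trans H.mix_le

theorem measurable_corrected (β : ℝ) {T : Type*} [MeasurableSpace T] {b : T → Z} {w : T → Vec d}
    (hb : Measurable b) (hw : Measurable w) :
    Measurable fun t => corrected Q A Abar ε β (b t) (w t) := by
  have h1 : StronglyMeasurable (poissonNext Q fun z => A z - Abar) :=
    (stronglyMeasurable_poisson H.tmix_pos H.mixing H.invariant H.stronglyMeasurable_centered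
      H.centered_le H.integral_A).sub H.stronglyMeasurable_centered
  have h2 : StronglyMeasurable (poissonNext Q ε) :=
    (stronglyMeasurable_poisson H.tmix_pos H.mixing H.invariant H.stronglyMeasurable_ε
      H.noise_le H.integral_ε).sub H.stronglyMeasurable_ε
  exact hw.sub (((measurable_apply_of_stronglyMeasurable h1 hb hw).add
    (h2.measurable.comp hb)).const_smul β)

theorem measurable_lyapFun (β : ℝ) {T : Type*} [MeasurableSpace T] {b : T → Z} {w : T → Vec d}
    (hb : Measurable b) (hw : Measurable w) :
    Measurable fun t => lyapFun Q A Abar ε P β (b t) (w t) := by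
  have h := H.measurable_corrected β hb hw
  exact h.inner (P.continuous.measurable.comp h)

theorem lyapFun_nonneg (β : ℝ) (z : Z) (e : Vec d) : 0 ≤ lyapFun Q A Abar ε P β z e :=
  nonneg_of_mul_nonneg_right ((sq_nonneg _).trans (H.lyapunov.lower _)) H.D_pos

/-- The constants of `lyapunov_drift` are C₁ = 62D³ and C₂ = 4D³; the number 496 = 8·62 and D³ ≤ D⁶
make one condition on C₃ cover both requirements of `lintegral_pow_step`. -/
theorem lintegral_lyapFun_step {β : ℝ} (hβ : 0 < β) (hβD : 124 * (β * D ^ 3) ≤ 1)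
    {C₃ : ℝ} (hC₃ : 496 * D ^ 6 ≤ C₃ * a) {q : ℕ} (hq : 1 ≤ q) {l : ℝ}
    (hl : l = C₃ * (q * β)) (hl1 : l ≤ 1) (hqa : q * a * β ≤ 1) (z : Z) (e : Vec d) :
    ∫⁻ y, ENNReal.ofReal ((lyapFun Q A Abar ε P β y (e - β • (A y e + ε y)) + l) ^ q) ∂(Q z) ≤
      ENNReal.ofReal (Real.exp (-(q * a * β / 4)) * (lyapFun Q A Abar ε P β z e + l) ^ q +
        3 * (1 - Real.exp (-(q * a * β / 4))) * (4 * l) ^ q) := by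
  have hD0 := H.D_pos
  have hD36 : D ^ 3 ≤ D ^ 6 := pow_le_pow_right₀ H.one_le (by norm_num)
  have hM := H.mgInc_A_le
  have hm := H.mgInc_ε_le
  have hsM : StronglyMeasurable fun y => mgInc Q (fun z => A z - Abar) z y :=
    (stronglyMeasurable_mgInc H.tmix_pos H.mixing H.invariant H.stronglyMeasurable_centered
      H.centered_le H.integral_A).comp_measurable (g := fun y => (z, y)) (by fun_prop)
  have hsm : StronglyMeasurable fun y => mgInc Q ε z y :=
    (stronglyMeasurable_mgInc H.tmix_pos H.mixing H.invariant H.stronglyMeasurable_ε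
      H.noise_le H.integral_ε).comp_measurable (g := fun y => (z, y)) (by fun_prop)
  have hsMe : StronglyMeasurable fun y => mgInc Q (fun z => A z - Abar) z y e :=
    (measurable_apply_of_stronglyMeasurable hsM measurable_id measurable_const).stronglyMeasurable
  have hdrift := fun y => lyapunov_drift H.one_le H.lyapunov H.Abar_le
    (A' := A y) (B := poissonNext Q (fun z => A z - Abar) z)
    (B' := poissonNext Q (fun z => A z - Abar) y) (M := mgInc Q (fun z => A z - Abar) z y)
    (g := poissonNext Q ε z) (g' := poissonNext Q ε y) (m := mgInc Q ε z y) (ε' := ε y) (e := e)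
    (H.A_le y) (H.poissonNext_A_le z) (H.poissonNext_A_le y) (hM z y)
    (H.poissonNext_ε_le z) (hm z y) ((H.noise_le y).trans H.le_D)
    (by simp only [mgInc, poissonNext]; abel) (by simp only [mgInc, poissonNext]; abel)
    hβ.le hβD (u := corrected Q A Abar ε β z e) (e' := e - β • (A y e + ε y))
    (u' := corrected Q A Abar ε β y (e - β • (A y e + ε y))) rfl rfl rfl
  refine lintegral_pow_step (Q z) (C₁ := 62 * D ^ 3) (C₂ := 4 * D ^ 3)
    (ξ := fun y => -2 * inner ℝ (mgInc Q (fun z => A z - Abar) z y e + mgInc Q ε z y)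
      (P (corrected Q A Abar ε β z e)))
    ?_ (fun y => H.lyapFun_nonneg β y _) H.a_pos hβ hq (H.lyapFun_nonneg β z e)
    ?_ ?_ ?_ hl hl1 hqa (fun y => (hdrift y).1) ?_ (fun y => (hdrift y).2)
  · exact ((hsMe.add hsm).measurable.inner measurable_const).const_mul _
  · refine pos_of_mul_pos_left (lt_of_lt_of_le ?_ hC₃) H.a_pos.le
    positivity
  · linarith
  · have : 8 * (4 * D ^ 3) ^ 2 = 128 * D ^ 6 := by ring
    have : 0 < D ^ 6 := by positivity
    linarith
  · have i1 : Integrable (fun y => mgInc Q (fun z => A z - Abar) z y) (Q z) :=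
      Integrable.of_bound hsM.aestronglyMeasurable D (.of_forall (hM z))
    have i2 : Integrable (fun y => mgInc Q ε z y) (Q z) :=
      Integrable.of_bound hsm.aestronglyMeasurable D (.of_forall (hm z))
    have i3 : Integrable (fun y => mgInc Q (fun z => A z - Abar) z y e) (Q z) :=
      (ContinuousLinearMap.apply ℝ (Vec d) e).integrable_comp i1
    have h1 : ∫ y, mgInc Q (fun z => A z - Abar) z y e ∂(Q z) = 0 := by
      have := (ContinuousLinearMap.apply ℝ (Vec d) e).integral_comp_comm i1
      rw [integral_mgInc H.tmix_pos H.mixing H.invariant H.stronglyMeasurable_centered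
        H.centered_le H.integral_A z, map_zero] at this
      exact this
    have h2 := integral_mgInc H.tmix_pos H.mixing H.invariant H.stronglyMeasurable_ε
      H.noise_le H.integral_ε z
    have i4 : Integrable (fun y => mgInc Q (fun z => A z - Abar) z y e + mgInc Q ε z y) (Q z) :=
      i3.add i2
    have h3 := integral_inner (𝕜 := ℝ) i4 (P (corrected Q A Abar ε β z e))
    rw [integral_const_mul]
    simp_rw [real_inner_comm]
    rw [h3, integral_add i3 i2, h1, h2]
    simp

/-- The one-step map y ↦ ry + 3(1 − r)(4l)^q has fixed point 3(4l)^q and contracts towards it with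
factor r, starting from a value bounded by y₀^q. -/
theorem lintegral_lyapFun_le {ξ : Measure Z} [IsProbabilityMeasure ξ] {β : ℝ} (hβ : 0 < β)
    (hβD : 124 * (β * D ^ 3) ≤ 1) {C₃ : ℝ} (hC₃ : 496 * D ^ 6 ≤ C₃ * a) {q : ℕ} (hq : 1 ≤ q)
    {l : ℝ} (hl : l = C₃ * (q * β)) (hl0 : 0 ≤ l) (hl1 : l ≤ 1) (hqa : q * a * β ≤ 1) (e₀ : Vec d)
    {y₀ : ℝ} (hy₀ : ∀ z, lyapFun Q A Abar ε P β z e₀ + l ≤ y₀) (k : ℕ) :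
    ∫⁻ ω, ENNReal.ofReal ((lyapFun Q A Abar ε P β (ω k) (errIter A ε β e₀ ω k) + l) ^ q)
        ∂(chainLaw Q ξ) ≤
      ENNReal.ofReal (Real.exp (-(q * a * β / 4)) ^ k * y₀ ^ q + 3 * (4 * l) ^ q) := by
  set r := Real.exp (-(q * a * β / 4)) with hr
  have hr0 : 0 < r := Real.exp_pos _
  have hr1 : r ≤ 1 := Real.exp_le_one_iff.2 (by
    have := H.a_pos
    have : 0 ≤ q * a * β / 4 := by positivity
    linarith)
  have hr1' : 0 ≤ 1 - r := by linarith
  have hy0 : 0 ≤ y₀ := by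
    obtain ⟨z⟩ : Nonempty Z := π.nonempty_of_neZero
    have := H.lyapFun_nonneg β z e₀
    linarith [hy₀ z]
  induction k with
  | zero =>
    refine (lintegral_mono fun ω => ENNReal.ofReal_le_ofReal (q := y₀ ^ q) ?_).trans ?_
    · exact pow_le_pow_left₀ (add_nonneg (H.lyapFun_nonneg _ _ _) hl0) (hy₀ _) q
    · simp only [lintegral_const, measure_univ, mul_one, pow_zero, one_mul]
      exact ENNReal.ofReal_le_ofReal (by linarith [pow_nonneg (mul_nonneg zero_le_four hl0) q])
  | succ k ih =>
    have hm : Measurable (Function.uncurry fun (t : Z × Vec d) (y : Z) => ENNReal.ofReal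
        ((lyapFun Q A Abar ε P β y (t.2 - β • (A y t.2 + ε y)) + l) ^ q)) := by
      have h2 : Measurable fun p : (Z × Vec d) × Z => p.1.2 := by fun_prop
      have h1 : Measurable fun p : (Z × Vec d) × Z => A p.2 p.1.2 :=
        measurable_apply_of_stronglyMeasurable H.stronglyMeasurable_A measurable_snd h2
      have h3 : Measurable fun p : (Z × Vec d) × Z => ε p.2 :=
        H.stronglyMeasurable_ε.measurable.comp measurable_snd
      have hw : Measurable fun p : (Z × Vec d) × Z => p.1.2 - β • (A p.2 p.1.2 + ε p.2) :=
        h2.sub ((h1.add h3).const_smul β)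
      have h4 : Measurable fun p : (Z × Vec d) × Z =>
          lyapFun Q A Abar ε P β p.2 (p.1.2 - β • (A p.2 p.1.2 + ε p.2)) :=
        H.measurable_lyapFun β measurable_snd hw
      exact ((h4.add_const l).pow_const q).ennreal_ofReal
    have hs : MeasurableUpTo k fun ω : ℕ → Z => (ω k, errIter A ε β e₀ ω k) :=
      MeasurableUpTo.prodMk (MeasurableUpTo.eval le_rfl)
        (measurableUpTo_errIter H.stronglyMeasurable_A H.stronglyMeasurable_ε.measurable β e₀ k)
    have hstep := lintegral_chainLaw_succ Q ξ hs (φ := fun (t : Z × Vec d) (y : Z) =>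
      ENNReal.ofReal ((lyapFun Q A Abar ε P β y (t.2 - β • (A y t.2 + ε y)) + l) ^ q)) hm
    have hmono : ∀ ω : ℕ → Z, _ := fun ω => H.lintegral_lyapFun_step hβ hβD hC₃ hq hl hl1
      hqa (ω k) (errIter A ε β e₀ ω k)
    refine le_trans (le_of_eq hstep) (le_trans (lintegral_mono hmono) ?_)
    have hpos : ∀ ω : ℕ → Z,
        0 ≤ (lyapFun Q A Abar ε P β (ω k) (errIter A ε β e₀ ω k) + l) ^ q := fun ω =>
      pow_nonneg (add_nonneg (H.lyapFun_nonneg _ _ _) hl0) q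
    have hl4 : 0 ≤ (4 * l) ^ q := by positivity
    simp_rw [← hr, ENNReal.ofReal_add (mul_nonneg hr0.le (hpos _))
      (mul_nonneg (mul_nonneg zero_le_three hr1') hl4), ENNReal.ofReal_mul hr0.le]
    rw [lintegral_add_right _ measurable_const, lintegral_const_mul' _ _ ENNReal.ofReal_ne_top,
      lintegral_const, measure_univ, mul_one]
    refine (add_le_add (mul_le_mul_right ih _) le_rfl).trans_eq ?_
    rw [← ENNReal.ofReal_mul hr0.le, ← ENNReal.ofReal_add (by positivity)
      (mul_nonneg (mul_nonneg zero_le_three hr1') hl4)]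
    congr 1
    ring

end ErrorSystem

end ErrorProcess

/-! ### From moments to tails, and summation of the recursion. -/

section Tail

/-- Markov's inequality at the level (e²X)^q gives 4e^{-2q}, and 4 ≤ e² ≤ e^q. -/
theorem measure_exp_two_mul_lt_le {Ω : Type*} [MeasurableSpace Ω] (μ : Measure Ω) {Y : Ω → ℝ}
    (hY : Measurable Y) {X : ℝ} (hX : 0 < X) {q : ℕ} (hq : 2 ≤ q)
    (h : ∫⁻ ω, ENNReal.ofReal (Y ω ^ q) ∂μ ≤ ENNReal.ofReal (4 * X ^ q)) :
    μ {ω | Real.exp 2 * X < Y ω} ≤ ENNReal.ofReal (Real.exp (-q)) := by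
  have hq0 : (2 : ℝ) ≤ q := by exact_mod_cast hq
  have hsub : {ω | Real.exp 2 * X < Y ω} ⊆
      {ω | ENNReal.ofReal ((Real.exp 2 * X) ^ q) ≤ ENNReal.ofReal (Y ω ^ q)} := fun ω hω =>
    ENNReal.ofReal_le_ofReal (pow_le_pow_left₀ (by positivity) (Set.mem_ofPred.1 hω).le q)
  have hpos : 0 < (Real.exp 2 * X) ^ q := by positivity
  calc μ {ω | Real.exp 2 * X < Y ω}
      ≤ (∫⁻ ω, ENNReal.ofReal (Y ω ^ q) ∂μ) / ENNReal.ofReal ((Real.exp 2 * X) ^ q) :=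
        (measure_mono hsub).trans (meas_ge_le_lintegral_div
          (hY.pow_const q).ennreal_ofReal.aemeasurable
          (ENNReal.ofReal_pos.2 hpos).ne' ENNReal.ofReal_ne_top)
    _ ≤ ENNReal.ofReal (4 * X ^ q) / ENNReal.ofReal ((Real.exp 2 * X) ^ q) := by gcongr
    _ = ENNReal.ofReal (4 * X ^ q / (Real.exp 2 * X) ^ q) :=
        (ENNReal.ofReal_div_of_pos hpos).symm
    _ ≤ ENNReal.ofReal (Real.exp (-q)) := by
        refine ENNReal.ofReal_le_ofReal ?_
        rw [div_le_iff₀ hpos, mul_pow, ← Real.exp_nat_mul, ← mul_assoc, ← Real.exp_add]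
        refine mul_le_mul_of_nonneg_right ?_ (by positivity)
        have h1 : Real.exp 1 ^ 2 ≤ Real.exp (-(q : ℝ) + q * 2) := by
          rw [← Real.exp_nat_mul]
          exact Real.exp_le_exp.2 (by push_cast; linarith)
        have h2 := Real.add_one_le_exp (1 : ℝ)
        nlinarith

variable {Z : Type*} [MeasurableSpace Z] {d : ℕ}
  {Q : Kernel Z Z} [IsMarkovKernel Q] {π : Measure Z} [IsProbabilityMeasure π] {tmix : ℕ}
  {A : Z → Vec d →L[ℝ] Vec d} {Abar : Vec d →L[ℝ] Vec d} {ε : Z → Vec d} {P : Vec d →L[ℝ] Vec d}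
  {c D a : ℝ}

namespace ErrorSystem

variable (H : ErrorSystem Q π tmix A Abar ε P c D a)

include H

/-- The lower bound on P controls the corrected iterate; the O(β) cost of removing the correction is
at most √l by the assumption relating β² and l. -/
theorem norm_le_of_lyapFun_le {β l s : ℝ} (hβ : 0 ≤ β) (hβ1 : β * D ≤ 1 / 4) (hl0 : 0 ≤ l)
    (hβl : 2 * D ^ 3 * β ^ 2 ≤ l) (hs0 : 0 ≤ s) {z : Z} {e : Vec d}
    (hW : lyapFun Q A Abar ε P β z e ≤ 9 * (8 * D * s ^ 2 + 6 * l)) :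
    ‖e‖ ≤ 20 * D * (s + Real.sqrt l) := by
  have hD0 := H.D_pos
  have hD1 := H.one_le
  have hr0 := Real.sqrt_nonneg l
  have hr2 := Real.sq_sqrt hl0
  have hD12 : D ≤ D ^ 2 := by simpa using pow_le_pow_right₀ hD1 (show 1 ≤ 2 by norm_num)
  have hD23 : D ^ 2 ≤ D ^ 3 := pow_le_pow_right₀ hD1 (show 2 ≤ 3 by norm_num)
  have hu2 := H.lyapunov.lower (corrected Q A Abar ε β z e)
  have hu : ‖corrected Q A Abar ε β z e‖ ≤ 9 * D * (s + Real.sqrt l) := by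
    refine le_of_abs_le (abs_le_of_sq_le_sq ?_ (by positivity))
    refine hu2.trans ((mul_le_mul_of_nonneg_left hW hD0.le).trans ?_)
    have h1 : 0 ≤ D ^ 2 * (s * Real.sqrt l) := by positivity
    have h2 : D * l ≤ D ^ 2 * l := mul_le_mul_of_nonneg_right hD12 hl0
    have h3 : 0 ≤ D ^ 2 * s ^ 2 := by positivity
    have h4 : 0 ≤ D ^ 2 * l := by positivity
    have h5 : (9 * D * (s + Real.sqrt l)) ^ 2 = 81 * (D ^ 2 * s ^ 2) +
        162 * (D ^ 2 * (s * Real.sqrt l)) + 81 * (D ^ 2 * Real.sqrt l ^ 2) := by ring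
    rw [h5, hr2]
    linarith
  have h1 : 3 / 4 * ‖e‖ ≤ ‖corrected Q A Abar ε β z e‖ + β * D :=
    norm_le_of_corrected hβ hβ1 (H.poissonNext_A_le _) (H.poissonNext_ε_le _)
  have h2 : β * D ≤ Real.sqrt l := by
    refine Real.le_sqrt_of_sq_le ?_
    have := mul_le_mul_of_nonneg_left hD23 (sq_nonneg β)
    have : 0 ≤ β ^ 2 * D ^ 3 := by positivity
    linarith
  have h3 : Real.sqrt l ≤ D * Real.sqrt l := le_mul_of_one_le_left hr0 hD1
  have h4 : 0 ≤ D * s := by positivity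
  linarith

/-- A high-probability bound on the error at a given time. -/
theorem measure_norm_errIter_le {ξ : Measure Z} [IsProbabilityMeasure ξ] {β : ℝ} (hβ : 0 < β)
    (hβD : 124 * (β * D ^ 3) ≤ 1) {C₃ : ℝ} (hC₃ : 496 * D ^ 6 ≤ C₃ * a) (hC₃' : 2 * D ^ 3 ≤ C₃)
    {q : ℕ} (hq : 2 ≤ q) {l : ℝ} (hl : l = C₃ * (q * β)) (hl1 : l ≤ 1) (hqa : q * a * β ≤ 1)
    (e₀ : Vec d) (k : ℕ) :
    chainLaw Q ξ {ω | 20 * D * (Real.exp (-(a * β * k / 8)) * ‖e₀‖ + Real.sqrt l) <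
      ‖errIter A ε β e₀ ω k‖} ≤ ENNReal.ofReal (Real.exp (-q)) := by
  have hD0 := H.D_pos
  have hD1 := H.one_le
  have hq0 : (2 : ℝ) ≤ q := by exact_mod_cast hq
  have hC30 : 0 < C₃ := lt_of_lt_of_le (by positivity) hC₃'
  have hl0 : 0 < l := by rw [hl]; positivity
  have hD3 : D ≤ D ^ 3 := by
    simpa using pow_le_pow_right₀ hD1 (show 1 ≤ 3 by norm_num)
  have hβ1 : β * D ≤ 1 / 4 := by
    have := mul_le_mul_of_nonneg_left hD3 hβ.le
    linarith
  have hβ2 : β ≤ 1 := by nlinarith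
  have hβl : 2 * D ^ 3 * β ^ 2 ≤ l := by
    have h1 : 2 * D ^ 3 * β ^ 2 ≤ C₃ * β ^ 2 := mul_le_mul_of_nonneg_right hC₃' (sq_nonneg β)
    have h2 : β ^ 2 ≤ q * β := by nlinarith
    rw [hl]
    exact h1.trans (mul_le_mul_of_nonneg_left h2 hC30.le)
  -- The corrected start has norm at most 2‖e₀‖ + βD, so its Lyapunov value is at most 8D‖e₀‖² +
  -- 2D³β², and 2D³β² ≤ l; the other l is the offset.
  set y₀ := 8 * D * ‖e₀‖ ^ 2 + 2 * l with hy₀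
  have hy : ∀ z, lyapFun Q A Abar ε P β z e₀ + l ≤ y₀ := fun z => by
    have h1 := norm_corrected_le (e := e₀) hβ.le hβ1 (H.poissonNext_A_le z) (H.poissonNext_ε_le z)
    have h2 : lyapFun Q A Abar ε P β z e₀ ≤ _ :=
      (le_abs_self _).trans (abs_inner_le_of_lyapunov H.lyapunov _ _)
    set U := ‖e₀ - β • (poissonNext Q (fun z => A z - Abar) z e₀ + poissonNext Q ε z)‖ with hU
    have h3 : lyapFun Q A Abar ε P β z e₀ ≤ U * (D * U) := h2
    have h4 := mul_le_mul h1 h1 (norm_nonneg _) (by positivity)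
    have h5 := mul_le_mul_of_nonneg_left h4 hD0.le
    have h6 : 0 ≤ D * (2 * ‖e₀‖ - β * D) ^ 2 := by positivity
    linarith
  have hlin := H.lintegral_lyapFun_le (ξ := ξ) hβ hβD hC₃ (by omega) hl hl0.le hl1 hqa e₀ hy k
  set ρ := Real.exp (-(a * β * k / 4)) with hρ
  have hρ1 : ρ ≤ 1 := Real.exp_le_one_iff.2 (by
    have := H.a_pos
    have : 0 ≤ a * β * k / 4 := by positivity
    linarith)
  have hρ0 : 0 < ρ := Real.exp_pos _
  -- The contraction is written as a q-th power so that Markov's inequality returns a bound on the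
  -- Lyapunov function itself; its rate aβk/4 halves when passing to the norm.
  have hρq : Real.exp (-(q * a * β / 4)) ^ k = ρ ^ q := by
    rw [hρ, ← Real.exp_nat_mul, ← Real.exp_nat_mul]
    congr 1
    ring
  set X := ρ * y₀ + 4 * l with hX
  have hy0 : 0 ≤ y₀ := by positivity
  have hX0 : 0 < X := by positivity
  have hmom : Real.exp (-(q * a * β / 4)) ^ k * y₀ ^ q + 3 * (4 * l) ^ q ≤ 4 * X ^ q := by
    rw [hρq, ← mul_pow]
    have h1 : (ρ * y₀) ^ q ≤ X ^ q := pow_le_pow_left₀ (by positivity) (by linarith) q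
    have h2 : (4 * l) ^ q ≤ X ^ q :=
      pow_le_pow_left₀ (by positivity) (by linarith [mul_nonneg hρ0.le hy0]) q
    linarith
  have hm : Measurable fun ω : ℕ → Z =>
      lyapFun Q A Abar ε P β (ω k) (errIter A ε β e₀ ω k) + l :=
    (H.measurable_lyapFun β (measurable_pi_apply k) (measurableUpTo_errIter
      H.stronglyMeasurable_A H.stronglyMeasurable_ε.measurable β e₀ k).measurable).add_const l
  have htail := measure_exp_two_mul_lt_le (chainLaw Q ξ) hm hX0 hq
    (hlin.trans (ENNReal.ofReal_le_ofReal hmom))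
  have hsub : {ω | 20 * D * (Real.exp (-(a * β * k / 8)) * ‖e₀‖ + Real.sqrt l) <
      ‖errIter A ε β e₀ ω k‖} ⊆
      {ω | Real.exp 2 * X < lyapFun Q A Abar ε P β (ω k) (errIter A ε β e₀ ω k) + l} := by
    intro ω hω
    by_contra hcon
    have hcon3 := not_lt.1 (fun hh => hcon (Set.mem_ofPred.2 hh))
    refine (not_le.2 (Set.mem_ofPred.1 hω)) ?_
    set e := errIter A ε β e₀ ω k with he
    set s := Real.exp (-(a * β * k / 8)) * ‖e₀‖ with hs
    have hs0 : 0 ≤ s := by positivity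
    have hs2 : s ^ 2 = ρ * ‖e₀‖ ^ 2 := by
      rw [hs, mul_pow, hρ, ← Real.exp_nat_mul]
      congr 2
      push_cast
      ring
    have he2 : Real.exp 2 ≤ 9 := by
      have h1 : Real.exp 2 = Real.exp 1 ^ 2 := by
        rw [← Real.exp_nat_mul]
        norm_num
      rw [h1]
      have := Real.exp_one_lt_three
      nlinarith [Real.exp_pos 1]
    have hX2 : X ≤ 8 * D * s ^ 2 + 6 * l := by
      rw [hs2, hX, hy₀]
      have := mul_le_mul_of_nonneg_right hρ1 hl0.le
      linarith
    have hW : lyapFun Q A Abar ε P β (ω k) e ≤ 9 * (8 * D * s ^ 2 + 6 * l) := by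
      have := mul_le_mul he2 hX2 hX0.le (by norm_num)
      linarith
    exact H.norm_le_of_lyapFun_le hβ.le hβ1 hl0.le hβl hs0 hW
  exact (measure_mono hsub).trans htail

end ErrorSystem

/-- Summation of the error recursion, after solving the Poisson equation. -/
theorem sum_errIter_eq (Q : Kernel Z Z) (A : Z → Vec d →L[ℝ] Vec d) (Abar : Vec d →L[ℝ] Vec d)
    (ε : Z → Vec d) {β : ℝ} (hβ : β ≠ 0) (e₀ : Vec d) (ω : ℕ → Z) {n₀ n : ℕ} (hn : n₀ ≤ n) :
    Abar (∑ k ∈ Finset.Ico n₀ n, errIter A ε β e₀ ω k) =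
      β⁻¹ • (errIter A ε β e₀ ω n₀ - errIter A ε β e₀ ω n) -
      ∑ k ∈ Finset.Ico n₀ n, ε (ω (k + 1)) -
      ∑ k ∈ Finset.Ico n₀ n,
        mgInc Q (fun z => A z - Abar) (ω k) (ω (k + 1)) (errIter A ε β e₀ ω k) -
      (poissonNext Q (fun z => A z - Abar) (ω n₀) (errIter A ε β e₀ ω n₀) -
        poissonNext Q (fun z => A z - Abar) (ω n) (errIter A ε β e₀ ω n)) +
      β • ∑ k ∈ Finset.Ico n₀ n, poissonNext Q (fun z => A z - Abar) (ω (k + 1))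
        (A (ω (k + 1)) (errIter A ε β e₀ ω k) + ε (ω (k + 1))) := by
  induction n, hn using Nat.le_induction with
  | base => simp
  | succ n hn ih =>
    simp only [Finset.sum_Ico_succ_top hn]
    set e := errIter A ε β e₀ ω n with he
    have hstep : errIter A ε β e₀ ω (n + 1) = e - β • (A (ω (n + 1)) e + ε (ω (n + 1))) := rfl
    -- The Poisson equation expresses (A − Ā)e as a martingale increment plus a difference of
    -- boundary operators on the same vector e. Telescoping needs the new boundary operator at
    -- e_{n+1}; the mismatch e_n − e_{n+1} = βx produces the last sum.
    have hM : mgInc Q (fun z => A z - Abar) (ω n) (ω (n + 1)) e =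
        poissonNext Q (fun z => A z - Abar) (ω (n + 1)) e + (A (ω (n + 1)) e - Abar e) -
          poissonNext Q (fun z => A z - Abar) (ω n) e := by
      simp [mgInc, poissonNext]
    set x := A (ω (n + 1)) e + ε (ω (n + 1)) with hx
    have h1 : β⁻¹ • (errIter A ε β e₀ ω n₀ - (e - β • x)) =
        β⁻¹ • (errIter A ε β e₀ ω n₀ - e) + x := by
      rw [← sub_add, smul_add, smul_smul, inv_mul_cancel₀ hβ, one_smul]
    have h2 : poissonNext Q (fun z => A z - Abar) (ω (n + 1)) (e - β • x) =
        poissonNext Q (fun z => A z - Abar) (ω (n + 1)) e -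
          β • poissonNext Q (fun z => A z - Abar) (ω (n + 1)) x := by
      rw [map_sub, map_smul]
    have h3 : A (ω (n + 1)) e = x - ε (ω (n + 1)) := by rw [hx]; abel
    rw [map_add, ih, hstep, hM, h1, h2, h3, smul_add]
    abel

end Tail

/-! ### The Richardson-Romberg combination. -/

section RichardsonRomberg

variable {Z : Type*} [MeasurableSpace Z] {d : ℕ}
  {Q : Kernel Z Z} [IsMarkovKernel Q] {π : Measure Z} [IsProbabilityMeasure π] {tmix : ℕ}
  {A : Z → Vec d →L[ℝ] Vec d} {Abar : Vec d →L[ℝ] Vec d} {ε : Z → Vec d} {P : Vec d →L[ℝ] Vec d}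
  {c D a : ℝ}

theorem sum_eq_sum_mgInc_add {E : Type*} [NormedAddCommGroup E] [NormedSpace ℝ E]
    (Q : Kernel Z Z) (f : Z → E) (ω : ℕ → Z) {n₀ n : ℕ} (hn : n₀ ≤ n) :
    ∑ k ∈ Finset.Ico n₀ n, f (ω (k + 1)) =
      ∑ k ∈ Finset.Ico n₀ n, mgInc Q f (ω k) (ω (k + 1)) +
        (poissonNext Q f (ω n₀) - poissonNext Q f (ω n)) := by
  induction n, hn using Nat.le_induction with
  | base => simp
  | succ n hn ih =>
    rw [Finset.sum_Ico_succ_top hn, Finset.sum_Ico_succ_top hn, ih]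
    simp only [mgInc, poissonNext]
    abel

/-- The Richardson-Romberg combination of two error processes with the same noise. -/
noncomputable def rrErr (A : Z → Vec d →L[ℝ] Vec d) (ε : Z → Vec d) (α : ℝ) (e₀ : Vec d)
    (ω : ℕ → Z) (k : ℕ) : Vec d :=
  (2 : ℝ) • errIter A ε α e₀ ω k - errIter A ε (2 * α) e₀ ω k

/-- In the Richardson-Romberg combination the leading bias term cancels. -/
theorem sum_rrErr_eq (Q : Kernel Z Z) (A : Z → Vec d →L[ℝ] Vec d) (Abar : Vec d →L[ℝ] Vec d)
    (ε : Z → Vec d) {α : ℝ} (hα : α ≠ 0) (e₀ : Vec d) (ω : ℕ → Z) {n₀ n : ℕ} (hn : n₀ ≤ n) :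
    Abar (∑ k ∈ Finset.Ico n₀ n, rrErr A ε α e₀ ω k) =
      (2 * α⁻¹) • (errIter A ε α e₀ ω n₀ - errIter A ε α e₀ ω n) -
      (2 * α)⁻¹ • (errIter A ε (2 * α) e₀ ω n₀ - errIter A ε (2 * α) e₀ ω n) -
      ∑ k ∈ Finset.Ico n₀ n, ε (ω (k + 1)) -
      ∑ k ∈ Finset.Ico n₀ n,
        mgInc Q (fun z => A z - Abar) (ω k) (ω (k + 1)) (rrErr A ε α e₀ ω k) -
      (poissonNext Q (fun z => A z - Abar) (ω n₀) (rrErr A ε α e₀ ω n₀) -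
        poissonNext Q (fun z => A z - Abar) (ω n) (rrErr A ε α e₀ ω n)) +
      (2 * α) • ∑ k ∈ Finset.Ico n₀ n, poissonNext Q (fun z => A z - Abar) (ω (k + 1))
        (A (ω (k + 1)) (errIter A ε α e₀ ω k - errIter A ε (2 * α) e₀ ω k)) := by
  have h1 := sum_errIter_eq Q A Abar ε hα e₀ ω hn
  have h2 := sum_errIter_eq Q A Abar ε (mul_ne_zero two_ne_zero hα) e₀ ω hn
  have h3 : ∑ k ∈ Finset.Ico n₀ n,
      mgInc Q (fun z => A z - Abar) (ω k) (ω (k + 1)) (rrErr A ε α e₀ ω k) =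
      (2 : ℝ) • (∑ k ∈ Finset.Ico n₀ n,
        mgInc Q (fun z => A z - Abar) (ω k) (ω (k + 1)) (errIter A ε α e₀ ω k)) -
      ∑ k ∈ Finset.Ico n₀ n,
        mgInc Q (fun z => A z - Abar) (ω k) (ω (k + 1)) (errIter A ε (2 * α) e₀ ω k) := by
    rw [Finset.smul_sum, ← Finset.sum_sub_distrib]
    exact Finset.sum_congr rfl fun k _ => by rw [rrErr, map_sub, map_smul]
  -- The weights 2·α and 1·(2α) agree, so the two sums enter with opposite signs and the same
  -- coefficient, and the noise drops out of their difference.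
  have h4 : ∑ k ∈ Finset.Ico n₀ n, poissonNext Q (fun z => A z - Abar) (ω (k + 1))
        (A (ω (k + 1)) (errIter A ε α e₀ ω k - errIter A ε (2 * α) e₀ ω k)) =
      (∑ k ∈ Finset.Ico n₀ n, poissonNext Q (fun z => A z - Abar) (ω (k + 1))
        (A (ω (k + 1)) (errIter A ε α e₀ ω k) + ε (ω (k + 1)))) -
      ∑ k ∈ Finset.Ico n₀ n, poissonNext Q (fun z => A z - Abar) (ω (k + 1))
        (A (ω (k + 1)) (errIter A ε (2 * α) e₀ ω k) + ε (ω (k + 1))) := by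
    rw [← Finset.sum_sub_distrib]
    refine Finset.sum_congr rfl fun k _ => ?_
    rw [← map_sub, map_sub (A _)]
    congr 1
    abel
  have h5 : ∑ k ∈ Finset.Ico n₀ n, rrErr A ε α e₀ ω k =
      (2 : ℝ) • (∑ k ∈ Finset.Ico n₀ n, errIter A ε α e₀ ω k) -
        ∑ k ∈ Finset.Ico n₀ n, errIter A ε (2 * α) e₀ ω k := by
    rw [Finset.smul_sum, ← Finset.sum_sub_distrib]
    rfl
  rw [h3, h4, h5, map_sub, map_smul, h1, h2]
  simp only [rrErr, map_sub, map_smul]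
  module

namespace ErrorSystem

variable (H : ErrorSystem Q π tmix A Abar ε P c D a)

include H

/-- The triangle inequality in `sum_rrErr_eq`. The coefficient 5/α is 4/α from the process with step
α plus 1/α from the one with step 2α, and the combined error has norm at most 3R. -/
theorem norm_sum_rrErr_le {α R : ℝ} (hα : 0 < α) {e₀ : Vec d} {ω : ℕ → Z}
    {n₀ n : ℕ} (hn : n₀ ≤ n) (h1 : ∀ k, n₀ ≤ k → k ≤ n → ‖errIter A ε α e₀ ω k‖ ≤ R)
    (h2 : ∀ k, n₀ ≤ k → k ≤ n → ‖errIter A ε (2 * α) e₀ ω k‖ ≤ R) :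
    ‖Abar (∑ k ∈ Finset.Ico n₀ n, rrErr A ε α e₀ ω k)‖ ≤
      5 * (α⁻¹ * R) + 6 * (D * R) + 4 * (α * (((n : ℝ) - n₀) * (D ^ 2 * R))) + 2 * D +
      ‖∑ k ∈ Finset.Ico n₀ n, mgInc Q ε (ω k) (ω (k + 1))‖ +
      ‖∑ k ∈ Finset.Ico n₀ n,
        mgInc Q (fun z => A z - Abar) (ω k) (ω (k + 1)) (rrErr A ε α e₀ ω k)‖ := by
  have hD0 := H.D_pos
  have hrr : ∀ k, n₀ ≤ k → k ≤ n → ‖rrErr A ε α e₀ ω k‖ ≤ 3 * R := fun k hk hk' => by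
    refine (norm_sub_le _ _).trans ?_
    rw [norm_smul, Real.norm_of_nonneg zero_le_two]
    linarith [h1 k hk hk', h2 k hk hk']
  have b1 : ‖(2 * α⁻¹) • (errIter A ε α e₀ ω n₀ - errIter A ε α e₀ ω n)‖ ≤
      2 * α⁻¹ * (2 * R) := by
    rw [norm_smul, Real.norm_of_nonneg (by positivity)]
    refine mul_le_mul_of_nonneg_left ((norm_sub_le _ _).trans ?_) (by positivity)
    linarith [h1 n₀ le_rfl hn, h1 n hn le_rfl]
  have b2 : ‖(2 * α)⁻¹ • (errIter A ε (2 * α) e₀ ω n₀ - errIter A ε (2 * α) e₀ ω n)‖ ≤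
      (2 * α)⁻¹ * (2 * R) := by
    rw [norm_smul, Real.norm_of_nonneg (by positivity)]
    refine mul_le_mul_of_nonneg_left ((norm_sub_le _ _).trans ?_) (by positivity)
    linarith [h2 n₀ le_rfl hn, h2 n hn le_rfl]
  have b3 : ‖∑ k ∈ Finset.Ico n₀ n, ε (ω (k + 1))‖ ≤
      ‖∑ k ∈ Finset.Ico n₀ n, mgInc Q ε (ω k) (ω (k + 1))‖ + 2 * D := by
    rw [sum_eq_sum_mgInc_add Q ε ω hn]
    refine (norm_add_le _ _).trans (add_le_add le_rfl ((norm_sub_le _ _).trans ?_))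
    linarith [H.poissonNext_ε_le (ω n₀), H.poissonNext_ε_le (ω n)]
  have b4 : ∀ k, n₀ ≤ k → k ≤ n →
      ‖poissonNext Q (fun z => A z - Abar) (ω k) (rrErr A ε α e₀ ω k)‖ ≤ D * (3 * R) :=
    fun k hk hk' => (ContinuousLinearMap.le_of_opNorm_le _ (H.poissonNext_A_le (ω k)) _).trans
      (mul_le_mul_of_nonneg_left (hrr k hk hk') hD0.le)
  have b5 : ‖(2 * α) • ∑ k ∈ Finset.Ico n₀ n, poissonNext Q (fun z => A z - Abar) (ω (k + 1))
        (A (ω (k + 1)) (errIter A ε α e₀ ω k - errIter A ε (2 * α) e₀ ω k))‖ ≤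
      2 * α * (((n : ℝ) - n₀) * (D * (D * (2 * R)))) := by
    rw [norm_smul, Real.norm_of_nonneg (by positivity)]
    refine mul_le_mul_of_nonneg_left ?_ (by positivity)
    have hcard : ((n : ℝ) - n₀) * (D * (D * (2 * R))) =
        ∑ _k ∈ Finset.Ico n₀ n, D * (D * (2 * R)) := by
      rw [Finset.sum_const, Nat.card_Ico, nsmul_eq_mul, Nat.cast_sub hn]
    rw [hcard]
    refine norm_sum_le_of_le _ fun k hk => ?_
    obtain ⟨hk1, hk2⟩ := Finset.mem_Ico.1 hk
    refine (ContinuousLinearMap.le_of_opNorm_le _ (H.poissonNext_A_le _) _).trans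
      (mul_le_mul_of_nonneg_left ?_ hD0.le)
    refine (ContinuousLinearMap.le_of_opNorm_le _ (H.A_le _) _).trans
      (mul_le_mul_of_nonneg_left ((norm_sub_le _ _).trans ?_) hD0.le)
    linarith [h1 k hk1 hk2.le, h2 k hk1 hk2.le]
  rw [sum_rrErr_eq Q A Abar ε hα.ne' e₀ ω hn]
  refine (norm_add_le _ _).trans ?_
  refine (add_le_add (norm_sub_le _ _) b5).trans ?_
  have b6 := norm_sub_le (poissonNext Q (fun z => A z - Abar) (ω n₀) (rrErr A ε α e₀ ω n₀))
    (poissonNext Q (fun z => A z - Abar) (ω n) (rrErr A ε α e₀ ω n))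
  have b7 := b4 n₀ le_rfl hn
  have b8 := b4 n hn le_rfl
  refine (add_le_add (add_le_add ((norm_sub_le _ _).trans (add_le_add ((norm_sub_le _ _).trans
    (add_le_add ((norm_sub_le _ _).trans (add_le_add b1 b2)) b3)) le_rfl))
      (b6.trans (add_le_add b7 b8))) le_rfl).trans ?_
  rw [mul_inv]
  linarith

/-- The high-probability bound on the averaged Richardson-Romberg error. -/
theorem measure_norm_sum_rrErr_le [NeZero d] {ξ : Measure Z} [IsProbabilityMeasure ξ] {α : ℝ}
    (hα : 0 < α) (hαD : 124 * (2 * α * D ^ 3) ≤ 1) {C₃ : ℝ} (hC₃ : 496 * D ^ 6 ≤ C₃ * a)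
    (hC₃' : 2 * D ^ 3 ≤ C₃) {q : ℕ} (hq : 2 ≤ q) {l : ℝ} (hl : l = C₃ * (q * (2 * α)))
    (hl1 : l ≤ 1) (hqa : q * a * (2 * α) ≤ 1) (e₀ : Vec d) {n₀ n : ℕ} (hn₀ : 1 ≤ n₀)
    (hn : n₀ ≤ n) {p : ℝ} (hp : 1 ≤ p) (hpn : p ≤ (n : ℝ) - n₀) (hpq : p + Real.log n ≤ q)
    {F G R : ℝ} (hF : F = c * mixConst tmix) (hG : G = 4 * F ^ 2 * mixConst tmix)
    (hR : R = 20 * D * (Real.exp (-(a * α * n₀ / 8)) * ‖e₀‖ + Real.sqrt l)) :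
    chainLaw Q ξ {ω | 5 * (α⁻¹ * R) + 6 * (D * R) +
        4 * (α * (((n : ℝ) - n₀) * (D ^ 2 * R))) + 2 * D +
        6 * Real.sqrt (p * (((n : ℝ) - n₀) * ∑ i, asympVar Q π (fun z => ε z i) +
        d * ((16 * F ^ 2 + 8 * G + 1) * Real.sqrt (p * ((n : ℝ) - n₀))))) +
        6 * Real.sqrt (p * (d * (((n : ℝ) - n₀) * (D * (3 * R)) ^ 2))) <
        ‖Abar (∑ k ∈ Finset.Ico n₀ n, rrErr A ε α e₀ ω k)‖} ≤
      ENNReal.ofReal (4 * Real.exp (-p)) := by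
  have hD0 := H.D_pos
  have ha := H.a_pos
  have hn1 : (1 : ℝ) ≤ n := by exact_mod_cast hn₀.trans hn
  have hC30 : 0 < C₃ := lt_of_lt_of_le (by positivity) hC₃'
  have hq0 : (0 : ℝ) < q := by exact_mod_cast (show 0 < q by omega)
  have hl0 : 0 < l := by rw [hl]; positivity
  have hR0 : 0 < R := by
    have := Real.sqrt_pos.2 hl0
    rw [hR]
    positivity
  have hm : ∀ β k, MeasurableUpTo k fun ω : ℕ → Z => errIter A ε β e₀ ω k := fun β k =>
    measurableUpTo_errIter H.stronglyMeasurable_A H.stronglyMeasurable_ε.measurable β e₀ k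
  -- the error of each of the two processes is bounded by `R` on the averaging window
  have hexc : ∀ β, (β = α ∨ β = 2 * α) → ∀ k, n₀ ≤ k →
      chainLaw Q ξ {ω | R < ‖errIter A ε β e₀ ω k‖} ≤ ENNReal.ofReal (Real.exp (-q)) := by
    intro β hβ k hk
    have hβ1 : α ≤ β := by rcases hβ with rfl | rfl <;> linarith
    have hβ2 : β ≤ 2 * α := by rcases hβ with rfl | rfl <;> linarith
    have hβ0 : 0 < β := lt_of_lt_of_le hα hβ1
    have hlβ : C₃ * (q * β) ≤ l := by
      rw [hl]
      gcongr
    refine le_trans (measure_mono fun ω hω => ?_) (H.measure_norm_errIter_le (ξ := ξ) hβ0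
      (le_trans (by gcongr) hαD) hC₃ hC₃' hq rfl (hlβ.trans hl1) (le_trans (by gcongr) hqa) e₀ k)
    refine lt_of_le_of_lt ?_ (Set.mem_ofPred.1 hω)
    rw [hR]
    gcongr
  -- The Azuma inequality needs a process bounded everywhere. Truncation at 3R keeps the process
  -- adapted and changes nothing on the event where both errors are at most R.
  set w : ℕ → (ℕ → Z) → Vec d := fun k ω =>
    if ‖rrErr A ε α e₀ ω k‖ ≤ 3 * R then rrErr A ε α e₀ ω k else 0 with hw
  have hwm : ∀ k, MeasurableUpTo k (w k) := fun k => by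
    have h1 : MeasurableUpTo k fun ω : ℕ → Z => rrErr A ε α e₀ ω k :=
      ((hm α k).prodMk (hm (2 * α) k)).comp (g := fun t : Vec d × Vec d => (2 : ℝ) • t.1 - t.2)
        (by fun_prop)
    exact h1.comp (g := fun x : Vec d => if ‖x‖ ≤ 3 * R then x else 0)
      (Measurable.ite (measurableSet_le measurable_norm measurable_const) measurable_id
        measurable_const)
  have hwR : ∀ k ω, ‖w k ω‖ ≤ 3 * R := fun k ω => by
    simp only [hw]
    split_ifs with h
    · exact h
    · simpa using hR0.le
  have hT := measure_sum_mgInc_apply_le (ξ := ξ) H.tmix_pos H.mixing H.invariant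
    H.stronglyMeasurable_centered H.centered_le H.integral_A hwm (R := 3 * R) (by positivity) hwR
    hD0 H.mix_le hn hp hpn
  have hS := measure_sum_mgInc_le (ξ := ξ) H.tmix_pos H.mixing H.invariant
    H.stronglyMeasurable_ε H.noise_le H.integral_ε hF hG hn hp hpn
  set T : Set (ℕ → Z) := {ω | 6 * Real.sqrt (p * (d * (((n : ℝ) - n₀) * (D * (3 * R)) ^ 2))) <
    ‖∑ k ∈ Finset.Ico n₀ n, mgInc Q (fun z => A z - Abar) (ω k) (ω (k + 1)) (w k ω)‖} with hTdef
  set V : Set (ℕ → Z) := {ω | 6 * Real.sqrt (p * (((n : ℝ) - n₀) *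
    ∑ i, asympVar Q π (fun z => ε z i) +
    d * ((16 * F ^ 2 + 8 * G + 1) * Real.sqrt (p * ((n : ℝ) - n₀))))) <
    ‖∑ k ∈ Finset.Ico n₀ n, mgInc Q ε (ω k) (ω (k + 1))‖} with hVdef
  set U : ℝ → Set (ℕ → Z) := fun β =>
    ⋃ k ∈ Finset.Icc n₀ n, {ω | R < ‖errIter A ε β e₀ ω k‖} with hU
  have hUm : ∀ β, (β = α ∨ β = 2 * α) →
      chainLaw Q ξ (U β) ≤ ENNReal.ofReal (Real.exp (-p)) := by
    intro β hβ
    refine (measure_biUnion_finset_le _ _).trans ((Finset.sum_le_sum fun k hk =>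
      hexc β hβ k (Finset.mem_Icc.1 hk).1).trans ?_)
    rw [Finset.sum_const, Nat.card_Icc, nsmul_eq_mul, ← ENNReal.ofReal_natCast,
      ← ENNReal.ofReal_mul (Nat.cast_nonneg _)]
    refine ENNReal.ofReal_le_ofReal ?_
    -- The window including its right end has at most n times because n₀ ≥ 1; the factor n is the
    -- log n contained in q.
    have h1 : ((n + 1 - n₀ : ℕ) : ℝ) ≤ n := by exact_mod_cast (show n + 1 - n₀ ≤ n by omega)
    refine (mul_le_mul_of_nonneg_right h1 (Real.exp_pos _).le).trans ?_
    have h2 : (n : ℝ) * Real.exp (-q) = Real.exp (Real.log n - q) := by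
      rw [sub_eq_add_neg, Real.exp_add, Real.exp_log (by linarith)]
    rw [h2]
    exact Real.exp_le_exp.2 (by linarith)
  refine le_trans (measure_mono (t := ((U α ∪ U (2 * α)) ∪ V) ∪ T) fun ω hω => ?_) ?_
  · by_contra hcon
    simp only [Set.mem_union, not_or] at hcon
    obtain ⟨⟨⟨h1, h2⟩, h3⟩, h4⟩ := hcon
    simp only [hU, Set.mem_iUnion, Finset.mem_Icc, not_exists] at h1 h2
    have h1' : ∀ k, n₀ ≤ k → k ≤ n → ‖errIter A ε α e₀ ω k‖ ≤ R := fun k hk hk' =>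
      not_lt.1 (h1 k ⟨hk, hk'⟩)
    have h2' : ∀ k, n₀ ≤ k → k ≤ n → ‖errIter A ε (2 * α) e₀ ω k‖ ≤ R := fun k hk hk' =>
      not_lt.1 (h2 k ⟨hk, hk'⟩)
    have h3' := not_lt.1 (fun hh => h3 (Set.mem_ofPred.2 hh))
    have h4' := not_lt.1 (fun hh => h4 (Set.mem_ofPred.2 hh))
    have hweq : ∑ k ∈ Finset.Ico n₀ n,
        mgInc Q (fun z => A z - Abar) (ω k) (ω (k + 1)) (w k ω) =
        ∑ k ∈ Finset.Ico n₀ n,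
        mgInc Q (fun z => A z - Abar) (ω k) (ω (k + 1)) (rrErr A ε α e₀ ω k) := by
      refine Finset.sum_congr rfl fun k hk => ?_
      obtain ⟨hk1, hk2⟩ := Finset.mem_Ico.1 hk
      simp only [hw]
      rw [if_pos]
      refine (norm_sub_le _ _).trans ?_
      rw [norm_smul, Real.norm_of_nonneg zero_le_two]
      linarith [h1' k hk1 hk2.le, h2' k hk1 hk2.le]
    rw [hweq] at h4'
    have hfin := H.norm_sum_rrErr_le hα hn h1' h2'
    have := Set.mem_ofPred.1 hω
    linarith
  · have e4 : ENNReal.ofReal (4 * Real.exp (-p)) =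
        ENNReal.ofReal (Real.exp (-p)) + ENNReal.ofReal (Real.exp (-p)) +
          ENNReal.ofReal (Real.exp (-p)) + ENNReal.ofReal (Real.exp (-p)) := by
      rw [← ENNReal.ofReal_add (by positivity) (by positivity),
        ← ENNReal.ofReal_add (by positivity) (by positivity),
        ← ENNReal.ofReal_add (by positivity) (by positivity)]
      congr 1
      ring
    rw [e4]
    exact (measure_union_le _ _).trans (add_le_add ((measure_union_le _ _).trans (add_le_add
      ((measure_union_le _ _).trans (add_le_add (hUm α (Or.inl rfl)) (hUm _ (Or.inr rfl))))
        hS)) hT)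

end ErrorSystem

end RichardsonRomberg

/-! ### Lyapunov's theorem through the Cayley transform. -/

section Lyapunov

variable {d : ℕ}

/-- Gelfand's formula for the ℓ^∞ operator norm, which dominates each entry. -/
theorem exists_pow_apply_le [NeZero d] (X : Matrix (Fin d) (Fin d) ℂ)
    (hX : ∀ μ ∈ spectrum ℂ X, ‖μ‖ < 1) :
    ∃ r : ℝ, 0 ≤ r ∧ r < 1 ∧ ∀ᶠ n : ℕ in Filter.atTop, ∀ i j, ‖(X ^ n) i j‖ ≤ r ^ n := by
  let _ := Matrix.linftyOpNormedRing (n := Fin d) (α := ℂ)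
  let _ := Matrix.linftyOpNormedAlgebra (R := ℂ) (n := Fin d) (α := ℂ)
  have : CompleteSpace (Matrix (Fin d) (Fin d) ℂ) := FiniteDimensional.complete ℂ _
  have h1 : spectralRadius ℂ X < (1 : NNReal) := spectrum.spectralRadius_lt_of_forall_lt X hX
  obtain ⟨r, hr, hr1⟩ := ENNReal.lt_iff_exists_nnreal_btwn.1 h1
  refine ⟨r, r.2, by exact_mod_cast hr1, ?_⟩
  filter_upwards [(spectrum.pow_nnnorm_pow_one_div_tendsto_nhds_spectralRadius X).eventually
    (gt_mem_nhds hr), Filter.eventually_ge_atTop 1] with n hn hn1 i j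
  have hn0 : (n : ℝ) ≠ 0 := by positivity
  have h2 : (‖X ^ n‖₊ : ℝ≥0∞) ≤ (r : ℝ≥0∞) ^ n := by
    have h3 := ENNReal.rpow_le_rpow hn.le (Nat.cast_nonneg (α := ℝ) n)
    rwa [← ENNReal.rpow_mul, one_div, inv_mul_cancel₀ hn0, ENNReal.rpow_one,
      ENNReal.rpow_natCast] at h3
  have h4 : ‖X ^ n‖₊ ≤ r ^ n := by exact_mod_cast h2
  have h5 : ‖(X ^ n) i j‖₊ ≤ ‖X ^ n‖₊ := by
    rw [Matrix.linfty_opNNNorm_def]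
    exact (Finset.single_le_sum (f := fun j => ‖(X ^ n) i j‖₊) (fun _ _ => zero_le)
      (Finset.mem_univ j)).trans
      (Finset.le_sup (f := fun i => ∑ j, ‖(X ^ n) i j‖₊) (Finset.mem_univ i))
  exact_mod_cast h5.trans h4

theorem isUnit_add_of_isHurwitz {M : Matrix (Fin d) (Fin d) ℝ} (hM : IsHurwitz (-M)) {μ : ℂ}
    (hμ : 0 ≤ μ.re) :
    IsUnit (algebraMap ℂ (Matrix (Fin d) (Fin d) ℂ) μ + Complex.ofRealHom.mapMatrix M) := by
  have h1 : μ ∉ spectrum ℂ ((-M).map (fun x : ℝ => (x : ℂ))) := fun h =>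
    absurd (hM μ h) (not_lt.2 hμ)
  have h2 : (-M).map (fun x : ℝ => (x : ℂ)) = -Complex.ofRealHom.mapMatrix M := by
    ext i j
    simp
  rw [spectrum.notMem_iff, h2, sub_neg_eq_add] at h1
  exact h1

/-- Used with t = 1 to form the Cayley transform and with t = 0 to invert Ā. -/
theorem isUnit_det_add_smul_one_of_isHurwitz {M : Matrix (Fin d) (Fin d) ℝ}
    (hM : IsHurwitz (-M)) {t : ℝ} (ht : 0 ≤ t) : IsUnit (M + t • 1).det := by
  have h1 := isUnit_add_of_isHurwitz hM (μ := (t : ℂ)) (by simpa)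
  rw [Matrix.isUnit_iff_isUnit_det] at h1
  have h2 : algebraMap ℂ (Matrix (Fin d) (Fin d) ℂ) (t : ℂ) + Complex.ofRealHom.mapMatrix M =
      Complex.ofRealHom.mapMatrix (M + t • 1) := by
    ext i j
    by_cases hij : i = j <;>
      simp [Matrix.algebraMap_matrix_apply, add_comm, hij]
  rw [h2, ← RingHom.map_det, isUnit_iff_ne_zero] at h1
  rw [isUnit_iff_ne_zero]
  rintro h0
  simp [h0] at h1

/-- For μ ≠ 1, (μ − C)(N + 1) = (μ − 1)((μ + 1)/(μ − 1) + N). The real part of (μ + 1)/(μ − 1) has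
the sign of |μ|² − 1, so the right side is invertible when |μ| ≥ 1. -/
theorem norm_lt_one_of_mem_spectrum_cayley {M C : Matrix (Fin d) (Fin d) ℝ}
    (hM : IsHurwitz (-M)) (hC : C * (M + 1) = M - 1) :
    ∀ μ ∈ spectrum ℂ (Complex.ofRealHom.mapMatrix C), ‖μ‖ < 1 := by
  intro μ hμ
  by_contra! hcon
  refine hμ ?_
  rw [spectrum.mem_resolventSet_iff]
  set N := Complex.ofRealHom.mapMatrix M with hN
  have h1 : Complex.ofRealHom.mapMatrix C * (N + 1) = N - 1 := by
    rw [hN, ← map_one (Complex.ofRealHom.mapMatrix (m := Fin d)), ← map_add, ← map_mul, hC,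
      map_sub]
  have h2 : (algebraMap ℂ _ μ - Complex.ofRealHom.mapMatrix C) * (N + 1) =
      algebraMap ℂ _ (μ - 1) * N + algebraMap ℂ _ (μ + 1) := by
    rw [sub_mul, h1, map_sub, map_add, map_one]
    noncomm_ring
  have h3 : IsUnit ((algebraMap ℂ _ μ - Complex.ofRealHom.mapMatrix C) * (N + 1)) := by
    rw [h2]
    by_cases hμ1 : μ = 1
    · rw [hμ1, sub_self, map_zero, zero_mul, zero_add]
      exact (IsUnit.mk0 (1 + 1 : ℂ) (by norm_num)).map _
    · have h4 : μ - 1 ≠ 0 := sub_ne_zero.2 hμ1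
      have h5 : algebraMap ℂ (Matrix (Fin d) (Fin d) ℂ) (μ - 1) * N + algebraMap ℂ _ (μ + 1) =
          algebraMap ℂ _ (μ - 1) * (algebraMap ℂ _ ((μ + 1) / (μ - 1)) + N) := by
        rw [mul_add, ← map_mul, mul_div_cancel₀ _ h4, add_comm]
      rw [h5]
      refine ((IsUnit.mk0 _ h4).map _).mul (isUnit_add_of_isHurwitz hM ?_)
      rw [Complex.div_re, ← add_div]
      refine div_nonneg ?_ (Complex.normSq_nonneg _)
      have h6 : 1 ≤ Complex.normSq μ := by
        rw [Complex.normSq_eq_norm_sq]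
        nlinarith
      rw [Complex.normSq_apply] at h6
      simp
      nlinarith
  rw [Matrix.isUnit_iff_isUnit_det, Matrix.det_mul, IsUnit.mul_iff] at h3
  exact (Matrix.isUnit_iff_isUnit_det _).2 h3.1

theorem summable_transpose_pow_mul_mul_pow [NeZero d] {C W : Matrix (Fin d) (Fin d) ℝ}
    (hC : ∀ μ ∈ spectrum ℂ (Complex.ofRealHom.mapMatrix C), ‖μ‖ < 1) :
    Summable fun n : ℕ => (C ^ n).transpose * W * C ^ n := by
  obtain ⟨r, hr0, hr1, hr⟩ := exists_pow_apply_le _ hC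
  have hr' : ∀ᶠ n : ℕ in Filter.atTop, ∀ i j, |(C ^ n) i j| ≤ r ^ n := by
    filter_upwards [hr] with n hn i j
    have := hn i j
    rwa [← map_pow, RingHom.mapMatrix_apply, Matrix.map_apply, Complex.ofRealHom_eq_coe,
      Complex.norm_real, Real.norm_eq_abs] at this
  refine Pi.summable.2 fun i => Pi.summable.2 fun j => ?_
  simp only [Matrix.mul_apply, Matrix.transpose_apply, Finset.sum_mul]
  refine summable_sum fun k _ => summable_sum fun l _ => ?_
  refine Summable.of_norm_bounded_eventually_nat (g := fun n : ℕ => |W l k| * (r ^ 2) ^ n) ?_ ?_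
  · exact (summable_geometric_of_lt_one (sq_nonneg r) (by nlinarith)).mul_left _
  · filter_upwards [hr'] with n hn
    rw [norm_mul, norm_mul, Real.norm_eq_abs, Real.norm_eq_abs, Real.norm_eq_abs, ← pow_mul,
      mul_comm 2 n, pow_mul]
    have := mul_le_mul (hn l i) (hn k j) (abs_nonneg _) (pow_nonneg hr0 n)
    have h2 := mul_le_mul_of_nonneg_left this (abs_nonneg (W l k))
    linarith

/-- Lyapunov's theorem. -/
theorem exists_isLyapunovSolution [NeZero d] {M : Matrix (Fin d) (Fin d) ℝ}
    (hM : IsHurwitz (-M)) : ∃ P, IsLyapunovSolution M P := by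
  have hu := isUnit_det_add_smul_one_of_isHurwitz hM zero_le_one
  rw [one_smul] at hu
  set U := M + 1 with hU
  -- The Cayley transform turns the Lyapunov equation into P = W + CᵀPC, solved by a series that
  -- converges since the spectral radius of C is below 1.
  set C := (M - 1) * U⁻¹ with hCdef
  have hC : C * U = M - 1 := by rw [hCdef, Matrix.nonsing_inv_mul_cancel_right _ _ hu]
  set W : Matrix (Fin d) (Fin d) ℝ := (2 : ℝ) • ((U⁻¹).transpose * U⁻¹) with hW
  have hUW : U.transpose * W * U = (2 : ℝ) • 1 := by
    rw [hW, Matrix.mul_smul, Matrix.smul_mul, ← mul_assoc, ← Matrix.transpose_mul,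
      Matrix.nonsing_inv_mul _ hu, Matrix.transpose_one, one_mul, Matrix.nonsing_inv_mul _ hu]
  have hWpos : W.PosDef := by
    refine Matrix.PosDef.smul ?_ two_pos
    rw [← Matrix.conjTranspose_eq_transpose_of_trivial]
    refine Matrix.PosDef.conjTranspose_mul_self _ fun x y hxy => ?_
    have := congrArg (U.mulVec ·) hxy
    simpa [Matrix.mulVec_mulVec, Matrix.mul_nonsing_inv _ hu] using this
  have hs := summable_transpose_pow_mul_mul_pow (W := W)
    (norm_lt_one_of_mem_spectrum_cayley hM hC)
  set P := ∑' n : ℕ, (C ^ n).transpose * W * C ^ n with hP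
  have hfix : P = W + C.transpose * P * C := by
    conv_lhs => rw [hP, hs.tsum_eq_zero_add]
    rw [hP, ← hs.tsum_mul_left, ← (hs.mul_left _).tsum_mul_right]
    congr 1
    · simp
    · refine tsum_congr fun n => ?_
      rw [pow_succ, Matrix.transpose_mul]
      simp only [mul_assoc]
  have hn : ∀ n : ℕ, ((C ^ n).transpose * W * C ^ n).PosSemidef := fun n => by
    rw [← Matrix.conjTranspose_eq_transpose_of_trivial]
    exact hWpos.posSemidef.conjTranspose_mul_mul_same _
  have hPpos : P.PosSemidef := by
    refine Matrix.PosSemidef.of_dotProduct_mulVec_nonneg ?_ fun x => ?_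
    · rw [Matrix.IsHermitian, hP, Matrix.conjTranspose_tsum]
      exact tsum_congr fun n => (hn n).1
    · have h1 : HasSum (fun n : ℕ => star x ⬝ᵥ ((C ^ n).transpose * W * C ^ n).mulVec x)
          (star x ⬝ᵥ P.mulVec x) :=
        hs.hasSum.map (⟨⟨fun N : Matrix (Fin d) (Fin d) ℝ => star x ⬝ᵥ N.mulVec x, by simp⟩,
          fun N N' => by simp [Matrix.add_mulVec, dotProduct_add]⟩ :
            Matrix (Fin d) (Fin d) ℝ →+ ℝ) (by
            change Continuous fun N : Matrix (Fin d) (Fin d) ℝ => star x ⬝ᵥ N.mulVec x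
            fun_prop)
      exact h1.nonneg fun n => (hn n).dotProduct_mulVec_nonneg x
  refine ⟨P, ?_, ?_⟩
  · rw [hfix]
    refine hWpos.add_posSemidef ?_
    rw [← Matrix.conjTranspose_eq_transpose_of_trivial]
    exact hPpos.conjTranspose_mul_mul_same _
  -- Congruence by U = M + 1 sends W to 2I and CᵀPC to (M − 1)ᵀP(M − 1); the difference of the two
  -- quadratic expressions is 2(MᵀP + PM).
  · have h1 : U.transpose * P * U = (2 : ℝ) • 1 + (M - 1).transpose * P * (M - 1) := by
      conv_lhs => rw [hfix]
      rw [mul_add U.transpose, add_mul _ _ U, hUW, ← hC, Matrix.transpose_mul C U]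
      simp only [mul_assoc]
    rw [hU, Matrix.transpose_add, Matrix.transpose_sub, Matrix.transpose_one] at h1
    have h2 : (2 : ℝ) • (M.transpose * P + P * M) = (2 : ℝ) • (1 : Matrix (Fin d) (Fin d) ℝ) := by
      have h3 : (2 : ℝ) • (M.transpose * P + P * M) =
          (M.transpose + 1) * P * (M + 1) - (M.transpose - 1) * P * (M - 1) := by
        rw [two_smul]
        noncomm_ring
      rw [h3, h1]
      abel
    exact smul_right_injective _ (two_ne_zero (α := ℝ)) h2

end Lyapunov

/-! ### Matrices as operators on Euclidean space. -/

section Translation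

variable {d : ℕ}

/-- The operator of a matrix on `ℝ^d`. -/
noncomputable abbrev clm (M : Matrix (Fin d) (Fin d) ℝ) : Vec d →L[ℝ] Vec d :=
  Matrix.toEuclideanCLM (n := Fin d) (𝕜 := ℝ) M

theorem inner_clm_left (M : Matrix (Fin d) (Fin d) ℝ) (x y : Vec d) :
    inner ℝ (clm M x) y = inner ℝ x (clm M.transpose y) := by
  rw [← Matrix.conjTranspose_eq_transpose_of_trivial, ← Matrix.star_eq_conjTranspose, clm, clm,
    map_star, ContinuousLinearMap.star_eq_adjoint, ContinuousLinearMap.adjoint_inner_right]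

theorem abs_apply_le_norm_clm (M : Matrix (Fin d) (Fin d) ℝ) (i j : Fin d) :
    |M i j| ≤ ‖clm M‖ := by
  have h1 : M i j = (clm M (EuclideanSpace.single j 1)) i := by simp
  rw [h1, ← Real.norm_eq_abs]
  refine (PiLp.norm_apply_le _ i).trans (((clm M).le_opNorm _).trans ?_)
  simp

/-- Measurability and integrals of operator-valued maps reduce to those of the matrix entries. -/
theorem clm_eq_sum (M : Matrix (Fin d) (Fin d) ℝ) :
    clm M = ∑ i, ∑ j, M i j • clm (Matrix.single i j 1) := by
  conv_lhs => rw [Matrix.matrix_eq_sum_single M]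
  simp only [clm, map_sum, ← map_smul, Matrix.smul_single, smul_eq_mul, mul_one]

/-- The spectrum of P is bounded below without its condition number: the Lyapunov equation enters
through the nonnegativity of the quadratic form at x − tMx. -/
theorem IsLyapunovSolution.isLyapunovOperator {M P : Matrix (Fin d) (Fin d) ℝ} [NeZero d]
    (h : IsLyapunovSolution M P) {D : ℝ} (hD : ‖clm P‖ ≤ D)
    (hD' : 4 * ‖clm P‖ * ‖clm M‖ ^ 2 ≤ D) :
    0 < ‖clm P‖ ∧ 0 < ‖clm M‖ ∧
      IsLyapunovOperator (clm M) (clm P) D (‖clm P‖⁻¹ / 2) := by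
  have hPt : P.transpose = P := by
    have := h.1.1
    rwa [Matrix.IsHermitian, Matrix.conjTranspose_eq_transpose_of_trivial] at this
  have hsymm : ∀ x y : Vec d, inner ℝ x (clm P y) = inner ℝ y (clm P x) := fun x y => by
    rw [real_inner_comm, inner_clm_left, hPt]
  have heq : ∀ x, 2 * inner ℝ (clm M x) (clm P x) = ‖x‖ ^ 2 := fun x => by
    have h1 : inner ℝ (clm M x) (clm P x) = inner ℝ x (clm (M.transpose * P) x) := by
      rw [inner_clm_left, clm, clm, clm, map_mul]
      rfl
    have h2 : inner ℝ (clm M x) (clm P x) = inner ℝ x (clm (P * M) x) := by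
      rw [hsymm, clm, clm, clm, map_mul]
      rfl
    rw [two_mul]
    nth_rw 1 [h1]
    rw [h2, ← inner_add_right, ← add_apply, clm, clm, ← map_add, h.2, map_one,
      one_apply_eq_self, real_inner_self_eq_norm_sq]
  have hx : ∃ x : Vec d, ‖x‖ = 1 := ⟨EuclideanSpace.single 0 1, by simp⟩
  obtain ⟨x₀, hx₀⟩ := hx
  have hPM : 1 ≤ 2 * (‖clm M‖ * ‖clm P‖) := by
    have h1 := heq x₀
    have h2 := real_inner_le_norm (clm M x₀) (clm P x₀)
    have h3 := mul_le_mul ((clm M).le_opNorm x₀) ((clm P).le_opNorm x₀) (norm_nonneg _)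
      (by positivity)
    rw [hx₀] at h1 h3
    linarith
  have hP0 : 0 < ‖clm P‖ := by
    rcases (norm_nonneg (clm P)).eq_or_lt with h0 | h0
    · rw [← h0] at hPM
      norm_num at hPM
    · exact h0
  have hM0 : 0 < ‖clm M‖ := by
    rcases (norm_nonneg (clm M)).eq_or_lt with h0 | h0
    · rw [← h0] at hPM
      norm_num at hPM
    · exact h0
  have hle : ∀ x : Vec d, inner ℝ x (clm P x) ≤ ‖clm P‖ * ‖x‖ ^ 2 := fun x => by
    have h1 := real_inner_le_norm x (clm P x)
    have h2 := mul_le_mul_of_nonneg_left ((clm P).le_opNorm x) (norm_nonneg x)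
    linarith
  have hnn : ∀ x : Vec d, 0 ≤ inner ℝ x (clm P x) := fun x => by
    have h1 := h.1.posSemidef.dotProduct_mulVec_nonneg (x : Fin d → ℝ)
    rw [clm, Matrix.inner_toEuclideanCLM]
    simpa using h1
  refine ⟨hP0, hM0, hsymm, fun x => ?_, fun x => ?_, hD, heq⟩
  · set B := ‖clm P‖ * ‖clm M‖ ^ 2 with hB
    have hB0 : 0 < B := by positivity
    -- This value minimizes −t + Bt², and leaves ⟨x, Px⟩ ≥ ‖x‖²/(4B).
    set t := (2 * B)⁻¹ with ht
    have h1 := hnn (x - t • clm M x)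
    have h2 : inner ℝ (x - t • clm M x) (clm P (x - t • clm M x)) =
        inner ℝ x (clm P x) - t * ‖x‖ ^ 2 + t ^ 2 * inner ℝ (clm M x) (clm P (clm M x)) := by
      simp only [map_sub, map_smul, inner_sub_left, inner_sub_right, inner_smul_left,
        inner_smul_right]
      rw [hsymm x (clm M x), ← heq x]
      simp
      ring
    have h3 : inner ℝ (clm M x) (clm P (clm M x)) ≤ B * ‖x‖ ^ 2 := by
      refine (hle _).trans ?_
      have := pow_le_pow_left₀ (norm_nonneg _) ((clm M).le_opNorm x) 2
      have := mul_le_mul_of_nonneg_left this hP0.le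
      rw [hB]
      linarith
    have h4 := mul_le_mul_of_nonneg_left h3 (sq_nonneg t)
    have h5 : t * B = 1 / 2 := by
      rw [ht]
      field_simp
    have h6 : ‖x‖ ^ 2 ≤ 4 * B * inner ℝ x (clm P x) := by
      have h7 : t / 2 * ‖x‖ ^ 2 ≤ inner ℝ x (clm P x) := by
        have : t ^ 2 * (B * ‖x‖ ^ 2) = t / 2 * ‖x‖ ^ 2 := by
          linear_combination t * ‖x‖ ^ 2 * h5
        linarith
      have h8 := mul_le_mul_of_nonneg_left h7 (show 0 ≤ 4 * B by positivity)
      have h9 : 4 * B * (t / 2 * ‖x‖ ^ 2) = ‖x‖ ^ 2 := by linear_combination 2 * ‖x‖ ^ 2 * h5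
      linarith
    exact h6.trans (mul_le_mul_of_nonneg_right (by rw [hB]; linarith) (hnn x))
  · have h1 := mul_le_mul_of_nonneg_left (hle x) (inv_nonneg.2 hP0.le)
    rw [← mul_assoc, inv_mul_cancel₀ hP0.ne', one_mul] at h1
    linarith

end Translation

/-! ### From the problem data to the error recursion. -/

namespace LSA

variable {Z : Type*} [MeasurableSpace Z] {d : ℕ} {S : LSA Z d} {tmix : ℕ}

namespace Assumptions

variable (H : S.Assumptions tmix)

include H

theorem norm_A_le (z : Z) : ‖clm (S.A z)‖ ≤ S.CA :=
  (le_ciSup H.bdd_A z).trans (le_max_left _ _)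

theorem norm_Atilde_le (z : Z) : ‖clm (S.A z) - clm S.Abar‖ ≤ S.CA := by
  rw [clm, clm, ← map_sub]
  exact (le_ciSup H.bdd_Atilde z).trans (le_max_right _ _)

theorem norm_noise_le (z : Z) : ‖S.noise z‖ ≤ S.noiseSup := le_ciSup H.bdd_noise z

theorem norm_Abar_le : ‖clm S.Abar‖ ≤ 2 * S.CA := by
  obtain ⟨z⟩ := nonempty_of_isProbabilityMeasure S.statLaw
  have h1 := norm_sub_le (clm (S.A z)) (clm (S.A z) - clm S.Abar)
  rw [sub_sub_cancel] at h1
  linarith [H.norm_A_le z, H.norm_Atilde_le z]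

theorem isLyapunovSolution [NeZero d] : IsLyapunovSolution S.Abar S.lyap := by
  have h := exists_isLyapunovSolution H.hurwitz
  rw [lyap, lyapunov, dif_pos h]
  exact h.choose_spec

theorem act_thetaStar : act S.Abar S.thetaStar = S.bbar := by
  have h := isUnit_det_add_smul_one_of_isHurwitz H.hurwitz le_rfl
  rw [zero_smul, add_zero] at h
  change clm S.Abar (clm S.Abar⁻¹ S.bbar) = S.bbar
  rw [← mul_apply_eq_comp, clm, clm, ← map_mul, Matrix.mul_nonsing_inv _ h, map_one,
    one_apply_eq_self]

theorem stronglyMeasurable_A : StronglyMeasurable fun z => clm (S.A z) := by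
  rw [funext fun z => clm_eq_sum (S.A z)]
  exact Finset.stronglyMeasurable_fun_sum _ fun i _ => Finset.stronglyMeasurable_fun_sum _ fun j _ =>
    (S.measurable_A i j).stronglyMeasurable.smul_const _

theorem stronglyMeasurable_noise : StronglyMeasurable S.noise := by
  have h : StronglyMeasurable fun z => (clm (S.A z) - clm S.Abar) S.thetaStar - (S.b z - S.bbar) :=
    (measurable_apply_of_stronglyMeasurable (H.stronglyMeasurable_A.sub stronglyMeasurable_const)
      measurable_id measurable_const).stronglyMeasurable.sub
      (S.measurable_b.stronglyMeasurable.sub stronglyMeasurable_const)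
  convert h using 2 with z
  rw [clm, clm, ← map_sub]
  rfl

theorem integral_Atilde : ∫ z, (clm (S.A z) - clm S.Abar) ∂S.statLaw = 0 := by
  have hi : ∀ i j, Integrable (fun z => S.A z i j) S.statLaw := fun i j =>
    integrable_of_bdd (S.measurable_A i j) fun z =>
      (abs_apply_le_norm_clm _ i j).trans (H.norm_A_le z)
  have hi' : ∀ i j, Integrable (fun z => S.A z i j • clm (Matrix.single i j (1 : ℝ))) S.statLaw :=
    fun i j => (hi i j).smul_const _
  have h1 : ∫ z, clm (S.A z) ∂S.statLaw = clm S.Abar := by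
    rw [clm_eq_sum S.Abar, integral_congr_ae (.of_forall fun z => clm_eq_sum (S.A z))]
    rw [integral_finsetSum _ fun i _ => integrable_finsetSum _ fun j _ => hi' i j]
    refine Finset.sum_congr rfl fun i _ => ?_
    rw [integral_finsetSum _ fun j _ => hi' i j]
    refine Finset.sum_congr rfl fun j _ => ?_
    rw [integral_smul_const, H.mean_A]
  rw [integral_sub, h1]
  · simp
  · exact Integrable.of_bound H.stronglyMeasurable_A.aestronglyMeasurable _ (.of_forall H.norm_A_le)
  · exact integrable_const _

theorem integral_noise : ∫ z, S.noise z ∂S.statLaw = 0 := by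
  have h1 : Integrable (fun z => clm (S.A z) - clm S.Abar) S.statLaw :=
    Integrable.of_bound (H.stronglyMeasurable_A.sub stronglyMeasurable_const).aestronglyMeasurable _
      (.of_forall H.norm_Atilde_le)
  have h2 : Integrable S.noise S.statLaw :=
    Integrable.of_bound H.stronglyMeasurable_noise.aestronglyMeasurable _ (.of_forall H.norm_noise_le)
  have h3 : Integrable (fun z => (clm (S.A z) - clm S.Abar) S.thetaStar) S.statLaw :=
    h1.apply_continuousLinearMap _
  have h4 : ∀ z, S.b z = (clm (S.A z) - clm S.Abar) S.thetaStar + S.bbar - S.noise z := fun z => by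
    have : S.noise z = (clm (S.A z) - clm S.Abar) S.thetaStar - (S.b z - S.bbar) := by
      rw [clm, clm, ← map_sub]
      rfl
    rw [this]
    abel
  have h5 := H.mean_b
  simp_rw [h4] at h5
  have h6 : Integrable (fun z => (clm (S.A z) - clm S.Abar) S.thetaStar + S.bbar) S.statLaw :=
    h3.add (integrable_const _)
  rw [integral_sub h6 h2, integral_add h3 (integrable_const _),
    ← ContinuousLinearMap.integral_apply h1, H.integral_Atilde] at h5
  simpa using h5

/-- Because Āθ⋆ = b̄, the noise equals A(z)θ⋆ − b(z), exactly the residual of the update at θ⋆. -/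
theorem iter_sub_thetaStar (α : ℝ) (θ₀ : Vec d) (ω : ℕ → Z) (k : ℕ) :
    S.iter α θ₀ ω k - S.thetaStar =
      errIter (fun z => clm (S.A z)) S.noise α (θ₀ - S.thetaStar) ω k := by
  induction k with
  | zero => rfl
  | succ k ih =>
    rw [iter, errIter, ← ih]
    have h1 : S.noise (ω (k + 1)) =
        clm (S.A (ω (k + 1))) S.thetaStar - S.b (ω (k + 1)) := by
      have h2 : S.noise (ω (k + 1)) = clm (S.A (ω (k + 1))) S.thetaStar -
          act S.Abar S.thetaStar - (S.b (ω (k + 1)) - S.bbar) := by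
        rw [noise, Atilde, act, map_sub]
        rfl
      rw [h2, H.act_thetaStar]
      abel
    rw [h1, map_sub]
    change _ - _ • (clm (S.A (ω (k + 1))) _ - _) - _ = _
    module

theorem act_rrAverage_sub (α : ℝ) (θ₀ : Vec d) {n₀ n : ℕ} (hn : n₀ < n) (ω : ℕ → Z) :
    act S.Abar (S.rrAverage α θ₀ n₀ n ω - S.thetaStar) = ((n : ℝ) - n₀)⁻¹ •
      clm S.Abar (∑ k ∈ Finset.Ico n₀ n,
        rrErr (fun z => clm (S.A z)) S.noise α (θ₀ - S.thetaStar) ω k) := by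
  have hn' : (n : ℝ) - n₀ ≠ 0 := by
    have : (n₀ : ℝ) < n := by exact_mod_cast hn
    linarith
  have h1 : ∀ β : ℝ, S.prAverage β θ₀ n₀ n ω - S.thetaStar = ((n : ℝ) - n₀)⁻¹ •
      ∑ k ∈ Finset.Ico n₀ n,
        errIter (fun z => clm (S.A z)) S.noise β (θ₀ - S.thetaStar) ω k := fun β => by
    simp_rw [← H.iter_sub_thetaStar]
    rw [Finset.sum_sub_distrib, smul_sub, Finset.sum_const, Nat.card_Ico, ← Nat.cast_smul_eq_nsmul ℝ,
      Nat.cast_sub hn.le, smul_smul, inv_mul_cancel₀ hn', one_smul, prAverage]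
  change clm S.Abar _ = _
  rw [← map_smul]
  congr 1
  have h2 : S.rrAverage α θ₀ n₀ n ω - S.thetaStar =
      (2 : ℝ) • (S.prAverage α θ₀ n₀ n ω - S.thetaStar) -
        (S.prAverage (2 * α) θ₀ n₀ n ω - S.thetaStar) := by
    rw [rrAverage]
    module
  rw [h2, h1, h1]
  simp only [rrErr, Finset.sum_sub_distrib, ← Finset.smul_sum, smul_sub]
  rw [smul_comm]

end Assumptions

end LSA

/-! ### Condition number and weighted operator norm. -/

section Weighted

variable {d : ℕ} [NeZero d]

theorem condNumber_pos {P : Matrix (Fin d) (Fin d) ℝ} (hP : P.PosDef) : 0 < condNumber P := by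
  have h1 : spectrum ℝ P = Set.range hP.1.eigenvalues :=
    Matrix.IsHermitian.spectrum_real_eq_range_eigenvalues _
  have h2 : (spectrum ℝ P).Nonempty := by
    rw [h1]
    exact Set.range_nonempty _
  have h3 : (spectrum ℝ P).Finite := by
    rw [h1]
    exact Set.finite_range _
  have h4 : ∀ x ∈ spectrum ℝ P, 0 < x := by
    rw [h1]
    rintro _ ⟨i, rfl⟩
    exact hP.eigenvalues_pos i
  exact div_pos (h4 _ (h2.csSup_mem h3)) (h4 _ (h2.csInf_mem h3))

/-- An upper bound on this norm gives a lower bound on α_∞, where it appears as an inverse square.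
Positivity makes the inversion meaningful, and comes from Mx ≠ 0 for x ≠ 0, a consequence of the
Lyapunov equation. -/
theorem IsLyapunovOperator.wOpNorm_mem {M P : Matrix (Fin d) (Fin d) ℝ} {D a : ℝ}
    (h : IsLyapunovOperator (clm M) (clm P) D a) (hD : 0 < D) :
    0 < wOpNorm P M ∧ wOpNorm P M ^ 2 ≤ ‖clm P‖ * ‖clm M‖ ^ 2 * D := by
  have hpos : ∀ x : Vec d, x ≠ 0 → 0 < inner ℝ x (clm P x) := fun x hx => by
    have h1 := h.lower x
    have h2 : 0 < ‖x‖ ^ 2 := by positivity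
    exact pos_of_mul_pos_right (h2.trans_le h1) hD.le
  have hub : ∀ r ∈ {r | ∃ x : Vec d, wNorm P x = 1 ∧ r = wNorm P (act M x)},
      r ≤ Real.sqrt (‖clm P‖ * ‖clm M‖ ^ 2 * D) := by
    rintro _ ⟨x, hx, rfl⟩
    refine Real.sqrt_le_sqrt ?_
    change inner ℝ (clm M x) (clm P (clm M x)) ≤ _
    have h1 : inner ℝ x (clm P x) = 1 := Real.sqrt_eq_one.1 hx
    have h2 := h.lower x
    rw [h1, mul_one] at h2
    have h3 := real_inner_le_norm (clm M x) (clm P (clm M x))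
    have h4 := mul_le_mul_of_nonneg_left ((clm P).le_opNorm (clm M x)) (norm_nonneg (clm M x))
    have h5 := pow_le_pow_left₀ (norm_nonneg _) ((clm M).le_opNorm x) 2
    have h6 := mul_le_mul_of_nonneg_left h5 (norm_nonneg (clm P))
    have h7 := mul_le_mul_of_nonneg_left h2
      (show 0 ≤ ‖clm P‖ * ‖clm M‖ ^ 2 by positivity)
    linarith
  set x₀ : Vec d := EuclideanSpace.single 0 1 with hx₀
  have hx₀1 : x₀ ≠ 0 := by
    rw [← norm_ne_zero_iff, hx₀]
    simp
  set W := inner ℝ x₀ (clm P x₀) with hW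
  have hW0 : 0 < W := hpos x₀ hx₀1
  set x := (Real.sqrt W)⁻¹ • x₀ with hx
  have hs : 0 < Real.sqrt W := Real.sqrt_pos.2 hW0
  have hx1 : x ≠ 0 := smul_ne_zero (inv_ne_zero hs.ne') hx₀1
  have hxn : wNorm P x = 1 := by
    refine Real.sqrt_eq_one.2 ?_
    change inner ℝ x (clm P x) = 1
    rw [hx, map_smul, inner_smul_left, inner_smul_right, ← hW]
    simp only [conj_trivial]
    rw [← mul_assoc, ← mul_inv, Real.mul_self_sqrt hW0.le, inv_mul_cancel₀ hW0.ne']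
  have hMx : clm M x ≠ 0 := fun h0 => by
    have h1 := h.eq x
    rw [h0, inner_zero_left, mul_zero] at h1
    exact hx1 (by simpa using h1.symm)
  have h1 : wNorm P (act M x) ≤ wOpNorm P M := le_csSup ⟨_, hub⟩ ⟨x, hxn, rfl⟩
  refine ⟨(Real.sqrt_pos.2 (hpos _ hMx)).trans_le h1, ?_⟩
  have h2 : wOpNorm P M ≤ Real.sqrt (‖clm P‖ * ‖clm M‖ ^ 2 * D) :=
    csSup_le ⟨_, x, hxn, rfl⟩ hub
  have h3 : 0 ≤ wOpNorm P M := (Real.sqrt_nonneg _).trans h1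
  exact (Real.le_sqrt h3 (by positivity)).1 h2

end Weighted

/-- A bound for the noise and the centered matrices. -/
noncomputable def noiseBound (CA εsup : ℝ) : ℝ := CA + εsup

/-- A bound for all the operators attached to a problem. -/
noncomputable def sizeBound (tmix : ℕ) (a CA εsup : ℝ) : ℝ :=
  1 + 2 * CA + noiseBound CA εsup + 2 * (noiseBound CA εsup * mixConst tmix) + (2 * a)⁻¹ +
    8 * CA ^ 2 / a

/-- A lower bound for `p` times the step size `α_{p,∞}^{(b)}`. -/
noncomputable def stepBound (d tmix : ℕ) (a κ CA D : ℝ) : ℝ :=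
  min (min (min (min (min (a * ((2 * a)⁻¹ * (2 * CA) ^ 2 * D)⁻¹) (2 * a)⁻¹)
      ((Real.sqrt κ)⁻¹ * CA⁻¹)) (a / (6 * Real.exp 1 * κ * CA)) *
        ((⌈8 * Real.sqrt κ * CA / a⌉ : ℤ) : ℝ)⁻¹)
    (min (a / (12 * (4 * (Real.sqrt κ * CA + a / 6) ^ 2 * (⌈8 * Real.sqrt κ * CA / a⌉ : ℤ))) /
      (1 + Real.log d)) (1 / (1 + CA)))) (1 / a) * (tmix : ℝ)⁻¹

/-! ### Uniform constants and bounds on the step size. -/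

namespace LSA

variable {Z : Type*} [MeasurableSpace Z] {d : ℕ} {S : LSA Z d} {tmix : ℕ}

namespace Assumptions

variable (H : S.Assumptions tmix)

include H

theorem noiseSup_nonneg : 0 ≤ S.noiseSup := by
  obtain ⟨z⟩ := nonempty_of_isProbabilityMeasure S.statLaw
  exact (norm_nonneg _).trans (H.norm_noise_le z)

variable [NeZero d]

theorem norm_lyap_pos : 0 < ‖clm S.lyap‖ :=
  (H.isLyapunovSolution.isLyapunovOperator (le_max_left _ _) (le_max_right _ _)).1

theorem a_pos : 0 < S.a := half_pos (inv_pos.2 H.norm_lyap_pos)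

theorem norm_lyap : ‖clm S.lyap‖ = (2 * S.a)⁻¹ := by
  change _ = (2 * (‖clm S.lyap‖⁻¹ / 2))⁻¹
  rw [mul_div_cancel₀ _ two_ne_zero, inv_inv]

theorem CA_pos : 0 < S.CA := by
  have h := (H.isLyapunovSolution.isLyapunovOperator (le_max_left _ _) (le_max_right _ _)).2.1
  linarith [H.norm_Abar_le]

theorem kappa_pos : 0 < S.kappa := condNumber_pos H.isLyapunovSolution.1

theorem one_le_sizeBound : 1 ≤ sizeBound tmix S.a S.CA S.noiseSup := by
  have h1 := H.CA_pos
  have h2 := H.a_pos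
  have h3 := H.noiseSup_nonneg
  have h4 := mixConst_nonneg tmix
  have : 0 ≤ 2 * S.CA + noiseBound S.CA S.noiseSup +
      2 * (noiseBound S.CA S.noiseSup * mixConst tmix) + (2 * S.a)⁻¹ + 8 * S.CA ^ 2 / S.a := by
    unfold noiseBound
    positivity
  unfold sizeBound
  linarith

/-- The summands of `sizeBound` answer the separate requirements on D; in particular ‖P‖ = 1/(2a),
and 8·CA²/a bounds 4‖P‖‖Ā‖², which the lower bound on P needs. -/
theorem errorSystem : ErrorSystem S.Q S.statLaw tmix (fun z => clm (S.A z)) (clm S.Abar) S.noise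
    (clm S.lyap) (noiseBound S.CA S.noiseSup) (sizeBound tmix S.a S.CA S.noiseSup) S.a := by
  have h1 := H.CA_pos
  have h2 := H.a_pos
  have h3 := H.noiseSup_nonneg
  have h4 := mixConst_nonneg tmix
  have h5 : 0 ≤ noiseBound S.CA S.noiseSup := by
    unfold noiseBound
    positivity
  have h6 : 0 ≤ 2 * (noiseBound S.CA S.noiseSup * mixConst tmix) := by positivity
  have h7 : 0 ≤ (2 * S.a)⁻¹ := by positivity
  have h8 : 0 ≤ 8 * S.CA ^ 2 / S.a := by positivity
  refine
    { tmix_pos := H.tmix_pos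
      mixing := H.mixing
      invariant := H.invariant
      stronglyMeasurable_A := H.stronglyMeasurable_A
      stronglyMeasurable_ε := H.stronglyMeasurable_noise
      centered_le := fun z => (H.norm_Atilde_le z).trans (by unfold noiseBound; linarith)
      noise_le := fun z => (H.norm_noise_le z).trans (by unfold noiseBound; linarith)
      integral_A := H.integral_Atilde
      integral_ε := H.integral_noise
      le_D := by unfold sizeBound; linarith
      mix_le := by unfold sizeBound; linarith
      one_le := H.one_le_sizeBound
      A_le := fun z => (H.norm_A_le z).trans (by unfold sizeBound; linarith)
      Abar_le := H.norm_Abar_le.trans (by unfold sizeBound; linarith)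
      a_pos := h2
      lyapunov := ?_ }
  refine (H.isLyapunovSolution.isLyapunovOperator ?_ ?_).2.2
  · rw [H.norm_lyap]
    unfold sizeBound
    linarith
  · have h9 := pow_le_pow_left₀ (norm_nonneg _) H.norm_Abar_le 2
    have h10 := mul_le_mul_of_nonneg_left h9 (show 0 ≤ 4 * (2 * S.a)⁻¹ by positivity)
    have h11 : 4 * (2 * S.a)⁻¹ * (2 * S.CA) ^ 2 = 8 * S.CA ^ 2 / S.a := by
      field_simp
      norm_num
    rw [H.norm_lyap]
    unfold sizeBound
    linarith

theorem le_alphaInf : min (S.a * ((2 * S.a)⁻¹ * (2 * S.CA) ^ 2 *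
    sizeBound tmix S.a S.CA S.noiseSup)⁻¹) (2 * S.a)⁻¹ ≤ S.alphaInf := by
  have h2 := H.a_pos
  have hD := H.one_le_sizeBound
  obtain ⟨h3, h4⟩ := H.errorSystem.lyapunov.wOpNorm_mem (zero_lt_one.trans_le hD)
  change _ ≤ min (1 / 2 * ((wOpNorm S.lyap S.Abar) ^ 2)⁻¹ * ‖clm S.lyap‖⁻¹) ‖clm S.lyap‖
  rw [H.norm_lyap] at h4 ⊢
  refine min_le_min ?_ le_rfl
  rw [inv_inv]
  have h5 : wOpNorm S.lyap S.Abar ^ 2 ≤ (2 * S.a)⁻¹ * (2 * S.CA) ^ 2 *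
      sizeBound tmix S.a S.CA S.noiseSup := by
    refine h4.trans ?_
    have := pow_le_pow_left₀ (norm_nonneg _) H.norm_Abar_le 2
    gcongr
  have h6 : ((2 * S.a)⁻¹ * (2 * S.CA) ^ 2 * sizeBound tmix S.a S.CA S.noiseSup)⁻¹ ≤
      (wOpNorm S.lyap S.Abar ^ 2)⁻¹ := inv_anti₀ (by positivity) h5
  have := mul_le_mul_of_nonneg_left h6 h2.le
  linarith

theorem blockLen_pos : 0 < S.blockLen := by
  have h1 := H.CA_pos
  have h2 := H.a_pos
  have h3 := H.kappa_pos
  rw [blockLen]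
  exact_mod_cast Int.ceil_pos.2 (by positivity)

theorem stepBound_pos :
    0 < stepBound d tmix S.a S.kappa S.CA (sizeBound tmix S.a S.CA S.noiseSup) := by
  have h1 := H.CA_pos
  have h2 := H.a_pos
  have h3 := H.kappa_pos
  have h4 : (0 : ℝ) < (⌈8 * Real.sqrt S.kappa * S.CA / S.a⌉ : ℤ) := H.blockLen_pos
  have h5 := zero_lt_one.trans_le H.one_le_sizeBound
  have h6 : (0 : ℝ) < tmix := by exact_mod_cast H.tmix_pos
  have h7 : 0 ≤ Real.log d := Real.log_natCast_nonneg d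
  have h8 := Real.sqrt_pos.2 h3
  unfold stepBound
  refine mul_pos (lt_min (lt_min (mul_pos (lt_min (lt_min (lt_min ?_ ?_) ?_) ?_) ?_)
    (lt_min ?_ ?_)) ?_) ?_ <;> positivity

/-- Every entry of the minimum is either independent of p or proportional to 1/p, so multiplication
by p ≥ 1 leaves a positive lower bound independent of p. The upper bounds come from the entries
1/(ap) and 1/(1 + CA). -/
theorem alphaB_mem {p : ℝ} (hp : 1 ≤ p) :
    stepBound d tmix S.a S.kappa S.CA (sizeBound tmix S.a S.CA S.noiseSup) ≤
      S.alphaB tmix p * p ∧ S.a * S.alphaB tmix p * p ≤ 1 ∧ S.alphaB tmix p ≤ 1 := by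
  have h1 := H.CA_pos
  have h2 := H.a_pos
  have h4 := H.blockLen_pos
  have h6 : (1 : ℝ) ≤ tmix := by exact_mod_cast H.tmix_pos
  have h7 : 0 ≤ Real.log d := Real.log_natCast_nonneg d
  have h8 : (tmix : ℝ)⁻¹ ≤ 1 := inv_le_one_of_one_le₀ h6
  have h9 : 0 ≤ (tmix : ℝ)⁻¹ := by positivity
  have hp0 : 0 < p := by linarith
  refine ⟨?_, ?_, ?_⟩
  · have hX := mul_le_mul_of_nonneg_right
      (min_le_min (min_le_min H.le_alphaInf (le_refl ((Real.sqrt S.kappa)⁻¹ * S.CA⁻¹)))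
        (le_refl (S.a / (6 * Real.exp 1 * S.kappa * S.CA)))) (inv_nonneg.2 h4.le)
    set X := min (min (min (S.a * ((2 * S.a)⁻¹ * (2 * S.CA) ^ 2 *
      sizeBound tmix S.a S.CA S.noiseSup)⁻¹) (2 * S.a)⁻¹)
        ((Real.sqrt S.kappa)⁻¹ * S.CA⁻¹)) (S.a / (6 * Real.exp 1 * S.kappa * S.CA)) *
          S.blockLen⁻¹ with hXdef
    set m := min (min X (min (S.a / (12 * S.CGamma) / (1 + Real.log d)) (1 / (1 + S.CA))))
      (1 / S.a) with hm
    have hstep : stepBound d tmix S.a S.kappa S.CA (sizeBound tmix S.a S.CA S.noiseSup) =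
        m * (tmix : ℝ)⁻¹ := rfl
    have hm0 : 0 ≤ m := by
      have := H.stepBound_pos
      rw [hstep] at this
      exact (pos_of_mul_pos_left this h9).le
    have hmp : m / p ≤ m := div_le_self hm0 hp
    rw [hstep, alphaB, mul_right_comm]
    refine mul_le_mul_of_nonneg_right ?_ h9
    rw [← div_le_iff₀ hp0, alphaM]
    refine le_min (le_min (le_min ?_ ?_) ?_) ?_
    · exact hmp.trans (((min_le_left _ _).trans (min_le_left _ _)).trans hX)
    · rw [mul_comm p, ← div_div]
      exact div_le_div_of_nonneg_right
        ((min_le_left _ _).trans ((min_le_right _ _).trans (min_le_left _ _))) hp0.le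
    · exact hmp.trans ((min_le_left _ _).trans ((min_le_right _ _).trans (min_le_right _ _)))
    · rw [← div_div]
      exact div_le_div_of_nonneg_right (min_le_right _ _) hp0.le
  · have h10 : S.alphaB tmix p ≤ 1 / (S.a * p) := by
      rw [alphaB]
      have h11 : 0 ≤ 1 / (S.a * p) := by positivity
      exact (mul_le_mul_of_nonneg_right (min_le_right _ _) h9).trans
        (mul_le_of_le_one_right h11 h8)
    rw [mul_right_comm, mul_comm]
    rwa [le_div_iff₀ (by positivity)] at h10
  · have h11 : 0 ≤ 1 / (1 + S.CA) := by positivity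
    have h12 : 1 / (1 + S.CA) ≤ 1 := by
      rw [div_le_one (by linarith)]
      linarith
    rw [alphaB]
    exact ((mul_le_mul_of_nonneg_right ((min_le_left _ _).trans (min_le_right _ _)) h9).trans
        (mul_le_of_le_one_right h11 h8)).trans h12

end Assumptions

end LSA

/-! ### Scalar estimates for the averaged bound. -/

section Scalar

/-- Dividing the fluctuation bound by the length `m` of the averaging window. -/
theorem averaged_bound_le {r p m T E Δ R D c₀ αb α : ℝ} (hr : 1 ≤ r) (hp : 1 ≤ p) (hD : 0 ≤ D)
    (hc₀ : 0 < c₀) (hαb : c₀ ≤ αb * p) (hαb1 : αb ≤ 1) (hα : α = αb * (r ^ 2)⁻¹)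
    (hm : r ^ 4 / 2 ≤ m) (hm' : m ≤ r ^ 4) (hT : 0 ≤ T) (hE : 0 ≤ E) (hΔ : 0 ≤ Δ) (hR : 0 ≤ R) :
    m⁻¹ * (5 * (α⁻¹ * R) + 6 * (D * R) + 4 * (α * (m * (D ^ 2 * R))) + 2 * D +
      6 * Real.sqrt (p * (m * T + Δ * (E * Real.sqrt (p * m)))) +
      6 * Real.sqrt (p * (Δ * (m * (D * (3 * R)) ^ 2)))) ≤
    6 * Real.sqrt (2 * (p * T)) * (r ^ 2)⁻¹ +
      (10 / c₀ + 12 * D + 4 * D ^ 2 + 36 * (D * Real.sqrt Δ)) * (R * p * (r ^ 2)⁻¹) +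
      (4 * D + 12 * Real.sqrt (Δ * E)) * (p * (r ^ 3)⁻¹) := by
  have hr0 : 0 < r := by linarith
  have hp0 : 0 < p := by linarith
  have hm0 : 0 < m := lt_of_lt_of_le (by positivity) hm
  have hαb0 : 0 < αb := pos_of_mul_pos_left (hc₀.trans_le hαb) hp0.le
  have hα0 : 0 < α := by
    rw [hα]
    positivity
  have hmi : m⁻¹ ≤ 2 * (r ^ 4)⁻¹ := by
    rw [← div_eq_mul_inv, inv_le_iff_one_le_mul₀ hm0, mul_comm, ← mul_div_assoc,
      le_div_iff₀ (by positivity)]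
    linarith
  have hr42 : (r ^ 4)⁻¹ ≤ (r ^ 2)⁻¹ :=
    inv_anti₀ (by positivity) (pow_le_pow_right₀ hr (by norm_num))
  have hr43 : (r ^ 4)⁻¹ ≤ (r ^ 3)⁻¹ :=
    inv_anti₀ (by positivity) (pow_le_pow_right₀ hr (by norm_num))
  have hmi2 : m⁻¹ ≤ 2 * (r ^ 2)⁻¹ := by linarith
  have hi2 : 0 < (r ^ 2)⁻¹ := by positivity
  have hi3 : 0 < (r ^ 3)⁻¹ := by positivity
  have hsm : Real.sqrt m ≤ r ^ 2 := by
    rw [← Real.sqrt_sq (show 0 ≤ r ^ 2 by positivity)]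
    exact Real.sqrt_le_sqrt (by linarith [show (r ^ 2) ^ 2 = r ^ 4 by ring])
  have h1 : m⁻¹ * (5 * (α⁻¹ * R)) ≤ 10 / c₀ * (R * p * (r ^ 2)⁻¹) := by
    have h2 : m⁻¹ * α⁻¹ ≤ 2 * (p / c₀ * (r ^ 2)⁻¹) := by
      have h3 : α⁻¹ ≤ p / c₀ * r ^ 2 := by
        rw [hα, mul_inv, inv_inv]
        refine mul_le_mul_of_nonneg_right ?_ (by positivity)
        rw [inv_le_iff_one_le_mul₀ hαb0, mul_comm, ← mul_div_assoc, le_div_iff₀ hc₀]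
        linarith
      have h4 := mul_le_mul hmi h3 (inv_nonneg.2 hα0.le) (by positivity)
      have h5 : 2 * (r ^ 4)⁻¹ * (p / c₀ * r ^ 2) = 2 * (p / c₀ * (r ^ 2)⁻¹) := by
        field_simp
      linarith
    have h6 := mul_le_mul_of_nonneg_left h2 (show 0 ≤ 5 * R by positivity)
    have h7 : 5 * R * (2 * (p / c₀ * (r ^ 2)⁻¹)) = 10 / c₀ * (R * p * (r ^ 2)⁻¹) := by ring
    linarith
  have h2 : m⁻¹ * (6 * (D * R)) ≤ 12 * D * (R * p * (r ^ 2)⁻¹) := by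
    have h3 := mul_le_mul_of_nonneg_right hmi2 (show 0 ≤ 6 * (D * R) by positivity)
    have h4 := mul_le_mul_of_nonneg_left hp (show 0 ≤ 12 * D * (R * (r ^ 2)⁻¹) by positivity)
    linarith
  have h3 : m⁻¹ * (4 * (α * (m * (D ^ 2 * R)))) ≤ 4 * D ^ 2 * (R * p * (r ^ 2)⁻¹) := by
    have h4 : m⁻¹ * (4 * (α * (m * (D ^ 2 * R)))) = 4 * D ^ 2 * (R * αb * (r ^ 2)⁻¹) := by
      rw [hα]
      field_simp
    have h5 := mul_le_mul_of_nonneg_left (hαb1.trans hp)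
      (show 0 ≤ 4 * D ^ 2 * (R * (r ^ 2)⁻¹) by positivity)
    linarith
  have h4 : m⁻¹ * (2 * D) ≤ 4 * D * (p * (r ^ 3)⁻¹) := by
    have h5 := mul_le_mul_of_nonneg_right (hmi.trans (mul_le_mul_of_nonneg_left hr43 zero_le_two))
      (show 0 ≤ 2 * D by positivity)
    have h6 := mul_le_mul_of_nonneg_left hp (show 0 ≤ 4 * D * (r ^ 3)⁻¹ by positivity)
    linarith
  have h5 : Real.sqrt (p * (m * T + Δ * (E * Real.sqrt (p * m)))) ≤
      Real.sqrt (2 * (p * T)) * (m * (r ^ 2)⁻¹) +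
        Real.sqrt (Δ * E) * (2 * p * m * (r ^ 3)⁻¹) := by
    have h6 : Real.sqrt (p * m) ≤ p * r ^ 2 := by
      rw [Real.sqrt_mul hp0.le]
      refine mul_le_mul ?_ hsm (Real.sqrt_nonneg _) hp0.le
      rw [Real.sqrt_le_left hp0.le]
      nlinarith
    -- The square of each summand dominates one of the two terms under the root, by r⁴ ≤ 2m; the
    -- cross term is discarded.
    refine Real.sqrt_le_iff.2 ⟨by positivity, ?_⟩
    have h7 : r ^ 4 ≤ 2 * m := by linarith
    have h8 : p * (m * T) ≤ (Real.sqrt (2 * (p * T)) * (m * (r ^ 2)⁻¹)) ^ 2 := by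
      rw [mul_pow, Real.sq_sqrt (by positivity)]
      have h9 : 2 * (p * T) * (m * (r ^ 2)⁻¹) ^ 2 = p * (m * T) * (2 * m / r ^ 4) := by
        field_simp
      rw [h9]
      refine le_mul_of_one_le_right (by positivity) ?_
      rwa [one_le_div (by positivity)]
    have h10 : p * (Δ * (E * Real.sqrt (p * m))) ≤
        (Real.sqrt (Δ * E) * (2 * p * m * (r ^ 3)⁻¹)) ^ 2 := by
      rw [mul_pow, Real.sq_sqrt (by positivity)]
      have h11 : Δ * E * (2 * p * m * (r ^ 3)⁻¹) ^ 2 =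
          p * (Δ * (E * (p * r ^ 2))) * (2 * m / r ^ 4) ^ 2 := by
        field_simp
      rw [h11]
      have h12 : 1 ≤ 2 * m / r ^ 4 := by rwa [one_le_div (by positivity)]
      calc p * (Δ * (E * Real.sqrt (p * m))) ≤ p * (Δ * (E * (p * r ^ 2))) := by gcongr
        _ ≤ _ := le_mul_of_one_le_right (by positivity) (one_le_pow₀ h12)
    have h13 : 0 ≤ Real.sqrt (2 * (p * T)) * (m * (r ^ 2)⁻¹) *
        (Real.sqrt (Δ * E) * (2 * p * m * (r ^ 3)⁻¹)) := by positivity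
    nlinarith
  have h5' : m⁻¹ * (6 * Real.sqrt (p * (m * T + Δ * (E * Real.sqrt (p * m))))) ≤
      6 * Real.sqrt (2 * (p * T)) * (r ^ 2)⁻¹ + 12 * Real.sqrt (Δ * E) * (p * (r ^ 3)⁻¹) := by
    have h6 := mul_le_mul_of_nonneg_left h5 (show 0 ≤ m⁻¹ * 6 by positivity)
    have h7 : m⁻¹ * 6 * (Real.sqrt (2 * (p * T)) * (m * (r ^ 2)⁻¹) +
        Real.sqrt (Δ * E) * (2 * p * m * (r ^ 3)⁻¹)) =
      6 * Real.sqrt (2 * (p * T)) * (r ^ 2)⁻¹ + 12 * Real.sqrt (Δ * E) * (p * (r ^ 3)⁻¹) := by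
      field_simp
      ring
    linarith
  have h6 : m⁻¹ * (6 * Real.sqrt (p * (Δ * (m * (D * (3 * R)) ^ 2)))) ≤
      36 * (D * Real.sqrt Δ) * (R * p * (r ^ 2)⁻¹) := by
    have h7 : Real.sqrt (p * (Δ * (m * (D * (3 * R)) ^ 2))) ≤
        p * (Real.sqrt Δ * (r ^ 2 * (D * (3 * R)))) := by
      rw [Real.sqrt_mul hp0.le, Real.sqrt_mul hΔ, Real.sqrt_mul hm0.le,
        Real.sqrt_sq (by positivity)]
      have : Real.sqrt p ≤ p := by
        rw [Real.sqrt_le_left hp0.le]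
        nlinarith
      gcongr
    have h8 := mul_le_mul hmi h7 (Real.sqrt_nonneg _) (by positivity)
    have h9 : 2 * (r ^ 4)⁻¹ * (p * (Real.sqrt Δ * (r ^ 2 * (D * (3 * R))))) =
        6 * (D * Real.sqrt Δ) * (R * p * (r ^ 2)⁻¹) := by
      field_simp
      ring
    linarith
  linarith

/-- The root is at most 2 + y^{3/2}, by comparison at y = 2. Since ℓ stays above ℓ₀, inserting the
factor ℓ^{5/2} costs only ℓ₀^{-5/2}. -/
theorem sqrt_two_add_le {y ℓ ℓ₀ : ℝ} (hy : 0 ≤ y) (hℓ₀ : 0 < ℓ₀) (hℓ : ℓ₀ ≤ ℓ) :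
    Real.sqrt (2 + y) ≤
      (2 + (ℓ₀ ^ (5 / 2 : ℝ))⁻¹) * (1 + y ^ (3 / 2 : ℝ) * ℓ ^ (5 / 2 : ℝ)) := by
  have h1 : Real.sqrt (2 + y) ≤ 2 + y ^ (3 / 2 : ℝ) := by
    have h0 : 0 ≤ y ^ (3 / 2 : ℝ) := by positivity
    rcases le_total y 2 with h | h
    · refine (Real.sqrt_le_left (by positivity)).2 ?_
      nlinarith
    · have h2 : y ≤ y ^ (3 / 2 : ℝ) := by
        conv_lhs => rw [← Real.rpow_one y]
        exact Real.rpow_le_rpow_of_exponent_le (by linarith) (by norm_num)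
      refine (Real.sqrt_le_left (by positivity)).2 ?_
      nlinarith
  have h2 : 1 ≤ (ℓ₀ ^ (5 / 2 : ℝ))⁻¹ * ℓ ^ (5 / 2 : ℝ) := by
    rw [inv_mul_eq_div, one_le_div (by positivity)]
    exact Real.rpow_le_rpow hℓ₀.le hℓ (by norm_num)
  have h3 := mul_le_mul_of_nonneg_left h2 (show 0 ≤ y ^ (3 / 2 : ℝ) by positivity)
  have hℓ0 : 0 ≤ ℓ := hℓ₀.le.trans hℓ
  have h4 : 0 ≤ y ^ (3 / 2 : ℝ) * ℓ ^ (5 / 2 : ℝ) := by positivity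
  have h5 : 0 ≤ (ℓ₀ ^ (5 / 2 : ℝ))⁻¹ := by positivity
  linarith

/-- Subadditivity suffices, so neither set has to be measurable. -/
theorem one_sub_le_measureReal {Ω : Type*} [MeasurableSpace Ω] {μ : Measure Ω}
    [IsProbabilityMeasure μ] {s t : Set Ω} (hst : ∀ ω, ω ∉ t → ω ∈ s) {δ : ℝ} (hδ : 0 ≤ δ)
    (ht : μ t ≤ ENNReal.ofReal δ) : 1 - δ ≤ μ.real s := by
  have h1 : (1 : ℝ) ≤ μ.real s + μ.real t := by
    rw [← probReal_univ (μ := μ)]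
    refine (measureReal_mono (fun ω _ => ?_) (measure_ne_top _ _)).trans (measureReal_union_le s t)
    by_cases h : ω ∈ t
    · exact Or.inr h
    · exact Or.inl (hst ω h)
  have h2 : μ.real t ≤ δ := ENNReal.toReal_le_of_le_ofReal hδ ht
  linarith

end Scalar

/-- The constant in front of `q β` in the moment bound of order `q` for the step size `β`. -/
noncomputable def driftConst (a D : ℝ) : ℝ := 496 * D ^ 6 / a + 2 * D ^ 3

/-- The deterministic bound is used as long as `n^{3/4}` is at most this multiple of `p`. -/
noncomputable def cutoff (a D : ℝ) : ℝ :=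
  (2 * (driftConst a D + a + 124 * D ^ 3) * (5 + 1 / a)) ^ 3 + 2

/-- The constant in front of the size of the iterates in the averaged bound. -/
noncomputable def iterConst (d : ℕ) (D c₀ : ℝ) : ℝ :=
  10 / c₀ + 12 * D + 4 * D ^ 2 + 36 * (D * Real.sqrt d)

/-- The constant in front of `p n^{-3/4}` in the averaged bound. -/
noncomputable def fluctConst (d tmix : ℕ) (c D : ℝ) : ℝ :=
  4 * D + 12 * Real.sqrt (d * (16 * (c * mixConst tmix) ^ 2 +
    8 * (4 * (c * mixConst tmix) ^ 2 * mixConst tmix) + 1))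

/-! ### The averaged error for small and for large n. -/

namespace ErrorSystem

variable {Z : Type*} [MeasurableSpace Z] {d : ℕ} {Q : Kernel Z Z} [IsMarkovKernel Q]
  {π : Measure Z} [IsProbabilityMeasure π] {tmix : ℕ} {A : Z → Vec d →L[ℝ] Vec d}
  {Abar : Vec d →L[ℝ] Vec d} {ε : Z → Vec d} {P : Vec d →L[ℝ] Vec d} {c D a : ℝ}
  (H : ErrorSystem Q π tmix A Abar ε P c D a)

include H

theorem driftConst_pos : 0 < driftConst a D := by
  have h1 := H.a_pos
  have h2 := H.D_pos
  unfold driftConst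
  positivity

theorem two_le_cutoff : 2 ≤ cutoff a D := by
  have h1 := H.a_pos
  have h2 := H.D_pos
  have h3 := H.driftConst_pos
  have h4 : 0 ≤ (2 * (driftConst a D + a + 124 * D ^ 3) * (5 + 1 / a)) ^ 3 := by positivity
  unfold cutoff
  linarith

theorem sum_asympVar_nonneg : 0 ≤ ∑ i, asympVar Q π (fun z => ε z i) := by
  refine Finset.sum_nonneg fun i _ => ?_
  have hεi : Measurable fun z => ε z i :=
    (EuclideanSpace.proj (𝕜 := ℝ) i).continuous.measurable.comp H.stronglyMeasurable_ε.measurable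
  refine (asympVar_mem (c := c) H.tmix_pos H.mixing H.invariant hεi (fun z => ?_) ?_).1
  · exact (PiLp.norm_apply_le _ i).trans (H.noise_le z)
  · have h1 : Integrable ε π :=
      Integrable.of_bound H.stronglyMeasurable_ε.aestronglyMeasurable _ (.of_forall H.noise_le)
    have h2 := (EuclideanSpace.proj (𝕜 := ℝ) i).integral_comp_comm h1
    rw [H.integral_ε] at h2
    simpa using h2

/-- A sure bound. Here nα = αb·r² ≤ αb·r³ ≤ cutoff/a, so the exponential growth of the iterates is
bounded by a constant. -/
theorem norm_average_rrErr_le {p αb α r : ℝ} (hαb : 0 ≤ αb)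
    (hap : a * αb * p ≤ 1) (hα : α = αb * (r ^ 2)⁻¹) {n₀ n : ℕ} (hn₀ : n₀ < n) (hr1 : 1 ≤ r)
    (hr : r ^ 4 = n) (hsmall : r ^ 3 ≤ cutoff a D * p) (e₀ : Vec d) (ω : ℕ → Z) :
    ‖((n : ℝ) - n₀)⁻¹ • Abar (∑ k ∈ Finset.Ico n₀ n, rrErr A ε α e₀ ω k)‖ ≤
      3 * D * Real.exp (2 * D * (cutoff a D / a)) * (‖e₀‖ + 1) := by
  have ha := H.a_pos
  have hD := H.D_pos
  have hr0 : 0 < r := by linarith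
  have hα0 : 0 ≤ α := by
    rw [hα]
    positivity
  have hm : 0 < (n : ℝ) - n₀ := by
    have : (n₀ : ℝ) < n := by exact_mod_cast hn₀
    linarith
  have h1 : n * α ≤ cutoff a D / a := by
    have h2 : n * α = αb * r ^ 2 := by
      rw [hα, ← hr]
      field_simp
    rw [h2, le_div_iff₀ ha]
    have h3 : r ^ 2 ≤ cutoff a D * p := (pow_le_pow_right₀ hr1 (by norm_num)).trans hsmall
    have h4 := mul_le_mul_of_nonneg_left h3 (show 0 ≤ αb * a by positivity)
    have h5 := mul_le_mul_of_nonneg_left hap (show 0 ≤ cutoff a D by linarith [H.two_le_cutoff])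
    linarith
  have h2 : ∀ k ∈ Finset.Ico n₀ n, ‖rrErr A ε α e₀ ω k‖ ≤
      3 * Real.exp (2 * D * (cutoff a D / a)) * (‖e₀‖ + 1) := fun k hk => by
    have hkn : (k : ℝ) ≤ n := by exact_mod_cast (Finset.mem_Ico.1 hk).2.le
    have hb : ∀ β, 0 ≤ β → β ≤ 2 * α → ‖errIter A ε β e₀ ω k‖ ≤
        Real.exp (2 * D * (cutoff a D / a)) * (‖e₀‖ + 1) := fun β hβ hβ' => by
      refine (norm_errIter_le hβ H.one_le H.A_le (fun z => (H.noise_le z).trans H.le_D) e₀ ω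
        k).trans ?_
      refine mul_le_mul_of_nonneg_right (Real.exp_le_exp.2 ?_) (by positivity)
      calc (k : ℝ) * (β * D) ≤ n * (2 * α * D) := by gcongr
        _ = 2 * D * (n * α) := by ring
        _ ≤ _ := by gcongr
    have h3 := hb α hα0 (by linarith)
    have h4 := hb (2 * α) (by positivity) le_rfl
    rw [rrErr]
    refine (norm_sub_le _ _).trans ?_
    rw [norm_smul, Real.norm_of_nonneg zero_le_two]
    linarith
  rw [norm_smul, norm_inv, Real.norm_of_nonneg hm.le, inv_mul_le_iff₀ hm]
  refine (Abar.le_of_opNorm_le H.Abar_le _).trans ?_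
  have h3 := (norm_sum_le_of_le _ h2)
  rw [Finset.sum_const, Nat.card_Ico, nsmul_eq_mul, Nat.cast_sub hn₀.le] at h3
  have h4 := mul_le_mul_of_nonneg_left h3 hD.le
  linarith

/-- Since αb ≤ 1 and αb·p ≤ 1/a, the product (p + y + 1)α is at most (5 + 1/a)/r. The cube in
`cutoff` is chosen so that r exceeds the constant needed. -/
theorem step_small {p αb α r y : ℝ} (hp : 2 ≤ p) (hαb : 0 ≤ αb) (hαb1 : αb ≤ 1)
    (hap : a * αb * p ≤ 1) (hα : α = αb * (r ^ 2)⁻¹) (hr1 : 1 ≤ r) (hy : y ≤ 4 * r)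
    (hbig : cutoff a D * p < r ^ 3) :
    2 * (driftConst a D + a + 124 * D ^ 3) * ((p + y + 1) * α) ≤ 1 := by
  have ha := H.a_pos
  have hD := H.D_pos
  have hC := H.driftConst_pos
  have hr0 : 0 < r := by linarith
  set r₀ := 2 * (driftConst a D + a + 124 * D ^ 3) * (5 + 1 / a) with hr₀
  have hr₀0 : 0 ≤ r₀ := by positivity
  have h1 : r₀ ≤ r := by
    refine le_of_pow_le_pow_left₀ (n := 3) (by norm_num) hr0.le ?_
    have h2 := mul_le_mul_of_nonneg_left (show 1 ≤ p by linarith)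
      (show 0 ≤ cutoff a D by linarith [H.two_le_cutoff])
    have h3 : cutoff a D = r₀ ^ 3 + 2 := rfl
    linarith
  have h2 : (p + y + 1) * α ≤ (5 + 1 / a) * r⁻¹ := by
    have h3 : p * αb ≤ 1 / a := by
      rw [le_div_iff₀ ha]
      linarith
    have h4 : (y + 1) * αb ≤ 5 * r := by
      have h5 : (y + 1) * αb ≤ 5 * r * αb := mul_le_mul_of_nonneg_right (by linarith) hαb
      exact h5.trans (mul_le_of_le_one_right (by positivity) hαb1)
    have h5 : 1 / a ≤ 1 / a * r := le_mul_of_one_le_right (by positivity) hr1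
    have h6 : (p + y + 1) * αb ≤ (5 + 1 / a) * r := by linarith
    have h7 := mul_le_mul_of_nonneg_right h6 (show 0 ≤ (r ^ 2)⁻¹ by positivity)
    have h8 : (5 + 1 / a) * r * (r ^ 2)⁻¹ = (5 + 1 / a) * r⁻¹ := by field_simp
    rw [hα]
    linarith
  have h3 := mul_le_mul_of_nonneg_left h2
    (show 0 ≤ 2 * (driftConst a D + a + 124 * D ^ 3) by positivity)
  rw [← mul_assoc _ (5 + 1 / a), ← hr₀] at h3
  refine h3.trans ?_
  rw [← div_eq_mul_inv, div_le_one hr0]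
  exact h1

theorem measure_norm_average_rrErr_le [NeZero d] {ξ : Measure Z} [IsProbabilityMeasure ξ]
    {p αb α r c₀ : ℝ} (hp : 2 ≤ p) (hc₀ : 0 < c₀) (hαb : c₀ ≤ αb * p) (hαb1 : αb ≤ 1)
    (hap : a * αb * p ≤ 1) (hα : α = αb * (r ^ 2)⁻¹) {n : ℕ} (hr1 : 1 ≤ r) (hr : r ^ 4 = n)
    (hbig : cutoff a D * p < r ^ 3) (e₀ : Vec d) :
    chainLaw Q ξ {ω | 6 * Real.sqrt (2 * (p * ∑ i, asympVar Q π (fun z => ε z i))) * (r ^ 2)⁻¹ +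
      iterConst d D c₀ * (60 * D * Real.exp (-(a * αb * r ^ 2 / 24)) * ‖e₀‖ * (p * (r ^ 2)⁻¹) +
        20 * D * Real.sqrt (6 * driftConst a D / a) * Real.sqrt (2 + Real.log n) *
          (p * (r ^ 3)⁻¹)) +
      fluctConst d tmix c D * (p * (r ^ 3)⁻¹) <
        ‖((n : ℝ) - (n / 2 : ℕ))⁻¹ • Abar (∑ k ∈ Finset.Ico (n / 2) n, rrErr A ε α e₀ ω k)‖} ≤
      ENNReal.ofReal (4 * Real.exp (-p)) := by
  have ha := H.a_pos
  have hD := H.D_pos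
  have hD1 := H.one_le
  have hC := H.driftConst_pos
  have hr0 : 0 < r := by linarith
  have hp0 : 0 < p := by linarith
  have hαb0 : 0 < αb := pos_of_mul_pos_left (hc₀.trans_le hαb) hp0.le
  have hα0 : 0 < α := by
    rw [hα]
    positivity
  have hr3 : 2 * p < r ^ 3 :=
    (mul_le_mul_of_nonneg_right H.two_le_cutoff hp0.le).trans_lt hbig
  have hr34 : r ^ 3 ≤ r ^ 4 := pow_le_pow_right₀ hr1 (by norm_num)
  have hn2 : 2 ≤ n := by
    have : (2 : ℝ) ≤ n := by linarith
    exact_mod_cast this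
  have hn₀ : 1 ≤ n / 2 := by omega
  have hy : Real.log n ≤ 4 * r := by
    rw [← hr, Real.log_pow]
    have := Real.log_le_self hr0.le
    push_cast
    linarith
  have hy0 : 0 ≤ Real.log n := Real.log_natCast_nonneg n
  have hsmall := H.step_small hp hαb0.le hαb1 hap hα hr1 hy hbig
  -- The moment order whose tail e^{-q} survives a union bound over n times; it is at most p + log n
  -- + 1.
  set q := ⌈p + Real.log n⌉₊ with hq
  have hq1 : p + Real.log n ≤ q := Nat.le_ceil _
  have hq2 : (q : ℝ) ≤ p + Real.log n + 1 := (Nat.ceil_lt_add_one (by positivity)).le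
  have hq3 : 2 ≤ q := by
    have : (2 : ℝ) ≤ q := by linarith
    exact_mod_cast this
  have hqα : q * α ≤ (p + Real.log n + 1) * α := mul_le_mul_of_nonneg_right hq2 hα0.le
  have hpα : α ≤ (p + Real.log n + 1) * α := le_mul_of_one_le_left hα0.le (by linarith)
  set X := (p + Real.log n + 1) * α with hX
  have hX0 : 0 ≤ X := hα0.le.trans hpα
  have e1 : 0 ≤ a * X := by positivity
  have e2 : 0 ≤ driftConst a D * X := by positivity
  have e3 : 0 ≤ D ^ 3 * X := by positivity
  have hm : r ^ 4 / 2 ≤ (n : ℝ) - (n / 2 : ℕ) := by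
    have : ((n / 2 : ℕ) : ℝ) ≤ n / 2 := Nat.cast_div_le
    rw [hr]
    linarith
  have hm' : (n : ℝ) - (n / 2 : ℕ) ≤ r ^ 4 := by
    rw [hr]
    linarith [Nat.cast_nonneg (α := ℝ) (n / 2)]
  have hm0 : 0 < (n : ℝ) - (n / 2 : ℕ) := lt_of_lt_of_le (by positivity) hm
  set l := driftConst a D * (q * (2 * α)) with hl
  have hl0 : 0 ≤ l := by positivity
  set R := 20 * D * (Real.exp (-(a * α * (n / 2 : ℕ) / 8)) * ‖e₀‖ + Real.sqrt l) with hR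
  have hR0 : 0 ≤ R := by positivity
  have hmain := H.measure_norm_sum_rrErr_le (ξ := ξ) (α := α) hα0
    (by
      have := mul_le_mul_of_nonneg_left hpα (show 0 ≤ D ^ 3 by positivity)
      linarith)
    (C₃ := driftConst a D)
    (by
      unfold driftConst
      rw [add_mul, div_mul_cancel₀ _ ha.ne']
      have : 0 ≤ 2 * D ^ 3 * a := by positivity
      linarith)
    (by
      unfold driftConst
      have : 0 ≤ 496 * D ^ 6 / a := by positivity
      linarith) hq3 hl
    (by
      have := mul_le_mul_of_nonneg_left hqα hC.le
      rw [hl]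
      linarith)
    (by
      have := mul_le_mul_of_nonneg_left hqα ha.le
      linarith) e₀ hn₀ (by omega : n / 2 ≤ n) (p := p) (by linarith) (by linarith) hq1 rfl rfl hR
  refine (measure_mono fun ω hω => ?_).trans hmain
  have hω' := Set.mem_ofPred.1 hω
  refine Set.mem_ofPred.2 ?_
  rw [norm_smul, norm_inv, Real.norm_of_nonneg hm0.le, ← div_eq_inv_mul, lt_div_iff₀ hm0] at hω'
  refine lt_of_le_of_lt ?_ hω'
  rw [← div_le_iff₀ hm0, div_eq_inv_mul]
  have hc : 0 ≤ c := by
    obtain ⟨z⟩ := nonempty_of_isProbabilityMeasure π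
    exact (norm_nonneg _).trans (H.noise_le z)
  have hmc := mixConst_nonneg tmix
  have hT := H.sum_asympVar_nonneg
  refine (averaged_bound_le (αb := αb) hr1 (by linarith) hD.le hc₀ hαb hαb1 hα hm hm' hT
    (by positivity) (Nat.cast_nonneg d) hR0).trans ?_
  refine add_le_add (add_le_add le_rfl (mul_le_mul_of_nonneg_left ?_ ?_)) le_rfl
  -- The burn-in n/2 gives the rate 1/16 up to the rounding of n/2. The slack to 1/24 is generous,
  -- and the rounding costs at most a factor e ≤ 3.
  · have hexp : Real.exp (-(a * α * (n / 2 : ℕ) / 8)) ≤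
        3 * Real.exp (-(a * αb * r ^ 2 / 24)) := by
      have h1 : (n : ℝ) / 2 - 1 / 2 ≤ (n / 2 : ℕ) := by
        have : (n : ℝ) ≤ 2 * (n / 2 : ℕ) + 1 := by exact_mod_cast (by omega : n ≤ 2 * (n / 2) + 1)
        linarith
      have h2 : a * α * n = a * αb * r ^ 2 := by
        rw [hα, ← hr]
        field_simp
      have h3 : a * α ≤ 1 := by
        have := mul_le_mul_of_nonneg_left hpα ha.le
        linarith
      have h4 := mul_le_mul_of_nonneg_left h1 (show 0 ≤ a * α by positivity)
      have h5 : 0 ≤ a * αb * r ^ 2 := by positivity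
      calc Real.exp (-(a * α * (n / 2 : ℕ) / 8))
          ≤ Real.exp (1 + -(a * αb * r ^ 2 / 24)) := Real.exp_le_exp.2 (by linarith)
        _ = Real.exp 1 * Real.exp (-(a * αb * r ^ 2 / 24)) := Real.exp_add _ _
        _ ≤ _ := mul_le_mul_of_nonneg_right (by linarith [Real.exp_one_lt_d9])
            (Real.exp_pos _).le
    have hsl : Real.sqrt l ≤
        Real.sqrt (6 * driftConst a D / a) * Real.sqrt (2 + Real.log n) * r⁻¹ := by
      have h1 : l ≤ 6 * driftConst a D / a * (2 + Real.log n) * (r ^ 2)⁻¹ := by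
        have h2 : X ≤ 3 / a * (2 + Real.log n) * (r ^ 2)⁻¹ := by
          have h3 : (p + Real.log n + 1) * αb ≤ 3 / a * (2 + Real.log n) := by
            have h4 : p + Real.log n + 1 ≤ p * (2 + Real.log n) := by nlinarith
            have h5 := mul_le_mul_of_nonneg_right h4 hαb0.le
            have h6 : p * αb ≤ 1 / a := by
              rw [le_div_iff₀ ha]
              linarith
            have h7 := mul_le_mul_of_nonneg_right h6 (show 0 ≤ 2 + Real.log n by linarith)
            have h8 : 0 ≤ 2 / a * (2 + Real.log n) := by positivity
            have h9 : 3 / a * (2 + Real.log n) =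
              1 / a * (2 + Real.log n) + 2 / a * (2 + Real.log n) := by ring
            linarith
          have h4 := mul_le_mul_of_nonneg_right h3 (show 0 ≤ (r ^ 2)⁻¹ by positivity)
          rw [hX, hα]
          linarith
        have h3 := mul_le_mul_of_nonneg_left (hqα.trans h2) (show 0 ≤ 2 * driftConst a D by positivity)
        have h4 : 2 * driftConst a D * (3 / a * (2 + Real.log n) * (r ^ 2)⁻¹) =
          6 * driftConst a D / a * (2 + Real.log n) * (r ^ 2)⁻¹ := by ring
        rw [hl]
        linarith
      refine (Real.sqrt_le_sqrt h1).trans (le_of_eq ?_)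
      rw [Real.sqrt_mul (by positivity), Real.sqrt_mul (by positivity), Real.sqrt_inv,
        Real.sqrt_sq hr0.le]
    have h1 : R ≤ 20 * D * (3 * Real.exp (-(a * αb * r ^ 2 / 24)) * ‖e₀‖ +
        Real.sqrt (6 * driftConst a D / a) * Real.sqrt (2 + Real.log n) * r⁻¹) := by
      rw [hR]
      gcongr
    have h2 := mul_le_mul_of_nonneg_right h1 (show 0 ≤ p * (r ^ 2)⁻¹ by positivity)
    have h3 : (r ^ 3)⁻¹ = r⁻¹ * (r ^ 2)⁻¹ := by
      rw [← mul_inv]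
      ring
    rw [h3]
    linarith
  · positivity

end ErrorSystem

/-! ### Confidence levels and assembly of the constants. -/

section Constants

/-- The ratio of `log (3 e / δ)` to `log (1 / δ)` is at most this for `δ ≤ δ₀`. -/
noncomputable def logRatio (δ₀ : ℝ) : ℝ := 1 + (Real.log 3 + 1) / Real.log (1 / δ₀)

/-- With p = log(3e/δ) the four exceptional events have total probability at most 4e^{-p} = 4δ/(3e)
≤ δ, and p ≥ 2 since log 3 ≥ 1. -/
theorem log_confidence {δ₀ δ : ℝ} (hδ₀ : δ₀ < 1) (hδ : 0 < δ) (hδδ₀ : δ ≤ δ₀) :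
    0 < Real.log (1 / δ₀) ∧ Real.log (1 / δ₀) ≤ Real.log (1 / δ) ∧
      2 ≤ Real.log (3 * Real.exp 1 / δ) ∧
      Real.log (3 * Real.exp 1 / δ) ≤ logRatio δ₀ * Real.log (1 / δ) ∧
      4 * Real.exp (-Real.log (3 * Real.exp 1 / δ)) ≤ δ := by
  have hδ₀0 : 0 < δ₀ := hδ.trans_le hδδ₀
  have h0 : 0 < Real.log (1 / δ₀) := Real.log_pos (by rwa [one_lt_div hδ₀0])
  have h1 : Real.log (1 / δ₀) ≤ Real.log (1 / δ) :=
    Real.log_le_log (by positivity) (one_div_le_one_div_of_le hδ hδδ₀)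
  have h2 : Real.log (3 * Real.exp 1 / δ) = Real.log 3 + 1 + Real.log (1 / δ) := by
    rw [div_eq_mul_one_div, Real.log_mul (by positivity) (by positivity),
      Real.log_mul (by norm_num) (Real.exp_pos 1).ne', Real.log_exp]
  have h3 : 1 ≤ Real.log 3 := by
    rw [Real.le_log_iff_exp_le (by norm_num)]
    linarith [Real.exp_one_lt_d9]
  refine ⟨h0, h1, by rw [h2]; linarith, ?_, ?_⟩
  · have h4 : Real.log 3 + 1 ≤ (Real.log 3 + 1) / Real.log (1 / δ₀) * Real.log (1 / δ) := by
      rw [div_mul_eq_mul_div, le_div_iff₀ h0]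
      exact mul_le_mul_of_nonneg_left h1 (by linarith)
    rw [h2, logRatio]
    linarith
  · rw [Real.exp_neg, Real.exp_log (by positivity), inv_div, ← mul_div_assoc,
      div_le_iff₀ (by positivity), mul_comm]
    exact mul_le_mul_of_nonneg_left (by linarith [Real.exp_one_gt_d9]) hδ.le

/-- When r³ ≤ cut·p, the factors ℓ/r³ and ℓ/r² are bounded below by constants. So is the
exponential, because aαb·r² ≤ aαb·cut·p ≤ cut; both terms on the right therefore dominate a constant
bound. -/
theorem crude_bound_le {r p b ℓ cut a αb w e G : ℝ} (hr : 1 ≤ r) (hp : 0 < p) (hb : p ≤ b * ℓ)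
    (hcut : 0 ≤ cut) (hsmall : r ^ 3 ≤ cut * p) (hap : a * αb * p ≤ 1) (haαb : 0 ≤ a * αb)
    (hw : 0 ≤ w) (he : 0 ≤ e) (hG : 0 ≤ G) :
    G * (e + 1) ≤ b * (G * cut * Real.exp (cut / 24)) * ((1 + w) * ℓ * (r ^ 3)⁻¹ +
      (r ^ 2)⁻¹ * ℓ * e * Real.exp (-(a * αb * r ^ 2 / 24))) := by
  have hr0 : 0 < r := by linarith
  have hbℓ : 0 < b * ℓ := hp.trans_le hb
  have hr23 : r ^ 2 ≤ r ^ 3 := pow_le_pow_right₀ hr (by norm_num)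
  have h1 : 1 ≤ cut * (b * ℓ) * (r ^ 3)⁻¹ := by
    rw [← div_eq_mul_inv, one_le_div (by positivity)]
    exact hsmall.trans (mul_le_mul_of_nonneg_left hb hcut)
  have h2 : 1 ≤ cut * (b * ℓ) * (r ^ 2)⁻¹ :=
    h1.trans (mul_le_mul_of_nonneg_left (inv_anti₀ (by positivity) hr23) (by positivity))
  have h3 : 1 ≤ Real.exp (cut / 24) := Real.one_le_exp (by positivity)
  have h4 : 1 ≤ Real.exp (cut / 24) * Real.exp (-(a * αb * r ^ 2 / 24)) := by
    rw [← Real.exp_add]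
    refine Real.one_le_exp ?_
    have h5 := mul_le_mul_of_nonneg_left (hr23.trans hsmall) haαb
    have h6 := mul_le_mul_of_nonneg_left hap hcut
    linarith
  have h5 : 1 ≤ Real.exp (cut / 24) * (cut * (b * ℓ) * (r ^ 3)⁻¹) * (1 + w) :=
    one_le_mul_of_one_le_of_one_le (one_le_mul_of_one_le_of_one_le h3 h1) (by linarith)
  have h6 : 1 ≤ Real.exp (cut / 24) * Real.exp (-(a * αb * r ^ 2 / 24)) *
      (cut * (b * ℓ) * (r ^ 2)⁻¹) := one_le_mul_of_one_le_of_one_le h4 h2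
  have h7 := mul_le_mul_of_nonneg_left h5 hG
  have h8 := mul_le_mul_of_nonneg_left h6 (mul_nonneg hG he)
  linarith

/-- Each p is traded for bℓ. In the leading term this happens inside the square root, so only √b
enters there. -/
theorem fine_bound_le {r p b ℓ T I D X e s y J w F : ℝ} (hr : 0 < r) (hb : p ≤ b * ℓ)
    (hb0 : 0 ≤ b) (hℓ : 0 ≤ ℓ) (hp : 0 ≤ p) (hT : 0 ≤ T) (hI : 0 ≤ I) (hD : 0 ≤ D) (hX : 0 ≤ X)
    (he : 0 ≤ e) (hs : 0 ≤ s) (hJ : Real.sqrt (2 + y) ≤ J * (1 + w)) (hJ0 : 0 ≤ J) (hw : 0 ≤ w)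
    (hF : 0 ≤ F) :
    6 * Real.sqrt (2 * (p * T)) * (r ^ 2)⁻¹ + I * (60 * D * X * e * (p * (r ^ 2)⁻¹) +
        20 * D * s * Real.sqrt (2 + y) * (p * (r ^ 3)⁻¹)) + F * (p * (r ^ 3)⁻¹) ≤
      6 * Real.sqrt (2 * b) * Real.sqrt (T * ℓ) * (r ^ 2)⁻¹ +
        (b * (60 * I * D) + b * (20 * I * D * s * J + F)) *
          ((1 + w) * ℓ * (r ^ 3)⁻¹ + (r ^ 2)⁻¹ * ℓ * e * X) := by
  have h1 : Real.sqrt (2 * (p * T)) ≤ Real.sqrt (2 * b) * Real.sqrt (T * ℓ) := by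
    rw [← Real.sqrt_mul (by positivity)]
    refine Real.sqrt_le_sqrt ?_
    have := mul_le_mul_of_nonneg_right hb hT
    linarith
  have h2 := mul_le_mul_of_nonneg_right h1 (show 0 ≤ 6 * (r ^ 2)⁻¹ by positivity)
  have h3 := mul_le_mul_of_nonneg_left hb (show 0 ≤ I * (60 * D * X * e * (r ^ 2)⁻¹) by positivity)
  have h4 := mul_le_mul hJ hb hp (by positivity)
  have h5 := mul_le_mul_of_nonneg_left h4 (show 0 ≤ I * (20 * D * s * (r ^ 3)⁻¹) by positivity)
  have h6 := mul_le_mul_of_nonneg_left hb (show 0 ≤ F * (r ^ 3)⁻¹ by positivity)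
  have h7 : 0 ≤ F * (b * ℓ * (r ^ 3)⁻¹) * w := by positivity
  have h8 : 0 ≤ b * (60 * I * D) * ((1 + w) * ℓ * (r ^ 3)⁻¹) := by positivity
  have h9 : 0 ≤ b * (20 * I * D * s * J + F) * ((r ^ 2)⁻¹ * ℓ * e * X) := by positivity
  linarith

/-- The constant in front of the remainder terms. -/
noncomputable def remainderConst (δ₀ : ℝ) (d tmix : ℕ) (a κ CA εsup : ℝ) : ℝ :=
  logRatio δ₀ * (3 * sizeBound tmix a CA εsup * Real.exp (2 * sizeBound tmix a CA εsup *
      (cutoff a (sizeBound tmix a CA εsup) / a)) * cutoff a (sizeBound tmix a CA εsup) *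
        Real.exp (cutoff a (sizeBound tmix a CA εsup) / 24)) +
    (logRatio δ₀ * (60 * iterConst d (sizeBound tmix a CA εsup)
        (stepBound d tmix a κ CA (sizeBound tmix a CA εsup)) * sizeBound tmix a CA εsup) +
      logRatio δ₀ * (20 * iterConst d (sizeBound tmix a CA εsup)
        (stepBound d tmix a κ CA (sizeBound tmix a CA εsup)) * sizeBound tmix a CA εsup *
          Real.sqrt (6 * driftConst a (sizeBound tmix a CA εsup) / a) *
            (2 + (Real.log (1 / δ₀) ^ (5 / 2 : ℝ))⁻¹) +
        fluctConst d tmix (noiseBound CA εsup) (sizeBound tmix a CA εsup)))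

end Constants

theorem LSA.Assumptions.one_sub_le_measureReal_error {Z : Type*} [MeasurableSpace Z] {d tmix : ℕ}
    [NeZero d] {S : LSA Z d} (H : S.Assumptions tmix) (ξ : Measure Z) [IsProbabilityMeasure ξ]
    {δ₀ δ : ℝ} (hδ₀ : δ₀ < 1) (hδ : 0 < δ) (hδδ₀ : δ ≤ δ₀) {n : ℕ} (hn : 1 ≤ n) (θ₀ : Vec d)
    {p αb α : ℝ} (hp : p = Real.log (3 * Real.exp 1 / δ)) (hαb : αb = S.alphaB tmix p)
    (hα : α = αb * (n : ℝ) ^ (-(1 / 2) : ℝ)) :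
    1 - δ ≤ (chainLaw S.Q ξ).real
      {z | ‖act S.Abar (S.rrAverage α θ₀ (n / 2) n z - S.thetaStar)‖ ≤
        6 * Real.sqrt (2 * logRatio δ₀) * Real.sqrt (S.noiseCov.trace * Real.log (1 / δ)) *
          (n : ℝ) ^ (-(1 / 2) : ℝ) +
        remainderConst δ₀ d tmix S.a S.kappa S.CA S.noiseSup *
          ((1 + Real.log n ^ (3 / 2 : ℝ) * Real.log (1 / δ) ^ (5 / 2 : ℝ))
              * Real.log (1 / δ) * (n : ℝ) ^ (-(3 / 4) : ℝ)
            + (n : ℝ) ^ (-(1 / 2) : ℝ) * Real.log (1 / δ) * ‖θ₀ - S.thetaStar‖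
              * Real.exp (-(S.a * αb * (n : ℝ) ^ (1 / 2 : ℝ) / 24)))} := by
  obtain ⟨hℓ₀, hℓ, hp2, hpb, hpδ⟩ := log_confidence hδ₀ hδ hδδ₀
  rw [← hp] at hp2 hpb hpδ
  obtain ⟨h1, h2, h3⟩ := H.alphaB_mem (p := p) (by linarith)
  have hc₀ := H.stepBound_pos
  have hE := H.errorSystem
  have hT := hE.sum_asympVar_nonneg
  have ha := hE.a_pos
  have hD := hE.D_pos
  have hcut := hE.two_le_cutoff
  have hdrift := hE.driftConst_pos
  rw [← hαb] at h1 h2 h3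
  have hTr : S.noiseCov.trace = ∑ i, asympVar S.Q S.statLaw (fun z => S.noise z i) := rfl
  set r : ℝ := (n : ℝ) ^ (1 / 4 : ℝ) with hr
  have hn1 : (1 : ℝ) ≤ n := by exact_mod_cast hn
  have hr1 : 1 ≤ r := Real.one_le_rpow hn1 (by norm_num)
  have hr0 : 0 < r := by linarith
  have hpow : ∀ k : ℕ, r ^ k = (n : ℝ) ^ ((k : ℝ) / 4) := fun k => by
    rw [hr, ← Real.rpow_natCast, ← Real.rpow_mul (by linarith)]
    congr 1
    ring
  have hr4 : r ^ 4 = n := by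
    rw [hpow]
    norm_num
  have e1 : (n : ℝ) ^ (-(1 / 2) : ℝ) = (r ^ 2)⁻¹ := by
    rw [hpow, ← Real.rpow_neg (by linarith)]
    norm_num
  have e2 : (n : ℝ) ^ (-(3 / 4) : ℝ) = (r ^ 3)⁻¹ := by
    rw [hpow, ← Real.rpow_neg (by linarith)]
    norm_num
  have e3 : (n : ℝ) ^ (1 / 2 : ℝ) = r ^ 2 := by
    rw [hpow]
    norm_num
  rw [e1] at hα
  rw [e1, e2, e3, hTr]
  have hp0 : 0 < p := by linarith
  have hαb0 : 0 < αb := pos_of_mul_pos_left (hc₀.trans_le h1) hp0.le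
  have hn2 : n / 2 < n := by omega
  have hlog : 0 ≤ Real.log n := Real.log_natCast_nonneg n
  have hℓ' : 0 < Real.log (1 / δ) := hℓ₀.trans_le hℓ
  have hb : 0 < logRatio δ₀ := pos_of_mul_pos_left (hp0.trans_le hpb) hℓ'.le
  have hw : 0 ≤ Real.log n ^ (3 / 2 : ℝ) * Real.log (1 / δ) ^ (5 / 2 : ℝ) := by positivity
  have hiter : 0 ≤ iterConst d (sizeBound tmix S.a S.CA S.noiseSup)
      (stepBound d tmix S.a S.kappa S.CA (sizeBound tmix S.a S.CA S.noiseSup)) := by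
    unfold iterConst
    positivity
  have hfluct : 0 ≤ fluctConst d tmix (noiseBound S.CA S.noiseSup)
      (sizeBound tmix S.a S.CA S.noiseSup) := by
    unfold fluctConst
    positivity
  have hJ : 0 ≤ 2 + (Real.log (1 / δ₀) ^ (5 / 2 : ℝ))⁻¹ := by positivity
  simp_rw [H.act_rrAverage_sub α θ₀ hn2]
  have hX : 0 ≤ (1 + Real.log n ^ (3 / 2 : ℝ) * Real.log (1 / δ) ^ (5 / 2 : ℝ)) *
      Real.log (1 / δ) * (r ^ 3)⁻¹ + (r ^ 2)⁻¹ * Real.log (1 / δ) * ‖θ₀ - S.thetaStar‖ *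
        Real.exp (-(S.a * αb * r ^ 2 / 24)) := by positivity
  -- In the first regime the bound holds for every trajectory, so the exceptional set is empty.
  rcases le_or_gt (r ^ 3) (cutoff S.a (sizeBound tmix S.a S.CA S.noiseSup) * p) with hcase | hcase
  · refine one_sub_le_measureReal (t := ∅) (fun ω _ => Set.mem_ofPred.2 ?_) hδ.le (by simp)
    refine (hE.norm_average_rrErr_le hαb0.le h2 hα hn2 hr1 hr4 hcase _ ω).trans ?_
    refine (crude_bound_le hr1 hp0 hpb (by linarith) hcase h2 (by positivity) hw (norm_nonneg _)
      (by positivity)).trans ?_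
    refine le_trans ?_ (le_add_of_nonneg_left (by positivity))
    rw [remainderConst]
    exact mul_le_mul_of_nonneg_right (le_add_of_nonneg_right (by positivity)) hX
  · refine one_sub_le_measureReal (fun ω hω => Set.mem_ofPred.2 ?_) hδ.le
      ((hE.measure_norm_average_rrErr_le (ξ := ξ) hp2 hc₀ h1 h3 h2 hα hr1 hr4 hcase
        (θ₀ - S.thetaStar)).trans (ENNReal.ofReal_le_ofReal hpδ))
    refine (not_lt.1 fun h => hω (Set.mem_ofPred.2 h)).trans ?_
    refine (fine_bound_le hr0 hpb hb.le hℓ'.le hp0.le hT hiter hD.le (Real.exp_pos _).le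
      (norm_nonneg _) (Real.sqrt_nonneg _) (sqrt_two_add_le hlog hℓ₀ hℓ) hJ hw hfluct).trans ?_
    refine add_le_add le_rfl ?_
    rw [remainderConst]
    exact mul_le_mul_of_nonneg_right (le_add_of_nonneg_left (by positivity)) hX

end MarkovLSA

theorem mainTheorem2 (δ₀ : ℝ) (hδ₀ : 0 < δ₀) (hδ₀' : δ₀ < 1) :
    ∃ K : ℝ, ∃ C : (d tmix : ℕ) → (a κ CA εsup : ℝ) → ℝ,
      ∀ (Z : Type*) [TopologicalSpace Z] [PolishSpace Z] [MeasurableSpace Z] [BorelSpace Z]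
        (d : ℕ) (_ : 1 ≤ d) (tmix : ℕ) (S : MarkovLSA.LSA Z d) (_ : S.Assumptions tmix)
        (ξ : MeasureTheory.Measure Z) (_ : MeasureTheory.IsProbabilityMeasure ξ)
        (θ₀ : MarkovLSA.Vec d) (n : ℕ) (_ : tmix ≤ n) (δ : ℝ) (_ : 0 < δ) (_ : δ ≤ δ₀)
        (p αb α : ℝ) (_ : p = Real.log (3 * Real.exp 1 / δ)) (_ : αb = S.alphaB tmix p)
        (_ : α = αb * (n : ℝ) ^ (-(1 / 2) : ℝ)),
        1 - δ ≤ (MarkovLSA.chainLaw S.Q ξ).real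
          {z | ‖MarkovLSA.act S.Abar (S.rrAverage α θ₀ (n / 2) n z - S.thetaStar)‖ ≤
            K * Real.sqrt (S.noiseCov.trace * Real.log (1 / δ)) * (n : ℝ) ^ (-(1 / 2) : ℝ)
            + C d tmix S.a S.kappa S.CA S.noiseSup *
              ((1 + Real.log n ^ (3 / 2 : ℝ) * Real.log (1 / δ) ^ (5 / 2 : ℝ))
                  * Real.log (1 / δ) * (n : ℝ) ^ (-(3 / 4) : ℝ)
                + (n : ℝ) ^ (-(1 / 2) : ℝ) * Real.log (1 / δ) * ‖θ₀ - S.thetaStar‖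
                  * Real.exp (-(S.a * αb * (n : ℝ) ^ (1 / 2 : ℝ) / 24)))} := by
  -- In K, the 6 comes from the dimension-free tail, the 2 from a window of length at least n/2, and
  -- `logRatio` from replacing p by log(1/δ).
  refine ⟨6 * Real.sqrt (2 * MarkovLSA.logRatio δ₀), MarkovLSA.remainderConst δ₀, ?_⟩
  intro Z _ _ _ _ d hd tmix S H ξ _ θ₀ n hn δ hδ hδδ₀ p αb α hp hαb hα
  have : NeZero d := ⟨by omega⟩
  exact H.one_sub_le_measureReal_error ξ hδ₀' hδ hδδ₀ (H.tmix_pos.trans hn) θ₀ hp hαb hα
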